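/- **Setting.** Let $1\le m\le n$, let $A\in\mathbb R^{m\times n}$ have full row rank, $b\in\mathbb R^m$, $\Omega=\{x\in\mathbb R^n: Ax=b,\ x\ge 0\}$ and $\Omega^\circ=\{x: Ax=b,\ x>0\}$. Let $f$ be continuous on $\{x\ge0\}$, differentiable on $\{x>0\}$ and concave on $\Omega^\circ$, with a minimizer $x^*$ over $\Omega$. For $0<\varepsilon\le 1$ put $\phi(x)=f(x)-\varepsilon\sum_{i=1}^n\ln x_i$, write $X=\mathrm{diag}(x)$, let $\|\cdot\|$ be the Euclidean norm, and let $L_\phi>0$ satisfy $\|X\nabla\phi(x)\|\le L_\phi$ for all $x\in\Omega^\circ$. Let $x_0\in\Omega^\circ$ and $C_0$ satisfy $-\sum_i\ln x_i\ge-\sum_i\ln x_{0,i}-C_0$ for all $x\in\Omega^\circ$. A point $x$ is an $\eta$-KKT point if $x\in\Omega^\circ$ and there are $\lambda\in\mathbb R^m$, $s\in\mathbb R^n_{\ge0}$ with $\|\nabla f(x)+A^\top\lambda-s\|_\infty\le\eta$ and $|x_is_i|\le\eta$ for all $i$. **Algorithm** (approximate first-order IPTR). Let $0<\beta\le\frac12$,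 $\delta=\frac{(1-\beta)\varepsilon}{184L_\phi}$, $T=\max\Bigl(0,\Bigl\lceil\frac{2\,(f(x_0)-f(x^*)+(C_0-1)\varepsilon)}{\varepsilon\beta(1-\beta)}\Bigr\rceil\Bigr)$ and $\bar x_0=x_0$. For $t=0,\dots,T-1$: put $X_t=\mathrm{diag}(x_t)$, $\bar X_t=\mathrm{diag}(\bar x_t)$, $$R_t=I-X_t^{-1}\bar X_t^2A^\top(A\bar X_t^2A^\top)^{-1}AX_t,\qquad r_t=R_tX_t\nabla\phi(x_t);$$ let $\tilde d_t=0$ if $r_t=0$ and $\tilde d_t=-\beta r_t/\|r_t\|$ otherwise; let $x_{t+1}=x_t+X_t\tilde d_t$; if $\phi(x_{t+1})-\phi(x_t)>-\frac12\varepsilon\beta(1-\beta)$, return $x_t$; otherwise compute $\bar x_{t+1}$ from $\bar x_t$ as follows (SelectVector). With $L=\lceil\log_2 n\rceil$, set $\bar x_{t+1,i}=x_{t+1,i}$ if $2^{L}\mid t+1$, or if for some $0\le l<L$ with $2^l\mid t+1$ one has $|\ln x_{t+1,i}-\ln x_{t+1-2^l,i}|\ge\delta/(2L)$; set $\bar x_{t+1,i}=\bar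 x_{t,i}$ otherwise. If the loop ends without returning, return $x_T$. **Theorem.** 1. For all $\beta\in(0,\frac12]$, $C_0$ and $\Delta$ there is a constant $K$, depending only on $\beta,C_0,\Delta$, such that in every such setting with $f(x_0)-f(x^*)\le\Delta$ the algorithm terminates within $K/\varepsilon$ iterations and returns a point $x$ that is a $2\varepsilon$-KKT point or satisfies $f(x)-f(x^*)\le\varepsilon$. 2. Let $2\le\omega<\frac52$ be such that two real $k\times k$ matrices can be multiplied by arithmetic straight-line programs of length $O(k^\omega)$. Then the algorithm has an implementation (a family of algebraic computation trees over $\mathbb R$, one for each triple $(m,n,T)$, with input $A,x_0,\varepsilon,\beta,\delta$, where each operation $+,-,\times,/,\sqrt{\cdot},\ln$, each loading of a real constant and each comparison costs one step, and each evaluation of $f$ or of $\nabla f$ by an oracle costs $n+1$ steps) which returns exactly the output of the algorithm and takes $\widetilde{\mathcal O}(nm^{\omega-1}+nm/\varepsilon^2)$ steps. That is, for all $\beta\in(0,\frac12]$, $L_\phi>0$, $C_0$, $\Delta$ there are constants $K,p$, depending only on these numbers, on $\omega$ and on the implementation, such that in every such setting with $f(x_0)-f(x^*)\le\Delta$ the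 number of steps is at most $$K\Bigl(nm^{\omega-1}+\frac{nm}{\varepsilon^2}\Bigr)\Bigl(1+\ln\frac n\varepsilon\Bigr)^p .$$ -/

import Mathlib

open scoped Matrix

noncomputable section

namespace IPTR

/-! ### The optimization problem  min f(x)  subject to  A x = b, x ≥ 0 -/

/-- `ℝⁿ` with the Euclidean norm. -/
abbrev E (n : ℕ) : Type := EuclideanSpace ℝ (Fin n)

variable {m n : ℕ}

/-- The feasible set `Ω = {x : A x = b, x ≥ 0}`. -/
def feasibleSet (A : Matrix (Fin m) (Fin n) ℝ) (b : Fin m → ℝ) : Set (E n) :=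
  {x | A *ᵥ x.ofLp = b ∧ ∀ i, 0 ≤ x i}

/-- The strictly feasible set `Ω° = {x : A x = b, x > 0}`. -/
def strictlyFeasibleSet (A : Matrix (Fin m) (Fin n) ℝ) (b : Fin m → ℝ) : Set (E n) :=
  {x | A *ᵥ x.ofLp = b ∧ ∀ i, 0 < x i}

/-- The vector `X d`, where `X = diag x`. -/
def scale (x d : E n) : E n := WithLp.toLp 2 fun i => x i * d i

/-- The potential function `φ(x) = f(x) - ε ∑ ln x_i`. -/
def potential (ε : ℝ) (f : E n → ℝ) (x : E n) : ℝ := f x - ε * ∑ i, Real.log (x i)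

/-- `x` is an `η`-KKT point of the problem `min f(x)` subject to `A x = b`, `x ≥ 0`: it is strictly
feasible and there are multipliers `lam ∈ ℝᵐ` and `s ≥ 0` with
`‖∇f(x) + Aᵀ lam - s‖_∞ ≤ η` and `|x_i s_i| ≤ η` for all `i`. -/
def IsApproxKKT (A : Matrix (Fin m) (Fin n) ℝ) (b : Fin m → ℝ) (f : E n → ℝ) (η : ℝ)
    (x : E n) : Prop :=
  x ∈ strictlyFeasibleSet A b ∧
    ∃ (lam : Fin m → ℝ) (s : Fin n → ℝ), (∀ i, 0 ≤ s i) ∧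
      (∀ i, |gradient f x i + (Aᵀ *ᵥ lam) i - s i| ≤ η) ∧ ∀ i, |x i * s i| ≤ η

/-- The standing assumptions on the problem, together with the concavity of `f` on `Ω°` and the
bound `‖X ∇φ(x)‖ ≤ Lφ` on `Ω°`. -/
structure ConcaveSetting (A : Matrix (Fin m) (Fin n) ℝ) (b : Fin m → ℝ) (f : E n → ℝ)
    (ε Lφ C₀ : ℝ) (x₀ xstar : E n) : Prop where
  /-- `A` has full row rank. -/
  fullRowRank : LinearIndependent ℝ A.row
  continuousOn : ContinuousOn f {x | ∀ i, 0 ≤ x i}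
  differentiableAt : ∀ x : E n, (∀ i, 0 < x i) → DifferentiableAt ℝ f x
  concaveOn : ConcaveOn ℝ (strictlyFeasibleSet A b) f
  /-- The scaled gradient of the potential function is bounded by `Lφ`. -/
  scaledGradient_le : ∀ x ∈ strictlyFeasibleSet A b,
    ‖scale x (gradient (potential ε f) x)‖ ≤ Lφ
  /-- `x₀` is an approximate analytic center, with constant `C₀`. -/
  start_mem : x₀ ∈ strictlyFeasibleSet A b
  start_center : ∀ x ∈ strictlyFeasibleSet A b,
    -∑ i, Real.log (x₀ i) - C₀ ≤ -∑ i, Real.log (x i)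
  /-- `xstar` is a global minimizer of `f` over `Ω`. -/
  star_mem : xstar ∈ feasibleSet A b
  star_min : ∀ x ∈ feasibleSet A b, f xstar ≤ f x

/-! ### The approximate first-order interior-point trust-region algorithm -/

/-- The update rule `SelectVector`. Given the old approximation `ybar` and the stream of vectors
`y 0, …, y t`, coordinate `i` of the approximation is refreshed to `y t i` if, for some level
`l < ⌈log₂ n⌉` with `2 ^ l ∣ t`, it has moved by at least `δ / (2 ⌈log₂ n⌉)` since time
`t - 2 ^ l`; at the top level `l = ⌈log₂ n⌉`, that is if `2 ^ ⌈log₂ n⌉ ∣ t`, all coordinates are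
refreshed. It is called only with `1 ≤ t`, so that `2 ^ l ≤ t` in the subtraction. -/
def selectVector (δ : ℝ) (ybar : Fin n → ℝ) (y : ℕ → Fin n → ℝ) (t : ℕ) : Fin n → ℝ :=
  open Classical in
  fun i =>
    if 2 ^ Nat.clog 2 n ∣ t ∨ ∃ l < Nat.clog 2 n, 2 ^ l ∣ t ∧
        δ / (2 * (Nat.clog 2 n : ℝ)) ≤ |y t i - y (t - 2 ^ l) i|
    then y t i else ybar i

/-- The approximate projection `R = I - X⁻¹ X̄² Aᵀ (A X̄² Aᵀ)⁻¹ A X`. -/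
def approxProjection (A : Matrix (Fin m) (Fin n) ℝ) (x xbar : E n) : Matrix (Fin n) (Fin n) ℝ :=
  1 - (Matrix.diagonal x.ofLp)⁻¹ * Matrix.diagonal xbar.ofLp ^ 2 * Aᵀ *
    (A * Matrix.diagonal xbar.ofLp ^ 2 * Aᵀ)⁻¹ * A * Matrix.diagonal x.ofLp

/-- The data of a run of the algorithm: constraint matrix, objective, barrier parameter `ε`,
trust-region radius `β`, accuracy `δ` of the maintained scaling, and starting point. -/
structure RunData (m n : ℕ) where
  A : Matrix (Fin m) (Fin n) ℝ
  f : E n → ℝ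
  ε : ℝ
  β : ℝ
  δ : ℝ
  x₀ : E n

/-- The approximately projected vector `R X ∇φ(x)`. -/
def RunData.projectedGradient (D : RunData m n) (x xbar : E n) : E n :=
  WithLp.toLp 2
    (approxProjection D.A x xbar *ᵥ (scale x (gradient (potential D.ε D.f) x)).ofLp)

/-- The search direction: `0` if `R X ∇φ(x) = 0`, and `-β R X ∇φ(x) / ‖R X ∇φ(x)‖` otherwise. -/
def RunData.direction (D : RunData m n) (x xbar : E n) : E n :=
  open Classical in
  if D.projectedGradient x xbar = 0 then 0
  else -(D.β / ‖D.projectedGradient x xbar‖) • D.projectedGradient x xbar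

/-- The state after `t` updates: the iterates found so far (the first component at `s ≤ t` is
`x_s`), and the maintained approximation `x̄_t` of `x_t`. One update is
`x_{t+1} = x_t + X_t d_t`, `ln x̄_{t+1} = SelectVector(ln x̄_t, ln x_0, …, ln x_{t+1}, δ)`. -/
def RunData.state (D : RunData m n) : ℕ → (ℕ → E n) × E n
  | 0 => (fun _ => D.x₀, D.x₀)
  | t + 1 =>
    let old := D.state t
    let xt := old.1 t
    let hist := Function.update old.1 (t + 1) (xt + scale xt (D.direction xt old.2))
    (hist, WithLp.toLp 2 fun i =>
      Real.exp (selectVector D.δ (fun j => Real.log (old.2 j))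
        (fun s j => Real.log (hist s j)) (t + 1) i))

/-- The iterate `x_t`. -/
def RunData.iterate (D : RunData m n) (t : ℕ) : E n := (D.state t).1 t

/-- The stopping test at `t`: the potential does not decrease by at least `ε β (1 - β) / 2`. -/
def RunData.Stops (D : RunData m n) (t : ℕ) : Prop :=
  potential D.ε D.f (D.iterate (t + 1)) - potential D.ε D.f (D.iterate t) >
    -(D.ε * D.β * (1 - D.β) / 2)

/-- The main loop, entered at time `t` with at most `k` iterations left. It returns a point and the
total number of iterations executed. -/
def RunData.loop (D : RunData m n) : ℕ → ℕ → E n × ℕ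
  | 0, t => (D.iterate t, t)
  | k + 1, t =>
    open Classical in
    if D.Stops t then (D.iterate t, t + 1) else D.loop k (t + 1)

/-- The point returned by the algorithm with iteration limit `T`. -/
def RunData.output (D : RunData m n) (T : ℕ) : E n := (D.loop T 0).1

/-- The number of iterations executed by the algorithm with iteration limit `T`. -/
def RunData.iterations (D : RunData m n) (T : ℕ) : ℕ := (D.loop T 0).2

/-- The run in the concave case, with `δ = (1 - β) ε / (184 Lφ)`. -/
def concaveRun (A : Matrix (Fin m) (Fin n) ℝ) (f : E n → ℝ) (ε β Lφ : ℝ) (x₀ : E n) :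
    RunData m n where
  A := A
  f := f
  ε := ε
  β := β
  δ := (1 - β) * ε / (184 * Lφ)
  x₀ := x₀

/-- The iteration limit in the concave case, where `gap = f(x₀) - f(x*)`:
`T = ⌈2 (gap + (C₀ - 1) ε) / (ε β (1 - β))⌉`, and `T = 0` if this is negative. -/
def concaveLimit (ε β C₀ gap : ℝ) : ℕ :=
  ⌈2 * (gap + (C₀ - 1) * ε) / (ε * β * (1 - β))⌉₊

/-! ### The machine model: algebraic computation trees over `ℝ` with oracles for `f` and `∇f` -/

/-- Registers that can be read: read-only input registers, indexed by `ι`, and work registers,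
indexed by `ℕ`. -/
abbrev Reg (ι : Type) : Type := ι ⊕ ℕ

/-- Arithmetic instructions; the result is written to the work register `dst`. -/
inductive Arith (ι : Type) : Type
  | const (dst : ℕ) (c : ℝ)
  | add (dst : ℕ) (a b : Reg ι)
  | sub (dst : ℕ) (a b : Reg ι)
  | mul (dst : ℕ) (a b : Reg ι)
  | div (dst : ℕ) (a b : Reg ι)

/-- Effect of an arithmetic instruction on the work registers `w`, for the input `inp`. -/
def Arith.exec {ι : Type} (inp : ι → ℝ) (w : ℕ → ℝ) : Arith ι → ℕ → ℝ
  | .const dst c => Function.update w dst c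
  | .add dst a b => Function.update w dst (Sum.elim inp w a + Sum.elim inp w b)
  | .sub dst a b => Function.update w dst (Sum.elim inp w a - Sum.elim inp w b)
  | .mul dst a b => Function.update w dst (Sum.elim inp w a * Sum.elim inp w b)
  | .div dst a b => Function.update w dst (Sum.elim inp w a / Sum.elim inp w b)

/-- A straight-line program with inputs indexed by `ι` and outputs indexed by `κ`. Its cost is the
length of `code`. -/
structure StraightLine (ι κ : Type) where
  code : List (Arith ι)
  out : κ → Reg ι

/-- The output of a straight-line program; all work registers start at `0`. -/
def StraightLine.run {ι κ : Type} (S : StraightLine ι κ) (inp : ι → ℝ) (k : κ) : ℝ :=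
  Sum.elim inp (S.code.foldl (Arith.exec inp) 0) (S.out k)

/-- `ω` is an exponent of matrix multiplication: two real `k × k` matrices can be multiplied by
straight-line programs with `O(k ^ ω)` arithmetic operations. -/
def IsMatMulExponent (ω : ℝ) : Prop :=
  ∃ C : ℝ, ∀ k : ℕ,
    ∃ S : StraightLine ((Fin k × Fin k) ⊕ (Fin k × Fin k)) (Fin k × Fin k),
      (S.code.length : ℝ) ≤ C * (k : ℝ) ^ ω ∧
      ∀ (X Y : Matrix (Fin k) (Fin k) ℝ) (i j : Fin k),
        S.run (Sum.elim (fun q => X q.1 q.2) fun q => Y q.1 q.2) (i, j) = (X * Y) i j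

/-- Algebraic computation trees with inputs indexed by `ι`, outputs indexed by `κ`, and oracles for
the value and the gradient of a function on `ℝⁿ`. -/
inductive Tree (ι κ : Type) (n : ℕ) : Type
  /-- Stop; output `k` is the content of register `out k`. -/
  | halt (out : κ → Reg ι)
  | arith (c : Arith ι) (next : Tree ι κ n)
  | sqrt (dst : ℕ) (a : Reg ι) (next : Tree ι κ n)
  | log (dst : ℕ) (a : Reg ι) (next : Tree ι κ n)
  /-- Write `f(p)` to the work register `dst`, where `p` is read from the registers `pt`. -/
  | value (dst : ℕ) (pt : Fin n → Reg ι) (next : Tree ι κ n)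
  /-- Write `∇f(p)` to the work registers `dst, …, dst + n - 1`. -/
  | grad (dst : ℕ) (pt : Fin n → Reg ι) (next : Tree ι κ n)
  /-- Continue with `yes` if the content of `a` is at most that of `b`, and with `no` otherwise. -/
  | ifLe (a b : Reg ι) (yes no : Tree ι κ n)

/-- Run a tree from the work registers `w`. The result is the output and the number of steps. Every
arithmetic operation, square root, logarithm and comparison takes one step, every call of an oracle
takes `n + 1` steps. -/
def Tree.runFrom {ι κ : Type} {n : ℕ} (f : E n → ℝ) (inp : ι → ℝ) :
    Tree ι κ n → (ℕ → ℝ) → (κ → ℝ) × ℕ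
  | .halt out, w => (fun k => Sum.elim inp w (out k), 0)
  | .arith c next, w =>
    let r := next.runFrom f inp (c.exec inp w)
    (r.1, r.2 + 1)
  | .sqrt dst a next, w =>
    let r := next.runFrom f inp (Function.update w dst (Real.sqrt (Sum.elim inp w a)))
    (r.1, r.2 + 1)
  | .log dst a next, w =>
    let r := next.runFrom f inp (Function.update w dst (Real.log (Sum.elim inp w a)))
    (r.1, r.2 + 1)
  | .value dst pt next, w =>
    let r := next.runFrom f inp
      (Function.update w dst (f (WithLp.toLp 2 fun j => Sum.elim inp w (pt j))))
    (r.1, r.2 + (n + 1))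
  | .grad dst pt next, w =>
    let g : E n := gradient f (WithLp.toLp 2 fun j => Sum.elim inp w (pt j))
    let r := next.runFrom f inp fun k =>
      if h : dst ≤ k ∧ k < dst + n then g ⟨k - dst, by omega⟩ else w k
    (r.1, r.2 + (n + 1))
  | .ifLe a b yes no, w =>
    open Classical in
    let r := if Sum.elim inp w a ≤ Sum.elim inp w b then yes.runFrom f inp w
      else no.runFrom f inp w
    (r.1, r.2 + 1)

/-- The output of a tree; all work registers start at `0`. -/
def Tree.result {ι κ : Type} {n : ℕ} (P : Tree ι κ n) (f : E n → ℝ) (inp : ι → ℝ) : κ → ℝ :=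
  (P.runFrom f inp 0).1

/-- The number of steps that a tree takes on a given input. -/
def Tree.steps {ι κ : Type} {n : ℕ} (P : Tree ι κ n) (f : E n → ℝ) (inp : ι → ℝ) : ℕ :=
  (P.runFrom f inp 0).2

/-- The input registers of an implementation of the algorithm. -/
inductive Input (m n : ℕ) : Type
  | A (i : Fin m) (j : Fin n)
  | x₀ (j : Fin n)
  | ε
  | β
  | δ

/-- The content of the input registers. -/
def RunData.input (D : RunData m n) : Input m n → ℝ
  | .A i j => D.A i j
  | .x₀ j => D.x₀ j
  | .ε => D.ε
  | .β => D.β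
  | .δ => D.δ

end IPTR

end

/-!
The theorem has two halves, which share the analysis of the iterates.

**Convergence.** On the kernel of `A X` concavity of `f` and `log (1 + d) ≥ d - d ^ 2` for
`|d| ≤ 1 / 2` give the model `φ(x + X d) ≤ φ(x) + ⟪X ∇φ(x), d⟫ + ε ‖d‖ ^ 2`
(`potential_add_scale_le`). If `x̄` agrees with `x` up to factors `e ^ δ`, then `R` differs from the
orthogonal projection `P` onto this kernel by `O(δ)` in norm (`norm_project_sub_project_le`). So
either `‖P X ∇φ(x)‖ ≤ ε`, and the multipliers from the projection show that `x` is a `2 ε`-KKT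
point, or the step decreases `φ` by `ε β (1 - β) / 2` (`isApproxKKT_or_decrease`). A run without
early return has decreased `φ` so often that `f(x_T) - f(x^*) ≤ ε`. The accuracy of `x̄` comes from
the dyadic tests of the vector selection: between the last refresh of a coordinate and the present
there is a walk of dyadic steps, at most two for each level, each of which changes the logarithm by
less than `δ / (2 L)` (`abs_sub_le_of_dyadic`).

**Complexity.** Computation trees are written as programs in continuation-passing style (`Prog`),
and a specification `Spec` records the result of a program together with a bound on its number of
steps. The program keeps the inverse of `A X̄² Aᵀ`. The initial inverse costs `O(n m ^ (ω - 1))`, by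
multiplication in square blocks and recursion on the Schur complement (`spec_gramInv`). If `k`
coordinates of `x̄` are refreshed, the Woodbury formula, applied to at most `m` coordinates at a
time with blocks of size `k`, updates the inverse in `O(n m √k)` steps, where `ω ≤ 5 / 2` is used
(`spec_lowRank`, `updateCost_le_mul_sqrt`). The logarithms of the iterates move by at most `1` per
step in the Euclidean norm, so level `l` refreshes at most `O((2 ^ l L / δ) ^ 2)` coordinates, once
in `2 ^ l` steps; hence the sum of the `√k` is at most `T (1 + 2 L ^ 2 / δ)`
(`sum_sqrt_card_refreshed_le`). As `T` and `1 / δ` are both `O(1 / ε)`, the updates cost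
`O(n m L ^ 2 / ε ^ 2)` altogether.
-/

noncomputable section

namespace IPTR

/-! ### Programs and their specifications -/

section Programs

/-- The memory of a running tree: the contents of the work registers, together with a counter
`fresh` beyond which no register has been used, so that all of them still hold `0`. -/
structure World where
  vals : ℕ → ℝ
  fresh : ℕ
  zero : ∀ i, fresh ≤ i → vals i = 0

/-- `W ≤ W'` if `W'` is a later memory: registers in use in `W` keep their contents. -/
instance : Preorder World where
  le W W' := W.fresh ≤ W'.fresh ∧ ∀ i < W.fresh, W'.vals i = W.vals i
  le_refl W := ⟨le_rfl, fun _ _ => rfl⟩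
  le_trans W₁ W₂ W₃ h h' :=
    ⟨h.1.trans h'.1, fun i hi => (h'.2 i (hi.trans_le h.1)).trans (h.2 i hi)⟩

variable {ι κ α β γ : Type} {n : ℕ}

/-- In the memory `W`, the register `r` is in use and holds `x`. -/
def Rep (inp : ι → ℝ) (W : World) : Reg ι → ℝ → Prop
  | .inl i, x => inp i = x
  | .inr k, x => k < W.fresh ∧ W.vals k = x

variable {inp : ι → ℝ} {f : E n → ℝ} {W W' : World}

lemma Rep.mono {r : Reg ι} {x : ℝ} (h : Rep inp W r x) (hW : W ≤ W') : Rep inp W' r x := by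
  cases r with
  | inl i => exact h
  | inr k => exact ⟨h.1.trans_le hW.1, (hW.2 k h.1).trans h.2⟩

lemma Rep.eval {r : Reg ι} {x : ℝ} (h : Rep inp W r x) : Sum.elim inp W.vals r = x := by
  cases r with
  | inl i => exact h
  | inr k => exact h.2

/-- Tree-building programs in continuation-passing style. A program receives the number of the
first unused work register; it hands its result, typically registers or Booleans obtained from
comparisons, and the updated counter to the rest of the tree. -/
def Prog (ι κ : Type) (n : ℕ) (α : Type) : Type :=
  ℕ → (α → ℕ → Tree ι κ n) → Tree ι κ n

instance : Inhabited (Reg ι) := ⟨.inr 0⟩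

instance : Monad (Prog ι κ n) where
  pure a := fun k cont => cont a k
  bind p q := fun k cont => p k fun a k' => q a k' cont

/-- Total correctness with a cost bound: started in the memory `W`, the program `p` spends at most
`c` steps and passes on a result and a later memory that satisfy `Q`. -/
def Spec (f : E n → ℝ) (inp : ι → ℝ) (p : Prog ι κ n α) (W : World) (Q : α → World → Prop)
    (c : ℝ) : Prop :=
  ∃ (a : α) (W' : World) (k : ℕ), W ≤ W' ∧ Q a W' ∧ (k : ℝ) ≤ c ∧ ∀ cont,
    (p W.fresh cont).runFrom f inp W.vals =
      (((cont a W'.fresh).runFrom f inp W'.vals).1,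
        ((cont a W'.fresh).runFrom f inp W'.vals).2 + k)

variable {p : Prog ι κ n α} {Q Q' : α → World → Prop} {c c' : ℝ}

lemma Spec.weaken (h : Spec f inp p W Q c) (hQ : ∀ a W', W ≤ W' → Q a W' → Q' a W')
    (hc : c ≤ c') : Spec f inp p W Q' c' := by
  obtain ⟨a, W', k, h1, h2, h3, h4⟩ := h
  exact ⟨a, W', k, h1, hQ a W' h1 h2, h3.trans hc, h4⟩

lemma Spec.cost_le (h : Spec f inp p W Q c) (hc : c ≤ c') : Spec f inp p W Q c' :=
  h.weaken (fun _ _ _ h => h) hc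

lemma Spec.pure {a : α} (h : Q a W) : Spec f inp (pure a : Prog ι κ n α) W Q 0 :=
  ⟨a, W, 0, le_rfl, h, by simp, fun _ => rfl⟩

lemma Spec.bind {q : α → Prog ι κ n β} {R : β → World → Prop} (h : Spec f inp p W Q c)
    (hq : ∀ a W', W ≤ W' → Q a W' → Spec f inp (q a) W' R c') :
    Spec f inp (p >>= q) W R (c + c') := by
  obtain ⟨a, W', k, h1, h2, h3, h4⟩ := h
  obtain ⟨b, W'', k', g1, g2, g3, g4⟩ := hq a W' h1 h2
  refine ⟨b, W'', k + k', h1.trans g1, g2, by push_cast; linarith, fun cont => ?_⟩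
  change (p W.fresh fun a k => q a k cont).runFrom f inp W.vals = _
  rw [h4, g4]
  simp only [Prod.mk.injEq, true_and]
  omega

lemma Spec.map {g : α → β} {R : β → World → Prop} (h : Spec f inp p W Q c)
    (hq : ∀ a W', W ≤ W' → Q a W' → R (g a) W') :
    Spec f inp (p >>= fun a => Pure.pure (g a)) W R c := by
  simpa using h.bind fun a W' hW ha => Spec.pure (f := f) (inp := inp) (hq a W' hW ha)

/-- The memory after writing `x` to the first unused register. -/
def World.push (W : World) (x : ℝ) : World where
  vals := Function.update W.vals W.fresh x
  fresh := W.fresh + 1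
  zero i hi := by rw [Function.update_of_ne (by omega)]; exact W.zero i (by omega)

lemma World.le_push (x : ℝ) : W ≤ W.push x :=
  ⟨Nat.le_succ _, fun _ hi => Function.update_of_ne hi.ne _ _⟩

lemma World.rep_push (x : ℝ) : Rep inp (W.push x) (.inr W.fresh) x :=
  ⟨Nat.lt_succ_self _, Function.update_self _ _ _⟩

/-- The program that executes an instruction writing to a fresh register, and returns the latter. -/
def Prog.instr (c : ℕ → Arith ι) : Prog ι κ n (Reg ι) :=
  fun k cont => .arith (c k) (cont (.inr k) (k + 1))

def Prog.const (c : ℝ) : Prog ι κ n (Reg ι) := .instr fun k => .const k c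
def Prog.add (a b : Reg ι) : Prog ι κ n (Reg ι) := .instr fun k => .add k a b
def Prog.sub (a b : Reg ι) : Prog ι κ n (Reg ι) := .instr fun k => .sub k a b
def Prog.mul (a b : Reg ι) : Prog ι κ n (Reg ι) := .instr fun k => .mul k a b
def Prog.div (a b : Reg ι) : Prog ι κ n (Reg ι) := .instr fun k => .div k a b
def Prog.sqrt (a : Reg ι) : Prog ι κ n (Reg ι) :=
  fun k cont => .sqrt k a (cont (.inr k) (k + 1))
def Prog.log (a : Reg ι) : Prog ι κ n (Reg ι) :=
  fun k cont => .log k a (cont (.inr k) (k + 1))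
def Prog.value (pt : Fin n → Reg ι) : Prog ι κ n (Reg ι) :=
  fun k cont => .value k pt (cont (.inr k) (k + 1))
def Prog.grad (pt : Fin n → Reg ι) : Prog ι κ n (Fin n → Reg ι) :=
  fun k cont => .grad k pt (cont (fun j => .inr (k + j)) (k + n))

/-- The program that compares two registers and returns the outcome. -/
def Prog.le (a b : Reg ι) : Prog ι κ n Bool :=
  fun k cont => .ifLe a b (cont true k) (cont false k)

lemma spec_push {p : Prog ι κ n (Reg ι)} {x : ℝ} {k : ℕ}
    (h : ∀ cont, (p W.fresh cont).runFrom f inp W.vals =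
      (((cont (.inr W.fresh) (W.fresh + 1)).runFrom f inp (W.push x).vals).1,
        ((cont (.inr W.fresh) (W.fresh + 1)).runFrom f inp (W.push x).vals).2 + k)) :
    Spec f inp p W (fun r W' => Rep inp W' r x) k :=
  ⟨.inr W.fresh, W.push x, k, W.le_push x, W.rep_push x, le_rfl, h⟩

lemma spec_const (c : ℝ) :
    Spec f inp (.const c : Prog ι κ n _) W (fun r W' => Rep inp W' r c) 1 :=
  mod_cast spec_push (k := 1) fun _ => rfl

variable {a b : Reg ι} {x y : ℝ}

lemma spec_add (ha : Rep inp W a x) (hb : Rep inp W b y) :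
    Spec f inp (.add a b : Prog ι κ n _) W (fun r W' => Rep inp W' r (x + y)) 1 := by
  rw [← ha.eval, ← hb.eval]
  exact mod_cast spec_push (k := 1) fun _ => rfl

lemma spec_sub (ha : Rep inp W a x) (hb : Rep inp W b y) :
    Spec f inp (.sub a b : Prog ι κ n _) W (fun r W' => Rep inp W' r (x - y)) 1 := by
  rw [← ha.eval, ← hb.eval]
  exact mod_cast spec_push (k := 1) fun _ => rfl

lemma spec_mul (ha : Rep inp W a x) (hb : Rep inp W b y) :
    Spec f inp (.mul a b : Prog ι κ n _) W (fun r W' => Rep inp W' r (x * y)) 1 := by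
  rw [← ha.eval, ← hb.eval]
  exact mod_cast spec_push (k := 1) fun _ => rfl

lemma spec_div (ha : Rep inp W a x) (hb : Rep inp W b y) :
    Spec f inp (.div a b : Prog ι κ n _) W (fun r W' => Rep inp W' r (x / y)) 1 := by
  rw [← ha.eval, ← hb.eval]
  exact mod_cast spec_push (k := 1) fun _ => rfl

lemma spec_sqrt (ha : Rep inp W a x) :
    Spec f inp (.sqrt a : Prog ι κ n _) W (fun r W' => Rep inp W' r (Real.sqrt x)) 1 := by
  rw [← ha.eval]
  exact mod_cast spec_push (k := 1) fun _ => rfl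

lemma spec_log (ha : Rep inp W a x) :
    Spec f inp (.log a : Prog ι κ n _) W (fun r W' => Rep inp W' r (Real.log x)) 1 := by
  rw [← ha.eval]
  exact mod_cast spec_push (k := 1) fun _ => rfl

lemma spec_value {pt : Fin n → Reg ι} {x : E n} (h : ∀ j, Rep inp W (pt j) (x j)) :
    Spec f inp (.value pt : Prog ι κ n _) W (fun r W' => Rep inp W' r (f x)) (n + 1) := by
  have hx : x = WithLp.toLp 2 fun j => Sum.elim inp W.vals (pt j) := by
    ext j; exact (h j).eval.symm
  rw [hx]
  exact mod_cast spec_push (k := n + 1) fun _ => rfl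

lemma spec_grad {pt : Fin n → Reg ι} {x : E n} (h : ∀ j, Rep inp W (pt j) (x j)) :
    Spec f inp (.grad pt : Prog ι κ n _) W
      (fun g W' => ∀ j, Rep inp W' (g j) (gradient f x j)) (n + 1) := by
  have hx : x = WithLp.toLp 2 fun j => Sum.elim inp W.vals (pt j) := by
    ext j; exact (h j).eval.symm
  let W' : World :=
    { vals := fun k => if h : W.fresh ≤ k ∧ k < W.fresh + n then
        gradient f x ⟨k - W.fresh, by omega⟩ else W.vals k
      fresh := W.fresh + n
      zero := fun i hi => by rw [dif_neg (by omega)]; exact W.zero i (by omega) }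
  refine ⟨fun j => .inr (W.fresh + j), W', n + 1, ⟨Nat.le_add_right _ _, fun i hi => ?_⟩,
    fun j => ⟨?_, ?_⟩, by push_cast; rfl, fun cont => ?_⟩
  · exact dif_neg (by omega)
  · change W.fresh + j < W.fresh + n; omega
  · change (if h : _ then _ else _) = _
    rw [dif_pos (by omega)]
    exact congrArg (gradient f x).ofLp (Fin.ext (Nat.add_sub_cancel_left W.fresh j.1))
  · subst hx; rfl

lemma spec_le (ha : Rep inp W a x) (hb : Rep inp W b y) :
    Spec f inp (.le a b : Prog ι κ n _) W (fun r _ => r = true ↔ x ≤ y) 1 := by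
  classical
  refine ⟨decide (x ≤ y), W, 1, le_rfl, by simp, by simp, fun cont => ?_⟩
  by_cases h : x ≤ y <;> simp [Prog.le, Tree.runFrom, ha.eval, hb.eval, h]

/-! ### Running straight-line programs -/

/-- The register written by an instruction. -/
def Arith.dst : Arith ι → ℕ
  | .const d _ | .add d _ _ | .sub d _ _ | .mul d _ _ | .div d _ _ => d

/-- The instruction with its operands renamed by `ρ` and its destination shifted by `k`. -/
def Arith.relocate {ι' : Type} (ρ : Reg ι' → Reg ι) (k : ℕ) : Arith ι' → Arith ι
  | .const d c => .const (k + d) c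
  | .add d a b => .add (k + d) (ρ a) (ρ b)
  | .sub d a b => .sub (k + d) (ρ a) (ρ b)
  | .mul d a b => .mul (k + d) (ρ a) (ρ b)
  | .div d a b => .div (k + d) (ρ a) (ρ b)

/-- The renaming of registers that reads the inputs of a straight-line program from `σ` and its
work registers at offset `k`. -/
def relocReg {ι' : Type} (σ : ι' → Reg ι) (k : ℕ) : Reg ι' → Reg ι :=
  Sum.elim σ fun j => .inr (k + j)

/-- The program that runs the straight-line program `S` on the registers `σ`. -/
def Prog.straightLine {ι' κ' : Type} [Fintype κ'] (S : StraightLine ι' κ') (σ : ι' → Reg ι) :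
    Prog ι κ n (κ' → Reg ι) :=
  fun k cont =>
    (S.code.map (Arith.relocate (relocReg σ k) k)).foldr Tree.arith
      (cont (fun o => relocReg σ k (S.out o))
        (k + ((S.code.map fun c => c.dst + 1).sum +
          ∑ o, Sum.elim (fun _ => 0) (fun j => j + 1) (S.out o))))

lemma runFrom_foldr_arith (l : List (Arith ι)) (t : Tree ι κ n) (w : ℕ → ℝ) :
    (l.foldr Tree.arith t).runFrom f inp w =
      ((t.runFrom f inp (l.foldl (Arith.exec inp) w)).1,
        (t.runFrom f inp (l.foldl (Arith.exec inp) w)).2 + l.length) := by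
  induction l generalizing w with
  | nil => rfl
  | cons c l ih =>
    simp only [List.foldr_cons, Tree.runFrom, ih, List.foldl_cons, List.length_cons]
    rw [add_assoc]

lemma exec_eq_update (c : Arith ι) (w : ℕ → ℝ) :
    ∃ x, c.exec inp w = Function.update w c.dst x := by
  cases c <;> exact ⟨_, rfl⟩

lemma foldl_exec_of_notMem (l : List (Arith ι)) (w : ℕ → ℝ) (i : ℕ)
    (h : ∀ c ∈ l, c.dst ≠ i) : l.foldl (Arith.exec inp) w i = w i := by
  induction l generalizing w with
  | nil => rfl
  | cons c l ih =>
    rw [List.foldl_cons, ih _ fun c hc => h c (List.mem_cons_of_mem _ hc)]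
    obtain ⟨x, hx⟩ := exec_eq_update (inp := inp) c w
    rw [hx, Function.update_of_ne (h c List.mem_cons_self).symm]

lemma dst_relocate {ι' : Type} (ρ : Reg ι' → Reg ι) (k : ℕ) (c : Arith ι') :
    (c.relocate ρ k).dst = k + c.dst := by
  cases c <;> rfl

/-- A relocated instruction acts on the registers from `k` on as the original one acts on all
registers. -/
lemma exec_relocate {ι' : Type} {σ : ι' → Reg ι} {x : ι' → ℝ} {k : ℕ} {w : ℕ → ℝ} {v : ℕ → ℝ}
    (hσ : ∀ i, Sum.elim inp w (σ i) = x i) (hv : ∀ j, w (k + j) = v j) (c : Arith ι') (j : ℕ) :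
    (c.relocate (relocReg σ k) k).exec inp w (k + j) = c.exec x v j := by
  have key : ∀ r, Sum.elim inp w (relocReg σ k r) = Sum.elim x v r := by
    rintro (i | j)
    · exact hσ i
    · exact hv j
  have upd : ∀ (d : ℕ) (z : ℝ),
      Function.update w (k + d) z (k + j) = Function.update v d z j := by
    intro d z
    by_cases h : j = d
    · subst h; simp
    · rw [Function.update_of_ne h, Function.update_of_ne (by omega), hv]
  cases c <;> simp only [Arith.relocate, Arith.exec, key, upd]

lemma foldl_exec_relocate {ι' : Type} {σ : ι' → Reg ι} {x : ι' → ℝ} (l : List (Arith ι'))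
    {w v : ℕ → ℝ} {k : ℕ} (hσ : ∀ i j, σ i = .inr j → j < k)
    (hx : ∀ i, Sum.elim inp w (σ i) = x i) (hv : ∀ j, w (k + j) = v j) (j : ℕ) :
    (l.map (Arith.relocate (relocReg σ k) k)).foldl (Arith.exec inp) w (k + j) =
      l.foldl (Arith.exec x) v j := by
  induction l generalizing w v with
  | nil => exact hv j
  | cons c l ih =>
    rw [List.map_cons, List.foldl_cons, List.foldl_cons]
    refine ih (fun i => ?_) (exec_relocate hx hv c)
    rw [← hx i]
    obtain ⟨z, hz⟩ := exec_eq_update (inp := inp) (c.relocate (relocReg σ k) k) w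
    rw [hz, dst_relocate]
    cases h : σ i with
    | inl i => rfl
    | inr j => exact Function.update_of_ne (by have := hσ i j h; omega) _ _

lemma spec_straightLine {ι' κ' : Type} [Fintype κ'] (S : StraightLine ι' κ') {σ : ι' → Reg ι}
    {x : ι' → ℝ} (hσ : ∀ i, Rep inp W (σ i) (x i)) :
    Spec f inp (.straightLine S σ : Prog ι κ n _) W
      (fun r W' => ∀ o, Rep inp W' (r o) (S.run x o)) S.code.length := by
  set N := (S.code.map fun c => c.dst + 1).sum +
    ∑ o, Sum.elim (fun _ => 0) (fun j => j + 1) (S.out o) with hN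
  set w := (S.code.map (Arith.relocate (relocReg σ W.fresh) W.fresh)).foldl
    (Arith.exec inp) W.vals with hw
  have hlt : ∀ i j, σ i = .inr j → j < W.fresh := by
    intro i j h
    have := hσ i
    rw [h] at this
    exact this.1
  have hsim : ∀ j, w (W.fresh + j) = S.code.foldl (Arith.exec x) 0 j :=
    foldl_exec_relocate S.code hlt (fun i => (hσ i).eval) fun j => W.zero _ (by omega)
  have hdst : ∀ c ∈ S.code, c.dst < N := by
    intro c hc
    have : c.dst + 1 ≤ (S.code.map fun c => c.dst + 1).sum :=
      List.single_le_sum (by simp) _ (List.mem_map_of_mem (f := fun c => c.dst + 1) hc)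
    omega
  let W' : World :=
    { vals := w
      fresh := W.fresh + N
      zero := fun i hi => by
        rw [hw, foldl_exec_of_notMem]
        · exact W.zero i (by omega)
        · intro c hc
          obtain ⟨d, hd, rfl⟩ := List.mem_map.mp hc
          have := hdst d hd
          rw [dst_relocate]
          omega }
  have hWW' : W ≤ W' := by
    refine ⟨Nat.le_add_right _ _, fun i hi => foldl_exec_of_notMem _ _ _ fun c hc => ?_⟩
    obtain ⟨d, hd, rfl⟩ := List.mem_map.mp hc
    rw [dst_relocate]
    omega
  refine ⟨fun o => relocReg σ W.fresh (S.out o), W', S.code.length, hWW', fun o => ?_, le_rfl,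
    fun cont => ?_⟩
  · beta_reduce
    rw [StraightLine.run]
    cases ho : S.out o with
    | inl i => exact (hσ i).mono hWW'
    | inr j =>
      suffices W.fresh + j < W'.fresh from ⟨this, hsim j⟩
      have : (Sum.elim (fun _ => 0) (fun j => j + 1) (S.out o) : ℕ) ≤
          ∑ o, Sum.elim (fun _ => 0) (fun j => j + 1) (S.out o) :=
        Finset.single_le_sum (f := fun o => Sum.elim (fun _ => 0) (fun j => j + 1) (S.out o))
          (fun _ _ => Nat.zero_le _) (Finset.mem_univ o)
      rw [ho] at this
      simp only [Sum.elim_inr] at this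
      change W.fresh + j < W.fresh + N
      omega
  · rw [Prog.straightLine, runFrom_foldr_arith, List.length_map]

/-! ### Iteration over finite index sets -/

/-- Run `p a` for all `a` in a list and collect the results. -/
def Prog.forList [DecidableEq α] [Inhabited β] (p : α → Prog ι κ n β) :
    List α → Prog ι κ n (α → β)
  | [] => pure fun _ => default
  | a :: l => do
    let b ← p a
    let g ← Prog.forList p l
    pure (Function.update g a b)

/-- Run `p a` for all `a` of a finite type and collect the results. -/
def Prog.forAll [Fintype α] [Inhabited β] (p : α → Prog ι κ n β) : Prog ι κ n (α → β) :=
  open Classical in Prog.forList p Finset.univ.toList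

lemma spec_forList [DecidableEq α] [Inhabited β] {p : α → Prog ι κ n β}
    {Q : α → β → World → Prop} {c : ℝ}
    (hQ : ∀ a b W₁ W₂, W₁ ≤ W₂ → Q a b W₁ → Q a b W₂)
    (l : List α) (W : World) (hp : ∀ a W', W ≤ W' → Spec f inp (p a) W' (Q a) c) :
    Spec f inp (.forList p l) W (fun g W' => ∀ a ∈ l, Q a (g a) W') (l.length * c) := by
  induction l generalizing W with
  | nil => exact (Spec.pure (by simp)).cost_le (by simp)
  | cons a l ih =>
    refine Spec.cost_le (c := c + l.length * c) ?_ (by push_cast [List.length_cons]; linarith)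
    refine (hp a W le_rfl).bind fun b W₁ hW₁ hb => ?_
    refine (ih W₁ fun a' W' hW' => hp a' W' (hW₁.trans hW')).map fun g W₂ hW₂ hg => ?_
    intro a' ha'
    by_cases h : a' = a
    · subst h
      rw [Function.update_self]
      exact hQ _ _ _ _ hW₂ hb
    · rw [Function.update_of_ne h]
      exact hg a' ((List.mem_cons.mp ha').resolve_left h)

lemma spec_forAll [Fintype α] [Inhabited β] {p : α → Prog ι κ n β}
    {Q : α → β → World → Prop} {c : ℝ}
    (hQ : ∀ a b W₁ W₂, W₁ ≤ W₂ → Q a b W₁ → Q a b W₂)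
    (hp : ∀ a W', W ≤ W' → Spec f inp (p a) W' (Q a) c) :
    Spec f inp (.forAll p) W (fun g W' => ∀ a, Q a (g a) W') (Fintype.card α * c) := by
  classical
  refine (spec_forList hQ Finset.univ.toList W hp).weaken
    (fun g W' _ h a => ?_) (by simp)
  exact h a (by simp)

/-- The case of `spec_forAll` in which every program computes a number. -/
lemma spec_forAll_rep [Fintype α] {p : α → Prog ι κ n (Reg ι)} {x : α → ℝ} {c : ℝ}
    (hp : ∀ a W', W ≤ W' → Spec f inp (p a) W' (fun r W'' => Rep inp W'' r (x a)) c) :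
    Spec f inp (.forAll p) W (fun g W' => ∀ a, Rep inp W' (g a) (x a)) (Fintype.card α * c) :=
  spec_forAll (Q := fun a r W'' => Rep inp W'' r (x a))
    (fun _ _ _ _ hW h => h.mono hW) hp

/-- The sum of the contents of a list of registers. -/
def Prog.sumList : List (Reg ι) → Prog ι κ n (Reg ι)
  | [] => .const 0
  | a :: l => do
    let s ← Prog.sumList l
    .add a s

/-- The sum of a finite family of registers. -/
def Prog.sum [Fintype α] (v : α → Reg ι) : Prog ι κ n (Reg ι) :=
  .sumList (Finset.univ.toList.map v)

lemma spec_sumList {v : α → Reg ι} {x : α → ℝ} (l : List α)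
    (h : ∀ a ∈ l, Rep inp W (v a) (x a)) :
    Spec f inp (.sumList (l.map v) : Prog ι κ n _) W
      (fun r W' => Rep inp W' r (l.map x).sum) (l.length + 1) := by
  induction l with
  | nil => exact (spec_const 0).cost_le (by simp)
  | cons a l ih =>
    refine Spec.cost_le ((ih fun a' ha' => h a' (List.mem_cons_of_mem _ ha')).bind
      fun s W' hW' hs => ?_) (c := (l.length + 1) + 1) (by simp)
    rw [List.map_cons, List.sum_cons]
    exact spec_add ((h a List.mem_cons_self).mono hW') hs

lemma spec_sum [Fintype α] {v : α → Reg ι} {x : α → ℝ} (h : ∀ a, Rep inp W (v a) (x a)) :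
    Spec f inp (.sum v : Prog ι κ n _) W
      (fun r W' => Rep inp W' r (∑ a, x a)) (Fintype.card α + 1) := by
  refine (spec_sumList Finset.univ.toList fun a _ => h a).weaken (fun r W' _ hr => ?_) (by simp)
  simpa [Finset.sum_map_toList] using hr

/-- The dot product of two families of registers. -/
def Prog.dot [Fintype α] (u v : α → Reg ι) : Prog ι κ n (Reg ι) := do
  let w ← Prog.forAll fun a => .mul (u a) (v a)
  .sum w

lemma spec_dot [Fintype α] {u v : α → Reg ι} {x y : α → ℝ} (hu : ∀ a, Rep inp W (u a) (x a))
    (hv : ∀ a, Rep inp W (v a) (y a)) :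
    Spec f inp (.dot u v : Prog ι κ n _) W
      (fun r W' => Rep inp W' r (∑ a, x a * y a)) (2 * Fintype.card α + 1) := by
  refine ((spec_forAll_rep (x := fun a => x a * y a) (c := 1) fun a W' hW' =>
    spec_mul ((hu a).mono hW') ((hv a).mono hW')).bind fun w W' _ hw => spec_sum hw).cost_le ?_
  linarith

/-- The registers `V` hold the entries of the matrix `X`. -/
def RepMat (inp : ι → ℝ) (W : World) (V : α → β → Reg ι) (X : Matrix α β ℝ) : Prop :=
  ∀ a b, Rep inp W (V a b) (X a b)

lemma RepMat.mono {V : α → β → Reg ι} {X : Matrix α β ℝ} (h : RepMat inp W V X) (hW : W ≤ W') :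
    RepMat inp W' V X :=
  fun a b => (h a b).mono hW

lemma RepMat.transpose {V : α → β → Reg ι} {X : Matrix α β ℝ} (h : RepMat inp W V X) :
    RepMat inp W (fun b a => V a b) Xᵀ :=
  fun b a => h a b

/-- Compute a matrix entry by entry. -/
def Prog.entries [Fintype α] [Fintype β] (p : α → β → Prog ι κ n (Reg ι)) :
    Prog ι κ n (α → β → Reg ι) := do
  let g ← Prog.forAll fun q : α × β => p q.1 q.2
  pure fun a b => g (a, b)

lemma spec_entries [Fintype α] [Fintype β] {p : α → β → Prog ι κ n (Reg ι)} {X : Matrix α β ℝ}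
    {c : ℝ} (hp : ∀ a b W', W ≤ W' →
      Spec f inp (p a b) W' (fun r W'' => Rep inp W'' r (X a b)) c) :
    Spec f inp (.entries p) W (fun V W' => RepMat inp W' V X)
      (Fintype.card α * Fintype.card β * c) := by
  refine Spec.cost_le ((spec_forAll_rep (x := fun q : α × β => X q.1 q.2) (c := c)
    fun q W' hW' => hp q.1 q.2 W' hW').map fun g W' _ hg a b => hg (a, b)) ?_
  simp

/-- The product of a matrix and a vector by the definition. -/
def Prog.mulVec [Fintype α] [Fintype β] (V : α → β → Reg ι) (v : β → Reg ι) :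
    Prog ι κ n (α → Reg ι) :=
  .forAll fun a => .dot (V a) v

lemma spec_mulVec [Fintype α] [Fintype β] {V : α → β → Reg ι} {v : β → Reg ι}
    {X : Matrix α β ℝ} {x : β → ℝ} (hV : RepMat inp W V X) (hv : ∀ b, Rep inp W (v b) (x b)) :
    Spec f inp (.mulVec V v : Prog ι κ n _) W (fun r W' => ∀ a, Rep inp W' (r a) ((X *ᵥ x) a))
      (Fintype.card α * (2 * Fintype.card β + 1)) :=
  spec_forAll_rep fun a _ hW' => spec_dot (fun b => (hV a b).mono hW') fun b => (hv b).mono hW'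

/-- The disjunction of the results of Boolean programs. -/
def Prog.anyList (p : α → Prog ι κ n Bool) : List α → Prog ι κ n Bool
  | [] => pure false
  | a :: l => do
    let b ← p a
    let b' ← Prog.anyList p l
    pure (b || b')

lemma spec_anyList {p : α → Prog ι κ n Bool} {P : α → Prop} {c : ℝ} (l : List α) (W : World)
    (hp : ∀ a ∈ l, ∀ W', W ≤ W' → Spec f inp (p a) W' (fun b _ => b = true ↔ P a) c) :
    Spec f inp (.anyList p l) W (fun b _ => b = true ↔ ∃ a ∈ l, P a) (l.length * c) := by
  induction l generalizing W with
  | nil => exact (Spec.pure (by simp)).cost_le (by simp)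
  | cons a l ih =>
    refine Spec.cost_le (c := c + l.length * c) ?_ (by push_cast [List.length_cons]; linarith)
    refine (hp a List.mem_cons_self W le_rfl).bind fun b W₁ hW₁ hb => ?_
    refine (ih W₁ fun a' ha' W' hW' => hp a' (List.mem_cons_of_mem _ ha') W'
      (hW₁.trans hW')).map fun b' W₂ _ hb' => ?_
    simp [hb, hb']

end Programs

/-! ### Linear algebra of block inversion and low-rank updates -/

section LinearAlgebra

variable {α β γ : Type} [Fintype α] [DecidableEq α] [Fintype β] [DecidableEq β]
  [Fintype γ] [DecidableEq γ]

open Matrix in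
/-- The blocks of a positive definite matrix: the leading block and its Schur complement are
positive definite, and they determine the inverse. -/
lemma posDef_fromBlocks_inv {A : Matrix β β ℝ} {B : Matrix β γ ℝ} {D : Matrix γ γ ℝ}
    (h : (fromBlocks A B Bᵀ D).PosDef) :
    A.PosDef ∧ (D - Bᵀ * (A⁻¹ * B)).PosDef ∧
      ∀ S G, S = (D - Bᵀ * (A⁻¹ * B))⁻¹ → G = A⁻¹ * B * S →
        (fromBlocks A B Bᵀ D)⁻¹ =
          fromBlocks (A⁻¹ + G * (A⁻¹ * B)ᵀ) (-G) (-G)ᵀ S := by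
  have hA : A.PosDef := by
    have := h.submatrix (e := Sum.inl) Sum.inl_injective
    exact this
  have hAu : IsUnit A.det := (isUnit_iff_isUnit_det _).mp hA.isUnit
  let _ : Invertible A := A.invertibleOfIsUnitDet hAu
  have hps : (D - Bᵀ * (A⁻¹ * B)).PosSemidef := by
    have := (Matrix.PosDef.fromBlocks₁₁ B D hA).mp h.posSemidef
    simpa [Matrix.mul_assoc] using this
  have hS : (D - Bᵀ * (A⁻¹ * B)).PosDef := by
    refine (hps.posDef_iff_isUnit).mpr ?_
    rw [isUnit_iff_isUnit_det]
    have hdet := (isUnit_iff_isUnit_det _).mp h.isUnit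
    rw [det_fromBlocks₁₁, invOf_eq_nonsing_inv, Matrix.mul_assoc] at hdet
    exact isUnit_of_mul_isUnit_right hdet
  refine ⟨hA, hS, fun S G hSdef hG => ?_⟩
  have hAt : (A⁻¹)ᵀ = A⁻¹ := by
    have := hA.inv.isHermitian
    exact this
  have hSt : Sᵀ = S := by
    have := hS.inv.isHermitian
    rw [← hSdef] at this
    exact this
  have hSS : (D - Bᵀ * (A⁻¹ * B)) * S = 1 := by
    rw [hSdef]
    exact mul_nonsing_inv _ ((isUnit_iff_isUnit_det _).mp hS.isUnit)
  have hAA : A * A⁻¹ = 1 := mul_nonsing_inv _ hAu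
  refine inv_eq_right_inv ?_
  have hGt : (-G)ᵀ = -(S * (Bᵀ * A⁻¹)) := by
    rw [hG, transpose_neg, transpose_mul, transpose_mul, hSt, hAt]
  have hAG : A * G = B * S := by
    rw [hG, ← Matrix.mul_assoc, ← Matrix.mul_assoc, hAA, Matrix.one_mul]
  have hDS : D * S = 1 + Bᵀ * G := by
    rw [Matrix.sub_mul, sub_eq_iff_eq_add] at hSS
    rw [hSS, hG, Matrix.mul_assoc, Matrix.mul_assoc]
  have hFt : (A⁻¹ * B)ᵀ = Bᵀ * A⁻¹ := by rw [transpose_mul, hAt]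
  rw [hFt, hGt, fromBlocks_multiply, ← fromBlocks_one]
  congr 1
  · rw [Matrix.mul_add, hAA, ← Matrix.mul_assoc A, hAG, Matrix.mul_neg]
    simp only [Matrix.mul_assoc]
    abel
  · rw [Matrix.mul_neg, hAG]
    abel
  · rw [Matrix.mul_add, Matrix.mul_neg, ← Matrix.mul_assoc D, hDS, Matrix.add_mul, Matrix.one_mul,
      Matrix.mul_assoc Bᵀ G]
    abel
  · rw [Matrix.mul_neg, hDS]
    abel

open Matrix in
/-- The Woodbury formula for a diagonal update `N + U Δ Uᵀ`, in a form that does not require `Δ`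
to be invertible. -/
lemma inv_add_mul_diagonal_mul {N : Matrix α α ℝ} (U : Matrix α β ℝ) (Δ : Matrix β β ℝ)
    (hN : N.PosDef) (hN' : (N + U * Δ * Uᵀ).PosDef) :
    IsUnit (1 + Δ * (Uᵀ * (N⁻¹ * U))).det ∧
      (N + U * Δ * Uᵀ)⁻¹ =
        N⁻¹ - N⁻¹ * U * ((1 + Δ * (Uᵀ * (N⁻¹ * U)))⁻¹ * Δ) * (N⁻¹ * U)ᵀ := by
  have hNu : IsUnit N.det := (isUnit_iff_isUnit_det _).mp hN.isUnit
  have hNN : N * N⁻¹ = 1 := mul_nonsing_inv _ hNu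
  have hNN' : N⁻¹ * N = 1 := nonsing_inv_mul _ hNu
  have hNt : (N⁻¹)ᵀ = N⁻¹ := hN.inv.isHermitian
  have hG : IsUnit (1 + Δ * (Uᵀ * (N⁻¹ * U))).det := by
    have : (1 + Δ * (Uᵀ * (N⁻¹ * U))).det = (N⁻¹ * (N + U * Δ * Uᵀ)).det := by
      rw [← Matrix.mul_assoc, det_one_add_mul_comm, Matrix.mul_add, hNN']
      simp only [Matrix.mul_assoc]
    rw [this, det_mul]
    exact ((isUnit_iff_isUnit_det _).mp hN.inv.isUnit).mul
      ((isUnit_iff_isUnit_det _).mp hN'.isUnit)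
  refine ⟨hG, inv_eq_right_inv ?_⟩
  set G := 1 + Δ * (Uᵀ * (N⁻¹ * U)) with hGdef
  have hGG : G * G⁻¹ = 1 := mul_nonsing_inv _ hG
  have hV : (N⁻¹ * U)ᵀ = Uᵀ * N⁻¹ := by rw [transpose_mul, hNt]
  have key : (N + U * Δ * Uᵀ) * (N⁻¹ * U) = U * G := by
    rw [hGdef, Matrix.add_mul, Matrix.mul_add, ← Matrix.mul_assoc N, hNN]
    simp only [Matrix.mul_assoc, Matrix.one_mul, Matrix.mul_one]
  have key' : (N + U * Δ * Uᵀ) * (N⁻¹ * U * (G⁻¹ * Δ) * (Uᵀ * N⁻¹)) = U * Δ * (Uᵀ * N⁻¹) := by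
    rw [Matrix.mul_assoc (N⁻¹ * U), ← Matrix.mul_assoc _ (N⁻¹ * U), key, Matrix.mul_assoc U G,
      Matrix.mul_assoc G⁻¹, ← Matrix.mul_assoc G, hGG, Matrix.one_mul, ← Matrix.mul_assoc U]
  rw [Matrix.mul_sub, hV, key', Matrix.add_mul, hNN, Matrix.mul_assoc _ Uᵀ, add_sub_cancel_right]

open Matrix in
/-- The inverse of a general matrix through that of a positive definite one. -/
lemma posDef_transpose_mul_self_of_isUnit {G : Matrix β β ℝ} (hG : IsUnit G.det) :
    (Gᵀ * G).PosDef ∧ G⁻¹ = (Gᵀ * G)⁻¹ * Gᵀ := by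
  refine ⟨?_, ?_⟩
  · have := Matrix.PosDef.conjTranspose_mul_self G
      (mulVec_injective_of_isUnit ((isUnit_iff_isUnit_det _).mpr hG))
    simpa using this
  · rw [Matrix.mul_inv_rev, Matrix.mul_assoc, nonsing_inv_mul _ (by rwa [det_transpose]),
      Matrix.mul_one]

end LinearAlgebra

open Matrix in
/-- The matrix `A diag(z) Aᵀ`. -/
def gram {m n : ℕ} (A : Matrix (Fin m) (Fin n) ℝ) (z : Fin n → ℝ) : Matrix (Fin m) (Fin m) ℝ :=
  A * diagonal z * Aᵀ

open Matrix in
lemma gram_posDef {m n : ℕ} {A : Matrix (Fin m) (Fin n) ℝ} (hA : LinearIndependent ℝ A.row)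
    {z : Fin n → ℝ} (hz : ∀ i, 0 < z i) : (gram A z).PosDef := by
  have h : (diagonal z).PosDef := Matrix.PosDef.diagonal hz
  have := h.mul_mul_conjTranspose_same (B := A) (Matrix.vecMul_injective_iff.mpr hA)
  simpa [gram] using this

open Matrix in
lemma gram_apply {m n : ℕ} (A : Matrix (Fin m) (Fin n) ℝ) (z : Fin n → ℝ) (a b : Fin m) :
    gram A z a b = ∑ i, A a i * z i * A b i := by
  rw [gram, Matrix.mul_apply]
  exact Finset.sum_congr rfl fun i _ => by rw [Matrix.mul_diagonal, Matrix.transpose_apply]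

open Matrix in
/-- Changing `z` on the set `c` changes `A diag(z) Aᵀ` by a matrix of rank at most `c.card`. -/
lemma gram_piecewise {m n : ℕ} (A : Matrix (Fin m) (Fin n) ℝ) (z z' : Fin n → ℝ)
    (c : Finset (Fin n)) :
    gram A (c.piecewise z' z) = gram A z + (A.submatrix id ((↑) : c → Fin n)) *
      diagonal (fun i : c => z' i - z i) * (A.submatrix id ((↑) : c → Fin n))ᵀ := by
  ext a b
  have hU : ((A.submatrix id ((↑) : c → Fin n)) * diagonal (fun i : c => z' i - z i) *
      (A.submatrix id ((↑) : c → Fin n))ᵀ) a b = ∑ i ∈ c, A a i * (z' i - z i) * A b i := by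
    rw [Matrix.mul_apply, ← Finset.sum_coe_sort c fun i => A a i * (z' i - z i) * A b i]
    exact Finset.sum_congr rfl fun i _ => by rw [Matrix.mul_diagonal]; rfl
  rw [Matrix.add_apply, gram_apply, gram_apply, hU,
    ← Finset.sum_filter_add_sum_filter_not Finset.univ (· ∈ c),
    ← Finset.sum_filter_add_sum_filter_not Finset.univ (· ∈ c) fun i => A a i * z i * A b i,
    add_right_comm]
  congr 1
  · simp only [Finset.filter_mem_eq_inter, Finset.univ_inter]
    rw [← Finset.sum_add_distrib]
    refine Finset.sum_congr rfl fun i hi => ?_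
    rw [Finset.piecewise_eq_of_mem _ _ _ hi]
    ring
  · refine Finset.sum_congr rfl fun i hi => ?_
    rw [Finset.piecewise_eq_of_notMem _ _ _ (Finset.mem_filter.mp hi).2]

/-! ### Fast matrix multiplication in blocks -/

/-- For each `k`, a straight-line program with input and output registers for the multiplication of
two `k × k` matrices. -/
abbrev MulFamily : Type :=
  ∀ k : ℕ, StraightLine ((Fin k × Fin k) ⊕ (Fin k × Fin k)) (Fin k × Fin k)

/-- The programs `S k` multiply matrices, with at most `C * k ^ ω` operations. -/
def IsMulFamily (ω C : ℝ) (S : MulFamily) : Prop :=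
  ∀ k : ℕ, ((S k).code.length : ℝ) ≤ C * (k : ℝ) ^ ω ∧
    ∀ (X Y : Matrix (Fin k) (Fin k) ℝ) (i j : Fin k),
      (S k).run (Sum.elim (fun q => X q.1 q.2) fun q => Y q.1 q.2) (i, j) = (X * Y) i j

lemma IsMatMulExponent.exists_mulFamily {ω : ℝ} (h : IsMatMulExponent ω) :
    ∃ (C : ℝ) (S : MulFamily), 0 ≤ C ∧ IsMulFamily ω C S := by
  obtain ⟨C, hC⟩ := h
  choose S hS using hC
  refine ⟨max C 0, S, le_max_right _ _, fun k => ⟨(hS k).1.trans ?_, (hS k).2⟩⟩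
  exact mul_le_mul_of_nonneg_right (le_max_left _ _) (by positivity)

section FastLinearAlgebra

variable {ι κ α β γ : Type} {n : ℕ} {inp : ι → ℝ} {f : E n → ℝ} {W : World}
variable [Fintype α] [Fintype β] [Fintype γ]

/-- The position of an index when the index set is cut into blocks of size `s`: the number of the
block and the place within the block. -/
def blockIndex {s : ℕ} (hs : 0 < s) (a : α) : Fin (Fintype.card α / s + 1) × Fin s :=
  (⟨Fintype.equivFin α a / s,
    Nat.lt_succ_of_le (Nat.div_le_div_right (Fintype.equivFin α a).2.le)⟩,
   ⟨Fintype.equivFin α a % s, Nat.mod_lt _ hs⟩)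

lemma blockIndex_injective {s : ℕ} (hs : 0 < s) :
    Function.Injective (blockIndex hs : α → _) := by
  intro a b h
  simp only [blockIndex, Prod.mk.injEq, Fin.mk.injEq] at h
  refine (Fintype.equivFin α).injective (Fin.ext ?_)
  rw [← Nat.div_add_mod (Fintype.equivFin α a : ℕ) s, h.1, h.2, Nat.div_add_mod]

/-- A rectangular array cut into blocks of size `s` and padded with `z`. -/
def padded {δ : Type} {s : ℕ} (hs : 0 < s) (V : α × β → δ) (z : δ) :
    (Fin (Fintype.card α / s + 1) × Fin s) × (Fin (Fintype.card β / s + 1) × Fin s) → δ :=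
  Function.extend (Prod.map (blockIndex hs) (blockIndex hs)) V fun _ => z

lemma padded_apply {δ : Type} {s : ℕ} (hs : 0 < s) (V : α × β → δ) (z : δ) (a : α) (b : β) :
    padded hs V z (blockIndex hs a, blockIndex hs b) = V (a, b) :=
  ((blockIndex_injective hs).prodMap (blockIndex_injective hs)).extend_apply _ _ (a, b)

lemma padded_of_right {δ : Type} {s : ℕ} (hs : 0 < s) (V : α × β → δ) (z : δ) (u)
    {v : Fin (Fintype.card β / s + 1) × Fin s} (hv : v ∉ Set.range (blockIndex (α := β) hs)) :
    padded hs V z (u, v) = z := by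
  refine Function.extend_apply' _ _ _ ?_
  rintro ⟨⟨a, b⟩, h⟩
  exact hv ⟨b, congrArg Prod.snd h⟩

lemma rep_padded {s : ℕ} (hs : 0 < s) {V : α → β → Reg ι} {z : Reg ι} {X : Matrix α β ℝ}
    (hV : RepMat inp W V X) (hz : Rep inp W z 0) (q) :
    Rep inp W (padded hs (fun q => V q.1 q.2) z q) (padded hs (fun q => X q.1 q.2) 0 q) := by
  by_cases h : ∃ t, Prod.map (blockIndex hs) (blockIndex hs) t = q
  · obtain ⟨⟨a, b⟩, rfl⟩ := h
    rw [Prod.map_apply, padded_apply, padded_apply]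
    exact hV a b
  · rw [padded, padded, Function.extend_apply' _ _ _ h, Function.extend_apply' _ _ _ h]
    exact hz

/-- A product of rectangular matrices as a sum of products of their padded blocks. -/
lemma mul_apply_eq_sum_blocks {s : ℕ} (hs : 0 < s) (X : Matrix α β ℝ) (Y : Matrix β γ ℝ) (a : α)
    (c : γ) :
    (X * Y) a c = ∑ K, ∑ k,
      padded hs (fun q => X q.1 q.2) 0 (blockIndex hs a, (K, k)) *
        padded hs (fun q => Y q.1 q.2) 0 ((K, k), blockIndex hs c) := by
  rw [Matrix.mul_apply, ← Fintype.sum_prod_type'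
    (f := fun K k => padded hs (fun q => X q.1 q.2) 0 (blockIndex hs a, (K, k)) *
      padded hs (fun q => Y q.1 q.2) 0 ((K, k), blockIndex hs c))]
  refine Fintype.sum_of_injective (blockIndex hs) (blockIndex_injective hs) _ _
    (fun v hv => ?_) fun b => ?_
  · rw [padded_of_right hs _ 0 _ hv, zero_mul]
  · exact (congrArg₂ (· * ·) (padded_apply hs (fun q => X q.1 q.2) 0 a b)
      (padded_apply hs (fun q => Y q.1 q.2) 0 b c)).symm

/-- Multiplication of rectangular matrices in blocks of size `s`. -/
def Prog.mm (S : MulFamily) {s : ℕ} (hs : 0 < s) (V : α → β → Reg ι) (U : β → γ → Reg ι) :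
    Prog ι κ n (α → γ → Reg ι) := do
  let z ← Prog.const 0
  let B ← Prog.forAll fun t : Fin (Fintype.card α / s + 1) × Fin (Fintype.card γ / s + 1) ×
      Fin (Fintype.card β / s + 1) =>
    Prog.straightLine (S s) (Sum.elim
      (fun q => padded hs (fun q => V q.1 q.2) z ((t.1, q.1), (t.2.2, q.2)))
      (fun q => padded hs (fun q => U q.1 q.2) z ((t.2.2, q.1), (t.2.1, q.2))))
  Prog.entries fun a c => Prog.sum fun K =>
    B ((blockIndex hs a).1, (blockIndex hs c).1, K) ((blockIndex hs a).2, (blockIndex hs c).2)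

lemma spec_mm_aux {ω C : ℝ} {S : MulFamily} (hS : IsMulFamily ω C S) {s : ℕ} (hs : 0 < s)
    {V : α → β → Reg ι} {U : β → γ → Reg ι} {X : Matrix α β ℝ} {Y : Matrix β γ ℝ}
    (hV : RepMat inp W V X) (hU : RepMat inp W U Y) :
    Spec f inp (.mm S hs V U : Prog ι κ n _) W (fun R W' => RepMat inp W' R (X * Y))
      (1 + (((Fintype.card α / s + 1 : ℕ) * ((Fintype.card γ / s + 1 : ℕ) *
        (Fintype.card β / s + 1 : ℕ)) * (C * (s : ℝ) ^ ω)) +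
        Fintype.card α * Fintype.card γ * ((Fintype.card β / s + 1 : ℕ) + 1))) := by
  refine (spec_const 0).bind fun z W₁ hW₁ hz => ?_
  let val (t : Fin (Fintype.card α / s + 1) × Fin (Fintype.card γ / s + 1) ×
      Fin (Fintype.card β / s + 1)) (q : Fin s × Fin s) : ℝ :=
    ∑ k, padded hs (fun q => X q.1 q.2) 0 ((t.1, q.1), (t.2.2, k)) *
      padded hs (fun q => Y q.1 q.2) 0 ((t.2.2, k), (t.2.1, q.2))
  refine Spec.bind (Q := fun B W' => ∀ t q, Rep inp W' (B t q) (val t q)) ?_ fun B W₂ hW₂ hB => ?_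
  · refine (spec_forAll (c := C * (s : ℝ) ^ ω)
      (Q := fun t (B : Fin s × Fin s → Reg ι) W' => ∀ q, Rep inp W' (B q) (val t q))
      (fun _ _ _ _ hW h q => (h q).mono hW) fun t W₂ hW₂ => ?_).cost_le ?_
    · let X' : Matrix (Fin s) (Fin s) ℝ :=
        fun i j => padded hs (fun q => X q.1 q.2) 0 ((t.1, i), (t.2.2, j))
      let Y' : Matrix (Fin s) (Fin s) ℝ :=
        fun i j => padded hs (fun q => Y q.1 q.2) 0 ((t.2.2, i), (t.2.1, j))
      refine (spec_straightLine (S s) (x := Sum.elim (fun q => X' q.1 q.2) fun q => Y' q.1 q.2)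
        ?_).weaken (fun r W₃ _ h q => ?_) (hS s).1
      · rintro (q | q)
        · exact (rep_padded hs (hV.mono hW₁) hz _).mono hW₂
        · exact (rep_padded hs (hU.mono hW₁) hz _).mono hW₂
      · have := h q
        rw [(hS s).2 X' Y' q.1 q.2, Matrix.mul_apply] at this
        exact this
    · simp
  · refine (spec_entries (c := (Fintype.card β / s + 1 : ℕ) + 1) fun a c W₃ hW₃ => ?_)
    rw [mul_apply_eq_sum_blocks hs]
    refine (spec_sum fun K => (hB _ _).mono hW₃).cost_le ?_
    simp

lemma div_add_one_le {k s : ℕ} {p : ℝ} (hs : 0 < s) (hp : 1 ≤ p) (h : (k : ℝ) ≤ p * s) :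
    ((k / s + 1 : ℕ) : ℝ) ≤ 2 * p := by
  have h1 : ((k / s : ℕ) : ℝ) ≤ (k : ℝ) / s := Nat.cast_div_le
  have h2 : (k : ℝ) / s ≤ p := by
    rw [div_le_iff₀ (by exact_mod_cast hs)]
    exact h
  push_cast
  linarith

/-- The cost of multiplying a `p s × q s` matrix and a `q s × r s` matrix. -/
lemma spec_mm {ω C : ℝ} {S : MulFamily} (hS : IsMulFamily ω C S) (hC : 0 ≤ C) (hω : 2 ≤ ω) {s : ℕ}
    (hs : 0 < s) {V : α → β → Reg ι} {U : β → γ → Reg ι} {X : Matrix α β ℝ} {Y : Matrix β γ ℝ}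
    (hV : RepMat inp W V X) (hU : RepMat inp W U Y) {p q r : ℝ} (hp : 1 ≤ p) (hq : 1 ≤ q)
    (hr : 1 ≤ r) (hα : (Fintype.card α : ℝ) ≤ p * s) (hβ : (Fintype.card β : ℝ) ≤ q * s)
    (hγ : (Fintype.card γ : ℝ) ≤ r * s) :
    Spec f inp (.mm S hs V U : Prog ι κ n _) W (fun R W' => RepMat inp W' R (X * Y))
      (8 * (C + 2) * (p * q * r * (s : ℝ) ^ ω)) := by
  refine (spec_mm_aux hS hs hV hU).cost_le ?_
  have hp' := div_add_one_le hs hp hα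
  have hq' := div_add_one_le hs hq hβ
  have hr' := div_add_one_le hs hr hγ
  have hs1 : (1 : ℝ) ≤ s := by exact_mod_cast hs
  have hsω : (s : ℝ) ^ 2 ≤ (s : ℝ) ^ ω := by
    rw [← Real.rpow_natCast]
    exact Real.rpow_le_rpow_of_exponent_le hs1 (by exact_mod_cast hω)
  set P : ℝ := ((Fintype.card α / s + 1 : ℕ) : ℝ)
  set Q : ℝ := ((Fintype.card β / s + 1 : ℕ) : ℝ)
  set R : ℝ := ((Fintype.card γ / s + 1 : ℕ) : ℝ)
  have h1 : (1 : ℝ) ≤ (s : ℝ) ^ ω := Real.one_le_rpow hs1 (by linarith)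
  have hP0 : 0 ≤ P := Nat.cast_nonneg _
  have hQ0 : 0 ≤ Q := Nat.cast_nonneg _
  have hR0 : 0 ≤ R := Nat.cast_nonneg _
  have e1 : P * (R * Q) ≤ (2 * p) * ((2 * r) * (2 * q)) := by gcongr
  have e2 : (Fintype.card α : ℝ) * Fintype.card γ * (Q + 1) ≤
      p * s * (r * s) * (3 * q) := by
    gcongr
    linarith
  have e3 : p * s * (r * s) * (3 * q) ≤ 3 * (p * q * r * (s : ℝ) ^ ω) := by
    have := mul_le_mul_of_nonneg_left hsω (by positivity : 0 ≤ 3 * (p * q * r))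
    linarith
  have e4 : P * (R * Q) * (C * (s : ℝ) ^ ω) ≤
      (2 * p) * ((2 * r) * (2 * q)) * (C * (s : ℝ) ^ ω) := by gcongr
  have e5 : 1 ≤ p * q * r * (s : ℝ) ^ ω := by
    have : 1 ≤ p * q := one_le_mul_of_one_le_of_one_le hp hq
    have : 1 ≤ p * q * r := one_le_mul_of_one_le_of_one_le this hr
    exact one_le_mul_of_one_le_of_one_le this h1
  calc _ ≤ 1 + ((2 * p) * ((2 * r) * (2 * q)) * (C * (s : ℝ) ^ ω) +
        3 * (p * q * r * (s : ℝ) ^ ω)) := by linarith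
    _ ≤ _ := by linarith

/-! ### Fast inversion -/

/-- The index set cut into its first `k` elements and the rest. -/
def splitEquiv (α : Type) [Fintype α] (k : ℕ) :
    α ≃ Fin (min k (Fintype.card α)) ⊕ Fin (Fintype.card α - k) :=
  ((Fintype.equivFin α).trans (finCongr (by omega))).trans finSumFinEquiv.symm

/-- Inversion of a positive definite matrix of size at most `2 ^ j`, by recursion on the Schur
complement of a leading block of half the size. -/
def Prog.invPosDef (S : MulFamily) : ℕ → (α : Type) → [Fintype α] → (α → α → Reg ι) →
    Prog ι κ n (α → α → Reg ι)
  | 0, _, _, V => do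
    let one ← Prog.const 1
    Prog.entries fun a b => .div one (V a b)
  | j + 1, α, _, V => do
    let e := splitEquiv α (2 ^ j)
    let B := fun a b => V (e.symm (.inl a)) (e.symm (.inr b))
    let Ai ← Prog.invPosDef S j _ fun a b => V (e.symm (.inl a)) (e.symm (.inl b))
    let F ← Prog.mm S (Nat.two_pow_pos j) Ai B
    let H ← Prog.mm S (Nat.two_pow_pos j) (fun b a => B a b) F
    let D ← Prog.entries fun a b => .sub (V (e.symm (.inr a)) (e.symm (.inr b))) (H a b)
    let Si ← Prog.invPosDef S j _ D
    let G ← Prog.mm S (Nat.two_pow_pos j) F Si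
    let K ← Prog.mm S (Nat.two_pow_pos j) G (fun b a => F a b)
    let TL ← Prog.entries fun a b => .add (Ai a b) (K a b)
    let z ← Prog.const 0
    let TR ← Prog.entries fun a b => .sub z (G a b)
    pure fun a b => Matrix.fromBlocks TL TR (fun b a => TR a b) Si (e a) (e b)

lemma spec_invPosDef {ω C : ℝ} {S : MulFamily} (hS : IsMulFamily ω C S) (hC : 0 ≤ C) (hω : 2 ≤ ω)
    (j : ℕ) : ∀ (α : Type) [Fintype α] [DecidableEq α] {W : World} {V : α → α → Reg ι}
      {X : Matrix α α ℝ}, Fintype.card α ≤ 2 ^ j → RepMat inp W V X → X.PosDef →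
    Spec f inp (.invPosDef S j α V : Prog ι κ n _) W (fun R W' => RepMat inp W' R X⁻¹)
      (18 * (C + 2) * ((2 ^ j : ℕ) : ℝ) ^ ω) := by
  induction j with
  | zero =>
    intro α _ _ W V X hα hV hX
    have hsub : Subsingleton α := Fintype.card_le_one_iff_subsingleton.mp hα
    have hα' : (Fintype.card α : ℝ) ≤ 1 := by exact_mod_cast hα
    refine Spec.cost_le (c := 1 + Fintype.card α * Fintype.card α * 1) ?_ ?_
    · refine (spec_const 1).bind fun one W₁ hW₁ h1 => ?_
      refine (spec_entries fun a b W₂ hW₂ => ?_)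
      have : X⁻¹ a b = 1 / X a b := by
        obtain rfl := Subsingleton.elim a b
        rw [Matrix.inv_subsingleton, Matrix.diagonal_apply_eq, Ring.inverse_eq_inv', one_div]
      rw [this]
      exact spec_div (h1.mono hW₂) ((hV a b).mono (hW₁.trans hW₂))
    · have : (Fintype.card α : ℝ) * Fintype.card α ≤ 1 :=
        mul_le_one₀ hα' (Nat.cast_nonneg _) hα'
      simp only [pow_zero, Nat.cast_one, Real.one_rpow]
      linarith
  | succ j ih =>
    intro α _ _ W V X hα hV hX
    set s : ℕ := 2 ^ j with hs
    set e := splitEquiv α s with he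
    set X₁₁ : Matrix _ _ ℝ := fun a b => X (e.symm (.inl a)) (e.symm (.inl b)) with hX₁₁
    set X₁₂ : Matrix _ _ ℝ := fun a b => X (e.symm (.inl a)) (e.symm (.inr b)) with hX₁₂
    set X₂₂ : Matrix _ _ ℝ := fun a b => X (e.symm (.inr a)) (e.symm (.inr b)) with hX₂₂
    have hXX : X.submatrix e.symm e.symm = Matrix.fromBlocks X₁₁ X₁₂ X₁₂ᵀ X₂₂ := by
      ext (a | a) (b | b)
      · rfl
      · rfl
      · have := hX.isHermitian.apply (e.symm (.inr a)) (e.symm (.inl b))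
        simpa using this.symm
      · rfl
    have hpd : (Matrix.fromBlocks X₁₁ X₁₂ X₁₂ᵀ X₂₂).PosDef := by
      rw [← hXX]
      exact hX.submatrix e.symm.injective
    obtain ⟨hpd₁, hpd₂, hinv⟩ := posDef_fromBlocks_inv hpd
    have hinv' := hinv _ _ rfl rfl
    have hs0 : 0 < s := Nat.two_pow_pos j
    have c₁ : Fintype.card (Fin (min s (Fintype.card α))) ≤ s := by simp
    have c₂ : Fintype.card (Fin (Fintype.card α - s)) ≤ s := by
      rw [pow_succ] at hα
      simp only [Fintype.card_fin]
      omega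
    have c₁' : (Fintype.card (Fin (min s (Fintype.card α))) : ℝ) ≤ 1 * s := by
      rw [one_mul]; exact_mod_cast c₁
    have c₂' : (Fintype.card (Fin (Fintype.card α - s)) : ℝ) ≤ 1 * s := by
      rw [one_mul]; exact_mod_cast c₂
    have hs1 : (1 : ℝ) ≤ s := by exact_mod_cast hs0
    set h := (s : ℝ) ^ ω with hh
    have hsω : (s : ℝ) ^ 2 ≤ h := by
      rw [← Real.rpow_natCast]
      exact Real.rpow_le_rpow_of_exponent_le hs1 (by exact_mod_cast hω)
    have ent : ∀ {a b : ℝ}, 0 ≤ a → 0 ≤ b → a ≤ 1 * s → b ≤ 1 * s → a * b * 1 ≤ h := by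
      intro a b ha hb ha' hb'
      calc a * b * 1 ≤ (1 * s) * (1 * s) * 1 := by gcongr
        _ = (s : ℝ) ^ 2 := by ring
        _ ≤ h := hsω
    have hB : RepMat inp W (fun a b => V (e.symm (.inl a)) (e.symm (.inr b))) X₁₂ :=
      fun a b => hV (e.symm (.inl a)) (e.symm (.inr b))
    set M := 8 * (C + 2) * (1 * 1 * 1 * h) with hM
    refine Spec.cost_le (c := 18 * (C + 2) * h + (M + (M + (h + (18 * (C + 2) * h + (M + (M +
      (h + (1 + h))))))))) ?_ ?_
    · refine (ih _ c₁ (X := X₁₁) (fun _ _ => hV _ _) hpd₁).bind fun Ai W₁ h₁ hAi => ?_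
      refine (spec_mm hS hC hω hs0 hAi (hB.mono h₁) le_rfl le_rfl le_rfl c₁' c₁' c₂').bind
        fun F W₂ h₂ hF => ?_
      have hB₂ := hB.mono (h₁.trans h₂)
      refine (spec_mm hS hC hω hs0 hB₂.transpose hF le_rfl le_rfl le_rfl c₂' c₁' c₂').bind
        fun H W₃ h₃ hH => ?_
      refine ((spec_entries (X := X₂₂ - X₁₂ᵀ * (X₁₁⁻¹ * X₁₂)) fun a b W₄ h₄ =>
        spec_sub ((hV _ _).mono (((h₁.trans h₂).trans h₃).trans h₄))
          ((hH a b).mono h₄)).cost_le (ent (by simp) (by simp) c₂' c₂')).bind fun D W₄ h₄ hD => ?_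
      refine (ih _ c₂ hD hpd₂).bind fun Si W₅ h₅ hSi => ?_
      have hF₅ := hF.mono (h₃.trans (h₄.trans h₅))
      refine (spec_mm hS hC hω hs0 hF₅ hSi le_rfl le_rfl le_rfl c₁' c₂' c₂').bind
        fun G W₆ h₆ hG => ?_
      refine (spec_mm hS hC hω hs0 hG (hF₅.mono h₆).transpose le_rfl le_rfl le_rfl
        c₁' c₂' c₁').bind fun K W₇ h₇ hK => ?_
      have hAi₇ := hAi.mono (((h₂.trans h₃).trans (h₄.trans h₅)).trans (h₆.trans h₇))
      refine ((spec_entries (X := X₁₁⁻¹ + _ * (X₁₁⁻¹ * X₁₂)ᵀ) fun a b W₈ h₈ =>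
        spec_add ((hAi₇ a b).mono h₈) ((hK a b).mono h₈)).cost_le
          (ent (by simp) (by simp) c₁' c₁')).bind fun TL W₈ h₈ hTL => ?_
      refine (spec_const 0).bind fun z W₉ h₉ hz => ?_
      have hG₉ := hG.mono ((h₇.trans h₈).trans h₉)
      refine ((spec_entries (X := -(X₁₁⁻¹ * X₁₂ * (X₂₂ - X₁₂ᵀ * (X₁₁⁻¹ * X₁₂))⁻¹))
        fun a b W' h' => ?_).cost_le (ent (by simp) (by simp) c₁' c₂')).map
          fun TR W' h' hTR => ?_
      · have := spec_sub (f := f) (κ := κ) (hz.mono h') ((hG₉ a b).mono h')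
        rwa [zero_sub] at this
      · intro a b
        have hinvX : X⁻¹ a b = (X.submatrix e.symm e.symm)⁻¹ (e a) (e b) := by
          rw [Matrix.inv_submatrix_equiv]
          simp
        rw [hinvX, hXX, hinv']
        have hTL' := hTL.mono (h₉.trans h')
        have hSi' := hSi.mono (((h₆.trans h₇).trans (h₈.trans h₉)).trans h')
        change Rep inp W' (Matrix.fromBlocks TL TR (fun b a => TR a b) Si (e a) (e b)) _
        rcases e a with i | i <;> rcases e b with k | k
        · exact hTL' i k
        · exact hTR i k
        · exact hTR k i
        · exact hSi' i k
    · have h1 : 1 ≤ h := Real.one_le_rpow hs1 (by linarith)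
      have h4 : 4 * h ≤ ((2 ^ (j + 1) : ℕ) : ℝ) ^ ω := by
        have : ((2 ^ (j + 1) : ℕ) : ℝ) = 2 * s := by rw [hs]; push_cast; ring
        rw [this, Real.mul_rpow (by norm_num) (by linarith)]
        have : (4 : ℝ) ≤ 2 ^ ω := by
          calc (4 : ℝ) = 2 ^ (2 : ℝ) := by norm_num
            _ ≤ 2 ^ ω := Real.rpow_le_rpow_of_exponent_le (by norm_num) hω
        gcongr
      have := mul_le_mul_of_nonneg_left h4 (by positivity : 0 ≤ 18 * (C + 2))
      refine le_trans ?_ this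
      rw [hM]
      nlinarith [mul_nonneg hC (by linarith : 0 ≤ h)]

lemma sq_le_rpow {s : ℕ} (hs : 0 < s) {ω : ℝ} (hω : 2 ≤ ω) : (s : ℝ) * s ≤ (s : ℝ) ^ ω := by
  rw [← sq, ← Real.rpow_natCast]
  exact Real.rpow_le_rpow_of_exponent_le (by exact_mod_cast hs) (by exact_mod_cast hω)

/-- Rounding the size up to a power of two multiplies the cost by at most `2 ^ ω ≤ 8`. -/
lemma two_pow_clog_rpow_le {k : ℕ} (hk : 0 < k) {ω : ℝ} (hω : 2 ≤ ω) (hω' : ω ≤ 3) :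
    ((2 ^ Nat.clog 2 k : ℕ) : ℝ) ^ ω ≤ 8 * (k : ℝ) ^ ω := by
  have h : 2 ^ Nat.clog 2 k ≤ 2 * k := by
    rcases Nat.lt_or_ge 1 k with h1 | h1
    · have h2 := Nat.pow_pred_clog_lt_self (b := 2) (by norm_num) h1
      have h3 : 0 < Nat.clog 2 k := Nat.clog_pos (by norm_num) h1
      obtain ⟨c, hc⟩ : ∃ c, Nat.clog 2 k = c + 1 := ⟨_, (Nat.succ_pred_eq_of_pos h3).symm⟩
      rw [hc] at h2 ⊢
      simp only [Nat.pred_succ] at h2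
      rw [pow_succ]
      omega
    · have : k = 1 := by omega
      subst this
      simp
  calc ((2 ^ Nat.clog 2 k : ℕ) : ℝ) ^ ω ≤ ((2 * k : ℕ) : ℝ) ^ ω :=
        Real.rpow_le_rpow (by positivity) (by exact_mod_cast h) (by linarith)
    _ = 2 ^ ω * (k : ℝ) ^ ω := by
        push_cast
        rw [Real.mul_rpow (by norm_num) (by positivity)]
    _ ≤ 8 * (k : ℝ) ^ ω := by
        have : (2 : ℝ) ^ ω ≤ 8 := by
          calc (2 : ℝ) ^ ω ≤ 2 ^ (3 : ℝ) := Real.rpow_le_rpow_of_exponent_le (by norm_num) hω'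
            _ = 8 := by norm_num
        gcongr

/-- Inversion of an invertible matrix `G` as `(Gᵀ G)⁻¹ Gᵀ`. -/
def Prog.inv (S : MulFamily) (hβ : 0 < Fintype.card β) (V : β → β → Reg ι) :
    Prog ι κ n (β → β → Reg ι) := do
  let K ← Prog.mm S hβ (fun b a => V a b) V
  let Ki ← Prog.invPosDef S (Nat.clog 2 (Fintype.card β)) β K
  Prog.mm S hβ Ki fun b a => V a b

lemma spec_inv [DecidableEq β] {ω C : ℝ} {S : MulFamily} (hS : IsMulFamily ω C S) (hC : 0 ≤ C)
    (hω : 2 ≤ ω) (hω' : ω ≤ 3) (hβ : 0 < Fintype.card β) {V : β → β → Reg ι} {G : Matrix β β ℝ}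
    (hV : RepMat inp W V G) (hG : IsUnit G.det) :
    Spec f inp (.inv S hβ V : Prog ι κ n _) W (fun R W' => RepMat inp W' R G⁻¹)
      (160 * (C + 2) * (Fintype.card β : ℝ) ^ ω) := by
  obtain ⟨hpd, hinv⟩ := posDef_transpose_mul_self_of_isUnit hG
  have hc : (Fintype.card β : ℝ) ≤ 1 * Fintype.card β := by rw [one_mul]
  rw [hinv]
  refine Spec.cost_le ((spec_mm hS hC hω hβ hV.transpose hV le_rfl le_rfl le_rfl hc hc hc).bind
    fun K W₁ h₁ hK => (spec_invPosDef hS hC hω _ β (Nat.le_pow_clog (by norm_num) _) hK hpd).bind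
      fun Ki W₂ h₂ hKi => spec_mm hS hC hω hβ hKi (hV.mono (h₁.trans h₂)).transpose
        le_rfl le_rfl le_rfl hc hc hc) ?_
  have := mul_le_mul_of_nonneg_left (two_pow_clog_rpow_le hβ hω hω')
    (by positivity : 0 ≤ 18 * (C + 2))
  linarith

/-! ### Maintaining the inverse of `A diag(z) Aᵀ` -/

variable {m : ℕ}

/-- Given the inverse `M` of `A diag(z) Aᵀ` and the changes `d` of the entries of `z` in `c`,
compute the new inverse by the Woodbury formula. -/
def Prog.lowRank (S : MulFamily) (A : Fin m → Fin n → Reg ι) (d : Fin n → Reg ι)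
    (c : Finset (Fin n)) (hc : 0 < Fintype.card c) (M : Fin m → Fin m → Reg ι) :
    Prog ι κ n (Fin m → Fin m → Reg ι) := do
  let one ← Prog.const 1
  let V ← Prog.mm S hc M fun a (i : c) => A a i
  let U ← Prog.mm S hc (fun (i : c) a => A a i) V
  let G ← Prog.entries fun (i j : c) => do
    let t ← Prog.mul (d i) (U i j)
    if i = j then Prog.add one t else pure t
  let Gi ← Prog.inv S hc G
  let H ← Prog.entries fun (i j : c) => .mul (Gi i j) (d j)
  let Y ← Prog.mm S hc V H
  let Z ← Prog.mm S hc Y fun i a => V a i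
  Prog.entries fun a b => .sub (M a b) (Z a b)

lemma spec_lowRank_aux {ω C : ℝ} {S : MulFamily} (hS : IsMulFamily ω C S) (hC : 0 ≤ C)
    (hω : 2 ≤ ω) (hω' : ω ≤ 3) {A : Fin m → Fin n → Reg ι} {X : Matrix (Fin m) (Fin n) ℝ}
    (hX : LinearIndependent ℝ X.row) {d : Fin n → Reg ι} {z z' : Fin n → ℝ} (hz : ∀ i, 0 < z i)
    (hz' : ∀ i, 0 < z' i) {c : Finset (Fin n)} (hc : 0 < Fintype.card c)
    {M : Fin m → Fin m → Reg ι} {p : ℝ} (hp : 1 ≤ p) (hm : (m : ℝ) = p * Fintype.card c)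
    (hA : RepMat inp W A X) (hd : ∀ i ∈ c, Rep inp W (d i) (z' i - z i))
    (hM : RepMat inp W M (gram X z)⁻¹) :
    Spec f inp (.lowRank S A d c hc M : Prog ι κ n _) W
      (fun R W' => RepMat inp W' R (gram X (c.piecewise z' z))⁻¹)
      (200 * (C + 2) * (p * p * (Fintype.card c : ℝ) ^ ω)) := by
  set k := Fintype.card c with hk
  have hpd := gram_posDef hX hz
  have hpd' : (gram X (c.piecewise z' z)).PosDef := gram_posDef hX fun i => by
    by_cases hi : i ∈ c
    · rw [Finset.piecewise_eq_of_mem _ _ _ hi]; exact hz' i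
    · rw [Finset.piecewise_eq_of_notMem _ _ _ hi]; exact hz i
  rw [gram_piecewise] at hpd' ⊢
  set N := gram X z
  set U := X.submatrix id ((↑) : c → Fin n) with hU
  set Δ := Matrix.diagonal fun i : c => z' i - z i with hΔ
  obtain ⟨hGu, hinv⟩ := inv_add_mul_diagonal_mul U Δ hpd hpd'
  rw [hinv]
  have hAU : RepMat inp W (fun a (i : c) => A a i) U := fun a i => hA a i
  have ck : (Fintype.card c : ℝ) ≤ 1 * k := by rw [one_mul]
  have cm : (Fintype.card (Fin m) : ℝ) ≤ p * k := by rw [Fintype.card_fin, hm]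
  have hkk := sq_le_rpow hc hω
  set h := (k : ℝ) ^ ω with hh
  have hh0 : 0 ≤ h := by positivity
  have ent : (Fintype.card c : ℝ) * (Fintype.card c) * 1 ≤ h := by rw [mul_one]; exact hkk
  refine Spec.cost_le (c := 1 + (8 * (C + 2) * (p * p * 1 * h) + (8 * (C + 2) * (1 * p * 1 * h) +
    (2 * h + (160 * (C + 2) * h + (h + (8 * (C + 2) * (p * 1 * 1 * h) +
    (8 * (C + 2) * (p * 1 * p * h) + p * p * h)))))))) ?_ ?_
  · refine (spec_const 1).bind fun one W₁ h₁ hone => ?_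
    refine (spec_mm hS hC hω hc (hM.mono h₁) (hAU.mono h₁) hp hp le_rfl cm cm ck).bind
      fun V W₂ h₂ hV => ?_
    refine (spec_mm hS hC hω hc (hAU.mono (h₁.trans h₂)).transpose hV le_rfl hp le_rfl
      ck cm ck).bind fun T W₃ h₃ hT => ?_
    refine ((spec_entries (X := 1 + Δ * (Uᵀ * (N⁻¹ * U))) (c := 2) fun i j W' h' => ?_).cost_le
      (by linarith)).bind fun G W₄ h₄ hG => ?_
    · refine Spec.cost_le (c := 1 + 1) ((spec_mul ((hd i i.2).mono
        (((h₁.trans h₂).trans h₃).trans h')) ((hT i j).mono h')).bind fun t W'' h'' ht => ?_)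
        (by norm_num)
      rw [Matrix.add_apply, hΔ, Matrix.diagonal_mul]
      split_ifs with hij
      · subst hij
        rw [Matrix.one_apply_eq]
        exact spec_add (hone.mono (((h₂.trans h₃).trans h').trans h'')) ht
      · rw [Matrix.one_apply_ne hij, zero_add]
        exact (Spec.pure ht).cost_le zero_le_one
    refine (spec_inv hS hC hω hω' hc hG hGu).bind fun Gi W₅ h₅ hGi => ?_
    have h₁₅ := ((h₁.trans h₂).trans h₃).trans (h₄.trans h₅)
    refine ((spec_entries (X := (1 + Δ * (Uᵀ * (N⁻¹ * U)))⁻¹ * Δ) fun i j W' h' => ?_).cost_le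
      ent).bind fun H W₆ h₆ hH => ?_
    · rw [hΔ, Matrix.mul_diagonal]
      exact spec_mul ((hGi i j).mono h') ((hd j j.2).mono (h₁₅.trans h'))
    have hV₆ := hV.mono ((h₃.trans h₄).trans (h₅.trans h₆))
    refine (spec_mm hS hC hω hc hV₆ hH hp le_rfl le_rfl cm ck ck).bind fun Y W₇ h₇ hY => ?_
    refine (spec_mm hS hC hω hc hY (hV₆.mono h₇).transpose hp le_rfl hp cm ck cm).bind
      fun Z W₈ h₈ hZ => ?_
    refine (spec_entries fun a b W' h' => spec_sub ((hM a b).mono ?_)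
      ((hZ a b).mono h')).cost_le ?_
    · exact h₁₅.trans (((h₆.trans h₇).trans h₈).trans h')
    · rw [Fintype.card_fin, hm]
      have := mul_le_mul_of_nonneg_left hkk (by positivity : 0 ≤ p * p)
      linarith
  · have hk1 : (1 : ℝ) ≤ k := by exact_mod_cast hc
    have h1 : 1 ≤ h := Real.one_le_rpow hk1 (by linarith)
    have hpp : p ≤ p * p := by nlinarith
    have e1 : h ≤ p * p * h := le_mul_of_one_le_left hh0 (by nlinarith)
    have e2 : p * h ≤ p * p * h := by gcongr
    set y := p * p * h
    have e3 := mul_le_mul_of_nonneg_left e1 (by positivity : 0 ≤ C + 2)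
    have e4 := mul_le_mul_of_nonneg_left e2 (by positivity : 0 ≤ C + 2)
    have e5 : 2 * y ≤ (C + 2) * y := by
      have : 0 ≤ C * y := mul_nonneg hC (by linarith)
      linarith
    have t1 : p * p * 1 * h = y := by ring
    have t2 : p * 1 * p * h = y := by ring
    have t3 : 1 * p * 1 * h = p * h := by ring
    have t4 : p * 1 * 1 * h = p * h := by ring
    rw [t1, t2, t3, t4]
    linarith

/-- For an exponent `ω ≤ 5 / 2` a change of `k ≤ m` entries costs `O(m² √k)`. -/
lemma spec_lowRank {ω C : ℝ} {S : MulFamily} (hS : IsMulFamily ω C S) (hC : 0 ≤ C)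
    (hω : 2 ≤ ω) (hω' : ω ≤ 5 / 2) {A : Fin m → Fin n → Reg ι} {X : Matrix (Fin m) (Fin n) ℝ}
    (hX : LinearIndependent ℝ X.row) {d : Fin n → Reg ι} {z z' : Fin n → ℝ} (hz : ∀ i, 0 < z i)
    (hz' : ∀ i, 0 < z' i) {c : Finset (Fin n)} (hc : 0 < Fintype.card c) (hcm : c.card ≤ m)
    {M : Fin m → Fin m → Reg ι}
    (hA : RepMat inp W A X) (hd : ∀ i ∈ c, Rep inp W (d i) (z' i - z i))
    (hM : RepMat inp W M (gram X z)⁻¹) :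
    Spec f inp (.lowRank S A d c hc M : Prog ι κ n _) W
      (fun R W' => RepMat inp W' R (gram X (c.piecewise z' z))⁻¹)
      (200 * (C + 2) * (m * m * √c.card)) := by
  have hck : Fintype.card c = c.card := Fintype.card_coe c
  have hk0 : (0 : ℝ) < Fintype.card c := by exact_mod_cast hc
  have hk1 : (1 : ℝ) ≤ Fintype.card c := by exact_mod_cast hc
  refine (spec_lowRank_aux (p := (m : ℝ) / Fintype.card c) hS hC hω (by linarith) hX hz hz' hc
    ?_ ?_ hA hd hM).cost_le ?_
  · rw [le_div_iff₀ hk0, one_mul, hck]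
    exact_mod_cast hcm
  · field_simp
  · refine mul_le_mul_of_nonneg_left ?_ (by positivity)
    have : (Fintype.card c : ℝ) ^ ω ≤ (Fintype.card c : ℝ) ^ 2 * √c.card := by
      rw [Real.sqrt_eq_rpow, ← hck, ← Real.rpow_natCast, ← Real.rpow_add hk0]
      refine Real.rpow_le_rpow_of_exponent_le hk1 ?_
      norm_num
      linarith
    calc (m : ℝ) / Fintype.card c * (m / Fintype.card c) * (Fintype.card c : ℝ) ^ ω
        ≤ (m : ℝ) / Fintype.card c * (m / Fintype.card c) *
          ((Fintype.card c : ℝ) ^ 2 * √c.card) := by gcongr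
      _ = m * m * √c.card := by field_simp

/-- A set of `m` elements of `s`, or `s` itself if it has at most `m` elements. -/
def chunk (m : ℕ) (s : Finset (Fin n)) : Finset (Fin n) :=
  (Finset.exists_subset_card_eq (Nat.min_le_right m s.card)).choose

lemma chunk_subset (m : ℕ) (s : Finset (Fin n)) : chunk m s ⊆ s :=
  (Finset.exists_subset_card_eq (Nat.min_le_right m s.card)).choose_spec.1

lemma card_chunk (m : ℕ) (s : Finset (Fin n)) : (chunk m s).card = min m s.card :=
  (Finset.exists_subset_card_eq (Nat.min_le_right m s.card)).choose_spec.2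

lemma chunk_pos (hm : 0 < m) {s : Finset (Fin n)} (hs : s.Nonempty) :
    0 < Fintype.card (chunk m s) := by
  rw [Fintype.card_coe, card_chunk]
  exact lt_min hm hs.card_pos

/-- Updates on arbitrary sets `s` of entries, in chunks of at most `m` entries; the numeral bounds
the number of chunks. -/
def Prog.update (S : MulFamily) (hm : 0 < m) (A : Fin m → Fin n → Reg ι) (d : Fin n → Reg ι) :
    ℕ → Finset (Fin n) → (Fin m → Fin m → Reg ι) → Prog ι κ n (Fin m → Fin m → Reg ι)
  | 0, _, M => pure M
  | j + 1, s, M =>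
    if hs : s.Nonempty then do
      let M' ← Prog.lowRank S A d (chunk m s) (chunk_pos hm hs) M
      Prog.update S hm A d j (s \ chunk m s) M'
    else pure M

/-- The cost, up to a constant, of an update of `k` entries in chunks of at most `m` entries. -/
def updateCost (m k : ℕ) : ℝ :=
  if k ≤ m then m * m * √k else m * √m * (k + m)

lemma updateCost_le (m k : ℕ) : updateCost m k ≤ m * √m * (k + m) := by
  unfold updateCost
  split_ifs with h
  · have h1 : √(k : ℝ) ≤ √m := Real.sqrt_le_sqrt (by exact_mod_cast h)
    have h2 : (0 : ℝ) ≤ m * √m * k := by positivity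
    have h3 : (m : ℝ) * m * √k ≤ m * m * √m := by gcongr
    linarith
  · exact le_rfl

lemma updateCost_nonneg (m k : ℕ) : 0 ≤ updateCost m k := by
  unfold updateCost
  split_ifs <;> positivity

/-- An update of `k ≤ n` entries costs `O(n m √k)`: for `k > m` this is because of
`√m ≤ √n` and `√k ≤ √n`. -/
lemma updateCost_le_mul_sqrt {m k n : ℕ} (hmn : m ≤ n) (hkn : k ≤ n) :
    updateCost m k ≤ 2 * (n * m) * √k := by
  unfold updateCost
  have hmn' : (m : ℝ) ≤ n := by exact_mod_cast hmn
  split_ifs with h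
  · have h1 : (m : ℝ) * m * √k ≤ n * m * √k := by gcongr
    have h2 : 0 ≤ (n : ℝ) * m * √k := by positivity
    linarith
  · have h1 : √(m : ℝ) * √k ≤ n := by
      calc √(m : ℝ) * √k ≤ √n * √n := by gcongr
        _ = n := Real.mul_self_sqrt (by positivity)
    have h2 : (m : ℝ) ≤ k := by exact_mod_cast (not_le.mp h).le
    calc (m : ℝ) * √m * (k + m) ≤ m * √m * (k + k) := by gcongr
      _ = 2 * m * (√m * √k) * √k := by
        have : (k : ℝ) = √k * √k := (Real.mul_self_sqrt (by positivity)).symm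
        linear_combination 2 * (m : ℝ) * √m * this
      _ ≤ 2 * m * n * √k := by gcongr
      _ = _ := by ring

lemma spec_update {ω C : ℝ} {S : MulFamily} (hS : IsMulFamily ω C S) (hC : 0 ≤ C)
    (hω : 2 ≤ ω) (hω' : ω ≤ 5 / 2) (hm : 0 < m) {A : Fin m → Fin n → Reg ι}
    {X : Matrix (Fin m) (Fin n) ℝ} (hX : LinearIndependent ℝ X.row) {d : Fin n → Reg ι}
    {z' : Fin n → ℝ} (hz' : ∀ i, 0 < z' i) (j : ℕ) {z : Fin n → ℝ} (hz : ∀ i, 0 < z i)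
    {s : Finset (Fin n)} (hs : s.card ≤ j) {W : World} {M : Fin m → Fin m → Reg ι}
    (hA : RepMat inp W A X) (hd : ∀ i ∈ s, Rep inp W (d i) (z' i - z i))
    (hM : RepMat inp W M (gram X z)⁻¹) :
    Spec f inp (.update S hm A d j s M : Prog ι κ n _) W
      (fun R W' => RepMat inp W' R (gram X (s.piecewise z' z))⁻¹)
      (200 * (C + 2) * updateCost m s.card) := by
  have hnonneg : ∀ k, 0 ≤ 200 * (C + 2) * updateCost m k := fun k =>
    mul_nonneg (by positivity) (updateCost_nonneg m k)
  have hempty : ∀ {z : Fin n → ℝ} {s : Finset (Fin n)}, ¬ s.Nonempty → s.piecewise z' z = z := by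
    intro z s h
    rw [Finset.not_nonempty_iff_eq_empty.mp h, Finset.piecewise_empty]
  induction j generalizing z s W M with
  | zero =>
    rw [hempty (by simpa using hs)]
    exact (Spec.pure hM).cost_le (hnonneg _)
  | succ j ih =>
    rw [Prog.update]
    split_ifs with hne
    · set c := chunk m s with hcdef
      have hcs : c ⊆ s := chunk_subset m s
      have hcc : c.card = min m s.card := card_chunk m s
      have hpos : 0 < c.card := by rw [hcc]; exact lt_min hm hne.card_pos
      have hpw : s.piecewise z' z = (s \ c).piecewise z' (c.piecewise z' z) := by
        ext i
        by_cases h1 : i ∈ c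
        · simp [Finset.piecewise, h1, hcs h1]
        · simp [Finset.piecewise, h1]
      have hzc : ∀ i, 0 < c.piecewise z' z i := fun i => by
        by_cases hi : i ∈ c
        · rw [Finset.piecewise_eq_of_mem _ _ _ hi]; exact hz' i
        · rw [Finset.piecewise_eq_of_notMem _ _ _ hi]; exact hz i
      have hcard : (s \ c).card = s.card - c.card := Finset.card_sdiff_of_subset hcs
      rw [hpw]
      refine ((spec_lowRank hS hC hω hω' hX hz hz' (chunk_pos hm hne)
        (by rw [card_chunk]; exact min_le_left _ _) hA (fun i hi => hd i (hcs hi)) hM).bind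
          fun M' W' hW hM' => ih hzc (by change (s \ c).card ≤ j; omega) (hA.mono hW)
            (fun i hi => ?_) hM').cost_le ?_
      · rw [Finset.mem_sdiff] at hi
        rw [Finset.piecewise_eq_of_notMem _ _ _ hi.2]
        exact (hd i hi.1).mono hW
      · rw [← mul_add]
        refine mul_le_mul_of_nonneg_left ?_ (by positivity)
        rw [hcard, ← hcdef]
        by_cases hsm : s.card ≤ m
        · rw [min_eq_right hsm] at hcc
          simp [hcc, updateCost, hsm]
        · rw [min_eq_left (not_le.mp hsm).le] at hcc
          have h1 := updateCost_le m (s.card - c.card)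
          rw [hcc, Nat.cast_sub (not_le.mp hsm).le] at h1
          rw [hcc, updateCost.eq_1 m s.card, if_neg hsm]
          linarith
    · rw [hempty hne]
      exact (Spec.pure hM).cost_le (hnonneg _)

/-- The initial computation of the inverse of `A diag(z) Aᵀ`. -/
def Prog.gramInv (S : MulFamily) (hm : 0 < m) (A : Fin m → Fin n → Reg ι) (z : Fin n → Reg ι) :
    Prog ι κ n (Fin m → Fin m → Reg ι) := do
  let B ← Prog.entries fun a i => .mul (A a i) (z i)
  let N ← Prog.mm S hm B fun i a => A a i
  Prog.invPosDef S (Nat.clog 2 m) (Fin m) N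

lemma spec_gramInv {ω C : ℝ} {S : MulFamily} (hS : IsMulFamily ω C S) (hC : 0 ≤ C)
    (hω : 2 ≤ ω) (hω' : ω ≤ 3) (hm : 0 < m) (hmn : m ≤ n) {A : Fin m → Fin n → Reg ι}
    {X : Matrix (Fin m) (Fin n) ℝ} (hX : LinearIndependent ℝ X.row) {zr : Fin n → Reg ι}
    {z : Fin n → ℝ} (hz : ∀ i, 0 < z i) (hA : RepMat inp W A X)
    (hzr : ∀ i, Rep inp W (zr i) (z i)) :
    Spec f inp (.gramInv S hm A zr : Prog ι κ n _) W
      (fun R W' => RepMat inp W' R (gram X z)⁻¹)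
      (160 * (C + 2) * (n * (m : ℝ) ^ (ω - 1))) := by
  have hm0 : (0 : ℝ) < m := by exact_mod_cast hm
  have hq : (1 : ℝ) ≤ (n : ℝ) / m := by
    rw [le_div_iff₀ hm0, one_mul]; exact_mod_cast hmn
  have hpow : (m : ℝ) ^ ω = m * (m : ℝ) ^ (ω - 1) := by
    rw [Real.rpow_sub_one hm0.ne']
    field_simp
  have h1 : (m : ℝ) ≤ (m : ℝ) ^ (ω - 1) := by
    calc (m : ℝ) = (m : ℝ) ^ (1 : ℝ) := (Real.rpow_one _).symm
      _ ≤ _ := Real.rpow_le_rpow_of_exponent_le (by exact_mod_cast hm) (by linarith)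
  have hm1 : (Fintype.card (Fin m) : ℝ) ≤ 1 * m := by simp
  refine Spec.cost_le (c := Fintype.card (Fin m) * Fintype.card (Fin n) * 1 +
    (8 * (C + 2) * (1 * (n / m) * 1 * (m : ℝ) ^ ω) +
      18 * (C + 2) * ((2 ^ Nat.clog 2 m : ℕ) : ℝ) ^ ω)) ?_ ?_
  · refine (spec_entries (X := X * Matrix.diagonal z) fun a i W' hW => ?_).bind
      fun B W₁ h₁ hB => (spec_mm hS hC hω hm hB (hA.mono h₁).transpose le_rfl hq le_rfl hm1
        (le_of_eq ?_) hm1).bind fun N W₂ h₂ hN =>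
          spec_invPosDef hS hC hω _ _ (by simpa using Nat.le_pow_clog (by norm_num) m) hN
            (gram_posDef hX hz)
    · rw [Matrix.mul_diagonal]
      exact spec_mul ((hA a i).mono hW) ((hzr i).mono hW)
    · rw [Fintype.card_fin]
      field_simp
  · have h2 := mul_le_mul_of_nonneg_left (two_pow_clog_rpow_le hm hω hω')
      (by positivity : 0 ≤ 18 * (C + 2))
    set y := (n : ℝ) * (m : ℝ) ^ (ω - 1) with hy
    have h3 : (m : ℝ) ^ ω ≤ y := by rw [hpow, hy]; gcongr
    have h4 : (m : ℝ) * n * 1 ≤ y := by rw [hy]; nlinarith [(Nat.cast_nonneg n : (0 : ℝ) ≤ n)]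
    have h5 : 1 * ((n : ℝ) / m) * 1 * (m : ℝ) ^ ω = y := by
      rw [hpow, hy]
      field_simp
    rw [h5, Fintype.card_fin, Fintype.card_fin]
    have h6 := mul_le_mul_of_nonneg_left h3 (by positivity : 0 ≤ C + 2)
    have h7 : 0 ≤ C * y := mul_nonneg hC (by positivity)
    have h8 : 0 ≤ y := by positivity
    linarith

end FastLinearAlgebra

/-! ### The potential function -/

section Potential

variable {m n : ℕ}

lemma inner_eq_sum (x y : E n) : inner ℝ x y = ∑ i, x i * y i := by
  rw [PiLp.inner_apply]
  exact Finset.sum_congr rfl fun i _ => by simp [mul_comm]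

lemma norm_sq_eq_sum (x : E n) : ‖x‖ ^ 2 = ∑ i, x i ^ 2 := by
  rw [← real_inner_self_eq_norm_sq, inner_eq_sum]
  exact Finset.sum_congr rfl fun i _ => (sq _).symm

lemma abs_apply_le_norm (x : E n) (i : Fin n) : |x i| ≤ ‖x‖ :=
  PiLp.norm_apply_le x i

lemma hasGradientAt_potential {f : E n → ℝ} {ε : ℝ} {x : E n} (hx : ∀ i, 0 < x i)
    (hf : DifferentiableAt ℝ f x) :
    HasGradientAt (potential ε f) (gradient f x - WithLp.toLp 2 fun i => ε / x i) x := by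
  rw [hasGradientAt_iff_hasFDerivAt]
  have h1 : HasFDerivAt f (InnerProductSpace.toDual ℝ (E n) (gradient f x)) x :=
    hf.hasGradientAt.hasFDerivAt
  have h2 : ∀ i, HasFDerivAt (fun y : E n => Real.log (y i))
      ((x i)⁻¹ • (EuclideanSpace.proj i : E n →L[ℝ] ℝ)) x := fun i =>
    (EuclideanSpace.proj i : E n →L[ℝ] ℝ).hasFDerivAt.log (hx i).ne'
  have h3 := h1.sub ((HasFDerivAt.fun_sum fun i (_ : i ∈ Finset.univ) => h2 i).const_mul ε)
  refine h3.congr_fderiv ?_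
  ext v
  simp only [map_sub, sub_apply, smul_apply, sum_apply, InnerProductSpace.toDual_apply_apply,
    inner_eq_sum, smul_eq_mul, PiLp.proj_apply, Finset.mul_sum]
  congr 1
  exact Finset.sum_congr rfl fun i _ => by rw [div_eq_mul_inv]; ring

/-- The scaled gradient `X ∇φ(x)`. -/
lemma scale_gradient_potential_apply {f : E n → ℝ} {ε : ℝ} {x : E n} (hx : ∀ i, 0 < x i)
    (hf : DifferentiableAt ℝ f x) (i : Fin n) :
    scale x (gradient (potential ε f) x) i = x i * gradient f x i - ε := by
  rw [(hasGradientAt_potential hx hf).gradient]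
  have := (hx i).ne'
  simp only [scale, PiLp.sub_apply]
  field_simp

/-- A concave function lies below its tangents. -/
lemma le_add_inner_gradient {s : Set (E n)} {f : E n → ℝ} (hf : ConcaveOn ℝ s f) {x y : E n}
    (hx : x ∈ s) (hy : y ∈ s) (hd : DifferentiableAt ℝ f x) :
    f y ≤ f x + inner ℝ (gradient f x) (y - x) := by
  let g : ℝ →ᵃ[ℝ] E n := AffineMap.lineMap x y
  have hg : ConcaveOn ℝ (g ⁻¹' s) (f ∘ g) := hf.comp_affineMap g
  have h0 : (0 : ℝ) ∈ g ⁻¹' s := by simpa [g] using hx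
  have h1 : (1 : ℝ) ∈ g ⁻¹' s := by simpa [g] using hy
  have hderiv : HasDerivAt (f ∘ g) (inner ℝ (gradient f x) (y - x)) 0 := by
    have hg' : HasDerivAt g (y - x) 0 := by
      simpa [g] using AffineMap.hasDerivAt_lineMap (a := x) (b := y) (x := (0 : ℝ))
    have hf' : HasFDerivAt f (InnerProductSpace.toDual ℝ (E n) (gradient f x)) (g 0) := by
      simpa [g] using hd.hasGradientAt.hasFDerivAt
    simpa using hf'.comp_hasDerivAt 0 hg'
  have := hg.slope_le_of_hasDerivAt h0 h1 zero_lt_one hderiv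
  have g0 : g 0 = x := by simp [g]
  have g1 : g 1 = y := by simp [g]
  rw [slope_def_field, Function.comp_apply, Function.comp_apply, g0, g1, sub_zero, div_one] at this
  linarith

/-- The quadratic lower bound for the logarithm that replaces the barrier by its second order
model. -/
lemma sub_sq_le_log_one_add {d : ℝ} (hd : |d| ≤ 1 / 2) : d - d ^ 2 ≤ Real.log (1 + d) := by
  rw [abs_le] at hd
  rcases le_total 0 d with h | h
  · have h1 := Real.one_sub_inv_le_log_of_pos (x := 1 + d) (by linarith)
    have h2 : d - d ^ 2 ≤ 1 - (1 + d)⁻¹ := by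
      have : 1 - (1 + d)⁻¹ = d / (1 + d) := by
        have : 1 + d ≠ 0 := by linarith
        field_simp
        ring
      rw [this, le_div_iff₀ (by linarith)]
      nlinarith [pow_nonneg h 3]
    linarith
  · rw [Real.le_log_iff_exp_le (by linarith)]
    obtain ⟨a, rfl⟩ : ∃ a, d = -a := ⟨-d, by ring⟩
    have ha : 0 ≤ a := by linarith
    have ha' : a ≤ 1 / 2 := by linarith
    have h1 := Real.quadratic_le_exp_of_nonneg (x := a + a ^ 2) (by positivity)
    have h2 : -a - (-a) ^ 2 = -(a + a ^ 2) := by ring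
    rw [h2, Real.exp_neg]
    refine inv_le_of_inv_le₀ (by linarith) (le_trans ?_ h1)
    rw [inv_le_iff_one_le_mul₀ (by linarith)]
    have h3 : a + a ^ 2 + a ^ 3 ≤ 1 := by
      nlinarith [pow_le_pow_left₀ ha ha' 3, pow_le_pow_left₀ ha ha' 2]
    nlinarith [mul_nonneg (sq_nonneg a) (sub_nonneg.mpr h3)]

lemma abs_log_one_add_le {d : ℝ} (hd : |d| ≤ 1 / 2) : |Real.log (1 + d)| ≤ 2 * |d| := by
  have h1 := sub_sq_le_log_one_add hd
  have h2 : Real.log (1 + d) ≤ d := by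
    have := Real.log_le_sub_one_of_pos (x := 1 + d) (by rw [abs_le] at hd; linarith)
    linarith
  have h3 : d ^ 2 ≤ |d| := by
    rw [← sq_abs]
    nlinarith [abs_nonneg d]
  rw [abs_le]
  constructor <;> nlinarith [neg_abs_le d, le_abs_self d]

/-! ### The approximate projection -/

/-- The multipliers `(A X̄² Aᵀ)⁻¹ A X g`. -/
def multiplier (A : Matrix (Fin m) (Fin n) ℝ) (x xbar g : E n) : Fin m → ℝ :=
  (gram A fun i => xbar i ^ 2)⁻¹ *ᵥ (A *ᵥ fun i => x i * g i)

lemma approxProjection_mulVec_apply (A : Matrix (Fin m) (Fin n) ℝ) {x : E n} (xbar g : E n)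
    (hx : ∀ i, 0 < x i) (i : Fin n) :
    (approxProjection A x xbar *ᵥ g.ofLp) i =
      g i - xbar i ^ 2 / x i * (Aᵀ *ᵥ multiplier A x xbar g) i := by
  have hinv : (Matrix.diagonal x.ofLp)⁻¹ = Matrix.diagonal fun i => (x i)⁻¹ := by
    refine Matrix.inv_eq_right_inv ?_
    rw [Matrix.diagonal_mul_diagonal, ← Matrix.diagonal_one]
    congr 1
    ext i
    exact mul_inv_cancel₀ (hx i).ne'
  have hg : (Matrix.diagonal x.ofLp) *ᵥ g.ofLp = fun i => x i * g i := by
    ext i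
    rw [Matrix.mulVec_diagonal]
  have hgram : A * Matrix.diagonal xbar.ofLp ^ 2 * Aᵀ = gram A fun i => xbar i ^ 2 := by
    rw [gram, Matrix.diagonal_pow]
    rfl
  rw [approxProjection, hgram, Matrix.sub_mulVec, Matrix.one_mulVec, hinv]
  simp only [← Matrix.mulVec_mulVec, hg, Pi.sub_apply]
  rw [Matrix.mulVec_diagonal, Matrix.diagonal_pow, Matrix.mulVec_diagonal]
  change g i - (x i)⁻¹ * (xbar i ^ 2 * _) = _
  rw [multiplier]
  ring

/-- `R X g` as a vector. -/
def project (A : Matrix (Fin m) (Fin n) ℝ) (x xbar g : E n) : E n :=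
  WithLp.toLp 2 (approxProjection A x xbar *ᵥ g.ofLp)

lemma project_apply (A : Matrix (Fin m) (Fin n) ℝ) {x : E n} (xbar g : E n) (hx : ∀ i, 0 < x i)
    (i : Fin n) :
    project A x xbar g i = g i - xbar i ^ 2 / x i * (Aᵀ *ᵥ multiplier A x xbar g) i :=
  approxProjection_mulVec_apply A xbar g hx i

/-- The image of the approximate projection lies in the kernel of `A X`. -/
lemma mulVec_scale_project {A : Matrix (Fin m) (Fin n) ℝ} (hA : LinearIndependent ℝ A.row)
    {x xbar : E n} (g : E n) (hx : ∀ i, 0 < x i) (hxbar : ∀ i, 0 < xbar i) :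
    A *ᵥ (fun i => x i * project A x xbar g i) = 0 := by
  have hpd : (gram A fun i => xbar i ^ 2).PosDef := gram_posDef hA fun i => by
    have := hxbar i
    positivity
  have h1 : (fun i => x i * project A x xbar g i) = (fun i => x i * g i) -
      Matrix.diagonal (fun i => xbar i ^ 2) *ᵥ (Aᵀ *ᵥ multiplier A x xbar g) := by
    ext i
    rw [project_apply A xbar g hx, Pi.sub_apply, Matrix.mulVec_diagonal]
    have := (hx i).ne'
    field_simp
  rw [h1, Matrix.mulVec_sub, Matrix.mulVec_mulVec, Matrix.mulVec_mulVec, ← gram, multiplier,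
    Matrix.mulVec_mulVec, Matrix.mul_nonsing_inv _ ((Matrix.isUnit_iff_isUnit_det _).mp hpd.isUnit),
    Matrix.one_mulVec, sub_self]

/-- The kernel of `A X` is orthogonal to the range of `X Aᵀ`. -/
lemma sum_scale_transpose_mul_eq_zero {A : Matrix (Fin m) (Fin n) ℝ} {x h : E n}
    (hh : A *ᵥ (fun i => x i * h i) = 0) (mu : Fin m → ℝ) :
    ∑ i, x i * (Aᵀ *ᵥ mu) i * h i = 0 := by
  have : mu ⬝ᵥ (A *ᵥ fun i => x i * h i) = 0 := by rw [hh, dotProduct_zero]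
  rw [Matrix.dotProduct_mulVec, ← Matrix.mulVec_transpose] at this
  rw [← this]
  exact Finset.sum_congr rfl fun i _ => by ring

/-- The exact projection does not increase the norm, nor does its complement `X Aᵀ μ`. -/
lemma norm_project_self {A : Matrix (Fin m) (Fin n) ℝ} (hA : LinearIndependent ℝ A.row)
    {x : E n} (g : E n) (hx : ∀ i, 0 < x i) :
    ‖project A x x g‖ ≤ ‖g‖ ∧ ‖g - project A x x g‖ ≤ ‖g‖ := by
  have h0 := sum_scale_transpose_mul_eq_zero (mulVec_scale_project hA g hx hx)
    (multiplier A x x g)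
  have h1 : inner ℝ (g - project A x x g) (project A x x g) = 0 := by
    rw [inner_eq_sum, ← h0]
    refine Finset.sum_congr rfl fun i _ => ?_
    rw [PiLp.sub_apply, project_apply A x g hx]
    have := (hx i).ne'
    field_simp
    ring
  have h2 : ‖g‖ * ‖g‖ = ‖g - project A x x g‖ * ‖g - project A x x g‖ +
      ‖project A x x g‖ * ‖project A x x g‖ := by
    rw [← norm_add_sq_eq_norm_sq_add_norm_sq_of_inner_eq_zero _ _ h1, sub_add_cancel]
  constructor <;> refine abs_le_of_sq_le_sq' ?_ (norm_nonneg _) |>.2 <;>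
    nlinarith [mul_self_nonneg ‖project A x x g‖, mul_self_nonneg ‖g - project A x x g‖]

/-- If the scalings `x` and `x̄` agree up to factors `e ^ δ`, the approximate projection `R g`
differs from the exact projection `P g` by `O(δ) ‖g‖`. With `D = X̄⁻¹ X`, the difference `e` lies in
`ker (A X)` and `D² e ≡ (D² - 1) (g - P g)` modulo the range of `X Aᵀ`, so that
`⟪D² e, e⟫ = ⟪(D² - 1) (g - P g), e⟫`. -/
lemma norm_project_sub_project_le {A : Matrix (Fin m) (Fin n) ℝ}
    (hA : LinearIndependent ℝ A.row) {x xbar : E n} (g : E n) (hx : ∀ i, 0 < x i)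
    (hxbar : ∀ i, 0 < xbar i) {δ : ℝ} (hδ : δ ≤ 1 / 16)
    (h : ∀ i, |Real.log (xbar i) - Real.log (x i)| ≤ δ) :
    ‖project A x xbar g - project A x x g‖ ≤ 5 * δ * ‖g‖ := by
  rcases isEmpty_or_nonempty (Fin n) with hn | ⟨⟨i₀⟩⟩
  · have : Subsingleton (E n) := (WithLp.equiv 2 (Fin n → ℝ)).subsingleton
    have h0 : project A x xbar g - project A x x g = 0 := Subsingleton.elim _ _
    have h1 : g = 0 := Subsingleton.elim _ _
    rw [h0, h1]
    simp
  have hδ0 : 0 ≤ δ := (abs_nonneg _).trans (h i₀)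
  set e := project A x xbar g - project A x x g with he
  set v := g - project A x x g with hv
  have hker : A *ᵥ (fun i => x i * e i) = 0 := by
    have : (fun i => x i * e i) = (fun i => x i * project A x xbar g i) -
        fun i => x i * project A x x g i := by
      ext i
      simp only [he, PiLp.sub_apply, Pi.sub_apply]
      ring
    rw [this, Matrix.mulVec_sub, mulVec_scale_project hA g hx hxbar,
      mulVec_scale_project hA g hx hx, sub_zero]
  have ho1 := sum_scale_transpose_mul_eq_zero hker (multiplier A x x g)
  have ho2 := sum_scale_transpose_mul_eq_zero hker (multiplier A x xbar g)
  let D : Fin n → ℝ := fun i => x i ^ 2 / xbar i ^ 2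
  have hkey : ∑ i, D i * e i * e i = ∑ i, (D i - 1) * v i * e i := by
    have hterm : ∀ i, D i * e i * e i = (D i - 1) * v i * e i +
        x i * (Aᵀ *ᵥ multiplier A x x g) i * e i -
        x i * (Aᵀ *ᵥ multiplier A x xbar g) i * e i := by
      intro i
      have h1 : v i = x i * (Aᵀ *ᵥ multiplier A x x g) i := by
        rw [hv, PiLp.sub_apply, project_apply A x g hx]
        have := (hx i).ne'
        field_simp
        ring
      have h2 : D i * e i = D i * v i - x i * (Aᵀ *ᵥ multiplier A x xbar g) i := by
        rw [h1, he, PiLp.sub_apply, project_apply A x g hx, project_apply A xbar g hx]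
        simp only [D]
        have := (hx i).ne'
        have := (hxbar i).ne'
        field_simp
        ring
      rw [h2, ← h1]
      ring
    rw [Finset.sum_congr rfl fun i _ => hterm i, Finset.sum_sub_distrib, Finset.sum_add_distrib,
      ho1, ho2]
    ring
  have hD : ∀ i, 1 - 2 * δ ≤ D i ∧ |D i - 1| ≤ 4 * δ := by
    intro i
    have hDe : D i = Real.exp (2 * (Real.log (x i) - Real.log (xbar i))) := by
      rw [two_mul, Real.exp_add, Real.exp_sub, Real.exp_log (hx i), Real.exp_log (hxbar i)]
      simp only [D]
      ring
    have hi := abs_le.mp (h i)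
    have h1 := Real.add_one_le_exp (2 * (Real.log (x i) - Real.log (xbar i)))
    have h2 : |2 * (Real.log (x i) - Real.log (xbar i))| ≤ 1 := by
      rw [abs_le]; constructor <;> linarith
    have h3 := Real.abs_exp_sub_one_le h2
    rw [hDe]
    refine ⟨by linarith, h3.trans ?_⟩
    rw [abs_mul, abs_two, abs_sub_comm]
    linarith [h i]
  have h1 : (1 - 2 * δ) * ‖e‖ ^ 2 ≤ 4 * δ * (‖v‖ * ‖e‖) := by
    calc (1 - 2 * δ) * ‖e‖ ^ 2 = ∑ i, (1 - 2 * δ) * e i ^ 2 := by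
          rw [norm_sq_eq_sum, Finset.mul_sum]
      _ ≤ ∑ i, D i * e i * e i := Finset.sum_le_sum fun i _ => by
          rw [mul_assoc, ← sq]
          exact mul_le_mul_of_nonneg_right (hD i).1 (sq_nonneg _)
      _ = ∑ i, (D i - 1) * v i * e i := hkey
      _ ≤ ∑ i, (4 * δ * |v i|) * |e i| := Finset.sum_le_sum fun i _ => by
          refine (le_abs_self _).trans ?_
          rw [abs_mul, abs_mul]
          gcongr
          exact (hD i).2
      _ = 4 * δ * inner ℝ (WithLp.toLp 2 fun i => |v i| : E n) (WithLp.toLp 2 fun i => |e i|) := by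
          rw [inner_eq_sum, Finset.mul_sum]
          exact Finset.sum_congr rfl fun i _ => by ring
      _ ≤ 4 * δ * (‖(WithLp.toLp 2 fun i => |v i| : E n)‖ *
            ‖(WithLp.toLp 2 fun i => |e i| : E n)‖) :=
          mul_le_mul_of_nonneg_left (real_inner_le_norm _ _) (by positivity)
      _ = 4 * δ * (‖v‖ * ‖e‖) := by
          simp only [EuclideanSpace.norm_eq, Real.norm_eq_abs, abs_abs]
  have h2 : ‖v‖ ≤ ‖g‖ := (norm_project_self hA g hx).2
  rcases (norm_nonneg e).eq_or_lt with h0 | h0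
  · rw [← h0]; positivity
  · have h3 : (1 - 2 * δ) * ‖e‖ ≤ 4 * δ * ‖v‖ := by
      refine le_of_mul_le_mul_right ?_ h0
      linarith
    have h4 : 4 * δ * ‖v‖ ≤ 4 * δ * ‖g‖ := by gcongr
    have h5 : 0 ≤ δ * ‖g‖ := by positivity
    nlinarith [norm_nonneg e]

end Potential

/-! ### One step of the algorithm -/

section Step

variable {m n : ℕ} {A : Matrix (Fin m) (Fin n) ℝ} {b : Fin m → ℝ} {f : E n → ℝ}
  {ε Lφ C₀ β : ℝ} {x₀ xstar : E n}

/-- The two cases of the definition agree, since `(β / 0) • 0 = 0`. -/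
lemma RunData.direction_eq (D : RunData m n) (x xbar : E n) :
    D.direction x xbar = -(D.β / ‖D.projectedGradient x xbar‖) • D.projectedGradient x xbar := by
  rw [RunData.direction]
  split_ifs with h
  · rw [h, smul_zero]
  · rfl

lemma RunData.norm_direction_le (D : RunData m n) (hβ : 0 ≤ D.β) (x xbar : E n) :
    ‖D.direction x xbar‖ ≤ D.β := by
  rw [RunData.direction_eq, neg_smul, norm_neg, norm_smul, norm_div, norm_norm, Real.norm_eq_abs,
    abs_of_nonneg hβ]
  rcases eq_or_ne (D.projectedGradient x xbar) 0 with h | h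
  · simpa [h] using hβ
  · rw [div_mul_cancel₀ _ (norm_ne_zero_iff.mpr h)]

/-- A step along a vector `d` of the kernel of `A X` with `‖d‖ < 1` stays strictly feasible. -/
lemma add_scale_mem {x d : E n} (hx : x ∈ strictlyFeasibleSet A b)
    (hd : A *ᵥ (fun i => x i * d i) = 0) (hd1 : ‖d‖ < 1) :
    x + scale x d ∈ strictlyFeasibleSet A b := by
  refine ⟨?_, fun i => ?_⟩
  · have : (x + scale x d).ofLp = x.ofLp + fun i => x i * d i := rfl
    rw [this, Matrix.mulVec_add, hx.1, hd, add_zero]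
  · have h1 := (abs_le.mp ((abs_apply_le_norm d i).trans hd1.le)).1
    have h2 := abs_lt.mp ((abs_apply_le_norm d i).trans_lt hd1)
    have : (x + scale x d) i = x i * (1 + d i) := by
      simp only [PiLp.add_apply, scale]
      ring
    rw [this]
    exact mul_pos (hx.2 i) (by linarith)

lemma RunData.mulVec_scale_direction (D : RunData m n) (hA : LinearIndependent ℝ D.A.row)
    {x xbar : E n} (hx : ∀ i, 0 < x i) (hxbar : ∀ i, 0 < xbar i) :
    D.A *ᵥ (fun i => x i * D.direction x xbar i) = 0 := by
  have h := mulVec_scale_project hA (scale x (gradient (potential D.ε D.f) x)) hx hxbar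
  have : (fun i => x i * D.direction x xbar i) = -(D.β / ‖D.projectedGradient x xbar‖) •
      fun i => x i * D.projectedGradient x xbar i := by
    ext i
    rw [RunData.direction_eq]
    simp only [PiLp.smul_apply, Pi.smul_apply, smul_eq_mul]
    ring
  rw [this, Matrix.mulVec_smul]
  exact (congrArg _ h).trans (smul_zero _)

/-- The second order model of the potential function along a step `X d`. -/
lemma potential_add_scale_le (hs : ConcaveSetting A b f ε Lφ C₀ x₀ xstar) (hε : 0 ≤ ε) {x d : E n}
    (hx : x ∈ strictlyFeasibleSet A b) (hd : A *ᵥ (fun i => x i * d i) = 0) (hd1 : ‖d‖ ≤ 1 / 2) :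
    potential ε f (x + scale x d) ≤ potential ε f x +
      inner ℝ (scale x (gradient (potential ε f) x)) d + ε * ‖d‖ ^ 2 := by
  have hy := add_scale_mem hx hd (by linarith)
  have hdiff := hs.differentiableAt x hx.2
  have h1 := le_add_inner_gradient hs.concaveOn hx hy hdiff
  have h2 : ∀ i, Real.log ((x + scale x d) i) = Real.log (x i) + Real.log (1 + d i) := by
    intro i
    have hdi := abs_le.mp ((abs_apply_le_norm d i).trans hd1)
    have : (x + scale x d) i = x i * (1 + d i) := by
      simp only [PiLp.add_apply, scale]
      ring
    rw [this, Real.log_mul (hx.2 i).ne' (by linarith)]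
  have h3 : ∑ i, (d i - d i ^ 2) ≤ ∑ i, Real.log (1 + d i) :=
    Finset.sum_le_sum fun i _ => sub_sq_le_log_one_add ((abs_apply_le_norm d i).trans hd1)
  have h4 : inner ℝ (scale x (gradient (potential ε f) x)) d =
      inner ℝ (gradient f x) (scale x d) - ε * ∑ i, d i := by
    rw [inner_eq_sum, inner_eq_sum, Finset.mul_sum, ← Finset.sum_sub_distrib]
    refine Finset.sum_congr rfl fun i _ => ?_
    rw [scale_gradient_potential_apply hx.2 hdiff]
    simp only [scale]
    ring
  rw [add_sub_cancel_left] at h1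
  rw [Finset.sum_sub_distrib, ← norm_sq_eq_sum] at h3
  have h5 := mul_le_mul_of_nonneg_left h3 hε
  simp only [potential, h2, Finset.sum_add_distrib]
  rw [h4]
  linarith

/-- A small exact projected gradient gives an approximate KKT point. -/
lemma isApproxKKT_of_norm_project_le (hs : ConcaveSetting A b f ε Lφ C₀ x₀ xstar) (hε : 0 ≤ ε)
    {x : E n} (hx : x ∈ strictlyFeasibleSet A b)
    (h : ‖project A x x (scale x (gradient (potential ε f) x))‖ ≤ ε) :
    IsApproxKKT A b f (2 * ε) x := by
  set g := scale x (gradient (potential ε f) x) with hg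
  have hP : ∀ i, |project A x x g i| ≤ ε := fun i => (abs_apply_le_norm _ i).trans h
  have hxs : ∀ i, x i * (gradient f x i - (Aᵀ *ᵥ multiplier A x x g) i) =
      ε + project A x x g i := by
    intro i
    rw [project_apply A x g hx.2, hg, scale_gradient_potential_apply hx.2
      (hs.differentiableAt x hx.2)]
    have := (hx.2 i).ne'
    field_simp
    ring
  refine ⟨hx, -multiplier A x x g, fun i => gradient f x i - (Aᵀ *ᵥ multiplier A x x g) i,
    fun i => ?_, fun i => ?_, fun i => ?_⟩
  · refine nonneg_of_mul_nonneg_right (a := x i) ?_ (hx.2 i)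
    rw [hxs]
    linarith [(abs_le.mp (hP i)).1]
  · rw [Matrix.mulVec_neg, Pi.neg_apply]
    simpa using by linarith
  · rw [hxs, abs_le]
    constructor <;> linarith [(abs_le.mp (hP i)).1, (abs_le.mp (hP i)).2]

/-- The slope of `g` along the normalized direction `-r` if `r` is close to a vector `p` with
`⟪g, r⟫ = ⟪p, r⟫`. -/
lemma inner_neg_div_norm_smul_le {g p r : E n} {e : ℝ} (horth : inner ℝ g r = inner ℝ p r)
    (he : ‖r - p‖ ≤ e) (hr : 0 < ‖r‖) (hβ : 0 ≤ β) :
    inner ℝ g (-(β / ‖r‖) • r) ≤ -(β * (‖p‖ - 2 * e)) := by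
  have h1 : inner ℝ p r = ‖r‖ ^ 2 - inner ℝ (r - p) r := by
    rw [inner_sub_left, real_inner_self_eq_norm_sq]
    ring
  have h2 := real_inner_le_norm (r - p) r
  have h3 : ‖r - p‖ * ‖r‖ ≤ e * ‖r‖ := by gcongr
  have h4 : ‖p‖ - e ≤ ‖r‖ := by
    have := norm_le_norm_add_norm_sub' p r
    rw [norm_sub_rev] at this
    linarith
  have h5 : ‖r‖ * (‖p‖ - 2 * e) ≤ inner ℝ p r := by
    have := mul_le_mul_of_nonneg_left (by linarith : ‖p‖ - 2 * e ≤ ‖r‖ - e) hr.le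
    rw [h1]
    linarith
  rw [inner_smul_right, horth, neg_mul, neg_le_neg_iff]
  calc β * (‖p‖ - 2 * e) = β / ‖r‖ * (‖r‖ * (‖p‖ - 2 * e)) := by field_simp
    _ ≤ β / ‖r‖ * inner ℝ p r := by gcongr

/-- As long as the scaling is accurate, an iterate that is not an approximate KKT point is followed
by a sufficient decrease of the potential function. -/
lemma isApproxKKT_or_decrease (hs : ConcaveSetting A b f ε Lφ C₀ x₀ xstar) (hε : 0 < ε)
    (hL : 0 < Lφ) (hβ : 0 < β) (hβ' : β ≤ 1 / 2) {x xbar : E n}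
    (hx : x ∈ strictlyFeasibleSet A b) (hxbar : ∀ i, 0 < xbar i)
    (hacc : ∀ i, |Real.log (xbar i) - Real.log (x i)| ≤ (1 - β) * ε / (184 * Lφ)) :
    IsApproxKKT A b f (2 * ε) x ∨
      potential ε f (x + scale x ((concaveRun A f ε β Lφ x₀).direction x xbar)) - potential ε f x ≤
        -(ε * β * (1 - β) / 2) := by
  set g := scale x (gradient (potential ε f) x) with hg
  rcases le_or_gt ‖project A x x g‖ ε with hP | hP
  · exact .inl (isApproxKKT_of_norm_project_le hs hε.le hx hP)
  right
  set D := concaveRun A f ε β Lφ x₀ with hD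
  set δ := (1 - β) * ε / (184 * Lφ) with hδ
  have hgL : ‖g‖ ≤ Lφ := hs.scaledGradient_le x hx
  have hεL : ε < Lφ := hP.trans_le ((norm_project_self hs.fullRowRank g hx.2).1.trans hgL)
  have hδ16 : δ ≤ 1 / 16 := by
    rw [hδ, div_le_iff₀ (by positivity)]
    nlinarith
  have hδ0 : 0 ≤ δ := div_nonneg (mul_nonneg (by linarith) hε.le) (by positivity)
  set r := project A x xbar g with hr
  set p := project A x x g with hp
  have herr : ‖r - p‖ ≤ ε * (1 - β) / 4 := by
    refine (norm_project_sub_project_le hs.fullRowRank g hx.2 hxbar hδ16 hacc).trans ?_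
    have h1 : δ * ‖g‖ ≤ δ * Lφ := by gcongr
    have h2 : δ * Lφ = (1 - β) * ε / 184 := by rw [hδ]; field_simp
    have h3 : 0 ≤ (1 - β) * ε := mul_nonneg (by linarith) hε.le
    linarith
  have hr0 : 0 < ‖r‖ := by
    have h1 := norm_le_norm_add_norm_sub' p r
    rw [norm_sub_rev] at h1
    have h2 : 0 < ε * β := mul_pos hε hβ
    linarith
  have hdir : D.direction x xbar = -(β / ‖r‖) • r := D.direction_eq x xbar
  have hnorm : ‖D.direction x xbar‖ ≤ β := D.norm_direction_le hβ.le x xbar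
  have hker := D.mulVec_scale_direction hs.fullRowRank hx.2 hxbar
  have hmodel := potential_add_scale_le hs hε.le hx hker (hnorm.trans hβ')
  have horth : inner ℝ g r = inner ℝ p r := by
    have h0 := sum_scale_transpose_mul_eq_zero (mulVec_scale_project hs.fullRowRank g hx.2 hxbar)
      (multiplier A x x g)
    rw [← sub_eq_zero, ← inner_sub_left, inner_eq_sum, ← h0]
    refine Finset.sum_congr rfl fun i _ => ?_
    rw [PiLp.sub_apply, hp, project_apply A x g hx.2]
    have := (hx.2 i).ne'
    field_simp
    ring
  have hlin : inner ℝ g (D.direction x xbar) ≤ -(β * (ε - ε * (1 - β) / 2)) := by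
    rw [hdir]
    refine (inner_neg_div_norm_smul_le horth herr hr0 hβ.le).trans (neg_le_neg ?_)
    exact mul_le_mul_of_nonneg_left (by linarith) hβ.le
  have hsq : ε * ‖D.direction x xbar‖ ^ 2 ≤ ε * β ^ 2 := by gcongr
  have hfin : -(β * (ε - ε * (1 - β) / 2)) + ε * β ^ 2 = -(ε * β * (1 - β) / 2) := by ring
  rw [sub_le_iff_le_add', ← hfin, ← add_assoc]
  exact hmodel.trans (add_le_add (add_le_add_right hlin _) hsq)

end Step

/-! ### The maintained scaling -/

section Scaling

/-- The condition under which `selectVector` refreshes coordinate `i` at time `t`. -/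
def RefreshCond {n : ℕ} (δ : ℝ) (y : ℕ → Fin n → ℝ) (t : ℕ) (i : Fin n) : Prop :=
  2 ^ Nat.clog 2 n ∣ t ∨ ∃ l < Nat.clog 2 n, 2 ^ l ∣ t ∧
    δ / (2 * (Nat.clog 2 n : ℝ)) ≤ |y t i - y (t - 2 ^ l) i|

/-- Walking from `a` up to the next multiple of `2 ^ k` in dyadic steps, at most one per level. -/
lemma abs_sub_le_of_ceil {u : ℕ → ℝ} {c : ℝ} {a t L : ℕ} (hc : 0 ≤ c)
    (hstep : ∀ s l, l < L → 2 ^ l ∣ s → a < s → s ≤ t → |u s - u (s - 2 ^ l)| ≤ c) (k : ℕ)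
    (hk : k ≤ L) :
    ∀ q, a ≤ q → q < a + 2 ^ k → 2 ^ k ∣ q → q ≤ t → |u q - u a| ≤ k * c := by
  induction k with
  | zero =>
    intro q h1 h2 _ _
    obtain rfl : q = a := by simp at h2; omega
    simp
  | succ k ih =>
    intro q h1 h2 h3 h4
    have h3' : 2 ^ k ∣ q := (pow_dvd_pow 2 (Nat.le_succ k)).trans h3
    push_cast
    rcases Nat.lt_or_ge q (a + 2 ^ k) with h | h
    · have := ih (by omega) q h1 h h3' h4
      linarith
    · have hpos : 0 < 2 ^ k := Nat.two_pow_pos k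
      rw [pow_succ] at h2
      have h5 := ih (by omega) (q - 2 ^ k) (by omega) (by omega)
        (Nat.dvd_sub h3' dvd_rfl) (by omega)
      have h6 := hstep q k (by omega) h3' (by omega) h4
      have h7 := abs_sub_le (u q) (u (q - 2 ^ k)) (u a)
      linarith

/-- Walking from the last multiple of `2 ^ k` up to `t` in dyadic steps, at most one per level. -/
lemma abs_sub_le_of_floor {u : ℕ → ℝ} {c : ℝ} {a t L : ℕ} (hc : 0 ≤ c)
    (hstep : ∀ s l, l < L → 2 ^ l ∣ s → a < s → s ≤ t → |u s - u (s - 2 ^ l)| ≤ c) (k : ℕ)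
    (hk : k ≤ L) :
    ∀ q, a ≤ q → q ≤ t → t < q + 2 ^ k → 2 ^ k ∣ q → |u t - u q| ≤ k * c := by
  induction k with
  | zero =>
    intro q _ h1 h2 _
    obtain rfl : q = t := by simp at h2; omega
    simp
  | succ k ih =>
    intro q h0 h1 h2 h3
    have h3' : 2 ^ k ∣ q := (pow_dvd_pow 2 (Nat.le_succ k)).trans h3
    push_cast
    rcases Nat.lt_or_ge t (q + 2 ^ k) with h | h
    · have := ih (by omega) q h0 h1 h h3'
      linarith
    · have hpos : 0 < 2 ^ k := Nat.two_pow_pos k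
      rw [pow_succ] at h2
      have h5 := ih (by omega) (q + 2 ^ k) (by omega) h (by omega) (Nat.dvd_add h3' dvd_rfl)
      have h6 := hstep (q + 2 ^ k) k (by omega) (Nat.dvd_add h3' dvd_rfl) (by omega) h
      rw [Nat.add_sub_cancel] at h6
      have h7 := abs_sub_le (u t) (u (q + 2 ^ k)) (u q)
      linarith

/-- If every dyadic step of level `l < L` inside `[a, t]` changes `u` by at most `c`, and no
multiple of `2 ^ L` lies in `(a, t]`, then `u` changes by at most `2 L c` from `a` to `t`: the steps
first grow, up to a multiple of the largest power of two with a multiple in `[a, t]`, and then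
shrink. -/
lemma abs_sub_le_of_dyadic {u : ℕ → ℝ} {c : ℝ} {a t L : ℕ} (hc : 0 ≤ c) (hat : a ≤ t)
    (hL : ∀ s, a < s → s ≤ t → ¬ 2 ^ L ∣ s)
    (hstep : ∀ s l, l < L → 2 ^ l ∣ s → a < s → s ≤ t → |u s - u (s - 2 ^ l)| ≤ c) :
    |u t - u a| ≤ 2 * L * c := by
  classical
  -- the largest level `k ≤ L` with a multiple `q` of `2 ^ k` in `[a, t]`
  let P : ℕ → Prop := fun k => ∃ q, a ≤ q ∧ q ≤ t ∧ 2 ^ k ∣ q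
  have hP0 : P 0 := ⟨a, le_rfl, hat, by simp⟩
  set k := Nat.findGreatest P L with hk
  have hkL : k ≤ L := Nat.findGreatest_le L
  obtain ⟨q, h1, h2, h3⟩ : P k := Nat.findGreatest_spec (Nat.zero_le L) hP0
  have hpos : 0 < 2 ^ k := Nat.two_pow_pos k
  have hup : q < a + 2 ^ k ∧ t < q + 2 ^ k ∨ q = a ∧ k = L ∧ t < q + 2 ^ k := by
    rcases hkL.eq_or_lt with h | h
    · right
      have hqa : q = a := by
        by_contra hne
        exact hL q (by omega) h2 (h ▸ h3)
      refine ⟨hqa, h, ?_⟩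
      by_contra hlt
      exact hL (q + 2 ^ k) (by omega) (by omega) (h ▸ Nat.dvd_add h3 dvd_rfl)
    · left
      have hnot : ∀ q', a ≤ q' → q' ≤ t → ¬ 2 ^ (k + 1) ∣ q' := fun q' h4 h5 h6 =>
        Nat.findGreatest_is_greatest (P := P) (Nat.lt_succ_self k) h ⟨q', h4, h5, h6⟩
      -- one of two consecutive multiples of `2 ^ k` is a multiple of `2 ^ (k + 1)`
      have hcons : ∀ r, 2 ^ k ∣ r → 2 ^ (k + 1) ∣ r ∨ 2 ^ (k + 1) ∣ r + 2 ^ k := by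
        rintro _ ⟨j, rfl⟩
        rcases Nat.even_or_odd j with ⟨i, rfl⟩ | ⟨i, rfl⟩
        · exact .inl ⟨i, by ring⟩
        · exact .inr ⟨i + 1, by ring⟩
      constructor
      · by_contra hlt
        rcases hcons (q - 2 ^ k) (Nat.dvd_sub h3 dvd_rfl) with h4 | h4
        · exact hnot _ (by omega) (by omega) h4
        · rw [Nat.sub_add_cancel (by omega)] at h4
          exact hnot _ h1 h2 h4
      · by_contra hlt
        rcases hcons q h3 with h4 | h4
        · exact hnot _ h1 h2 h4
        · exact hnot _ (by omega) (by omega) h4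
  have hkc : (k : ℝ) * c ≤ L * c := by gcongr
  have hdown : |u t - u q| ≤ k * c := by
    refine abs_sub_le_of_floor hc hstep k hkL q h1 h2 ?_ h3
    rcases hup with h | h
    exacts [h.2, h.2.2]
  have hupc : |u q - u a| ≤ k * c := by
    rcases hup with h | h
    · exact abs_sub_le_of_ceil hc hstep k hkL q h1 h.1 h3 h2
    · rw [h.1]
      simp only [sub_self, abs_zero]
      positivity
  have := abs_sub_le (u t) (u q) (u a)
  linarith

end Scaling

/-! ### The iterates -/

section Run

variable {m n : ℕ}

/-- The maintained approximation `x̄_t`. -/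
def RunData.scaling (D : RunData m n) (t : ℕ) : E n := (D.state t).2

/-- The logarithms of the iterates. -/
def RunData.logIterate (D : RunData m n) (t : ℕ) (i : Fin n) : ℝ := Real.log (D.iterate t i)

lemma RunData.state_fst_of_le (D : RunData m n) {s t : ℕ} (h : s ≤ t) :
    (D.state t).1 s = D.iterate s := by
  induction t with
  | zero => rw [Nat.le_zero.mp h]; rfl
  | succ t ih =>
    rcases h.eq_or_lt with rfl | h
    · rfl
    · rw [← ih (by omega)]
      exact Function.update_of_ne (by omega) _ _

lemma RunData.iterate_succ (D : RunData m n) (t : ℕ) :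
    D.iterate (t + 1) =
      D.iterate t + scale (D.iterate t) (D.direction (D.iterate t) (D.scaling t)) :=
  Function.update_self _ _ _

open Classical in
lemma RunData.scaling_succ (D : RunData m n) (t : ℕ) (i : Fin n) :
    D.scaling (t + 1) i = Real.exp (if RefreshCond D.δ D.logIterate (t + 1) i
      then Real.log (D.iterate (t + 1) i) else Real.log (D.scaling t i)) := by
  have key : ∀ s ≤ t + 1, ∀ j, Real.log ((D.state (t + 1)).1 s j) = D.logIterate s j :=
    fun s hs j => by rw [D.state_fst_of_le hs]; rfl
  have h : D.scaling (t + 1) i = Real.exp (selectVector D.δ (fun j => Real.log (D.scaling t j))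
      (fun s j => Real.log ((D.state (t + 1)).1 s j)) (t + 1) i) := rfl
  rw [h, selectVector]
  simp only [key _ le_rfl, key _ (Nat.sub_le (t + 1) _)]
  exact congrArg _ (if_congr Iff.rfl rfl rfl)

variable {A : Matrix (Fin m) (Fin n) ℝ} {b : Fin m → ℝ} {f : E n → ℝ}
  {ε Lφ C₀ β : ℝ} {x₀ xstar : E n}

/-- The iterates are strictly feasible and the maintained scalings are positive. -/
lemma iterate_mem_and_scaling_pos (hs : ConcaveSetting A b f ε Lφ C₀ x₀ xstar) (hβ : 0 < β)
    (hβ' : β ≤ 1 / 2) (t : ℕ) :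
    (concaveRun A f ε β Lφ x₀).iterate t ∈ strictlyFeasibleSet A b ∧
      ∀ i, 0 < (concaveRun A f ε β Lφ x₀).scaling t i := by
  set D := concaveRun A f ε β Lφ x₀
  induction t with
  | zero => exact ⟨hs.start_mem, hs.start_mem.2⟩
  | succ t ih =>
    have h1 : ‖D.direction (D.iterate t) (D.scaling t)‖ ≤ β := D.norm_direction_le hβ.le _ _
    have h2 := D.mulVec_scale_direction hs.fullRowRank ih.1.2 ih.2
    refine ⟨?_, fun i => ?_⟩
    · rw [RunData.iterate_succ]
      exact add_scale_mem ih.1 h2 (by linarith)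
    · rw [RunData.scaling_succ]
      exact Real.exp_pos _

open Classical in
lemma scaling_succ_eq_ite (hs : ConcaveSetting A b f ε Lφ C₀ x₀ xstar) (hβ : 0 < β)
    (hβ' : β ≤ 1 / 2) (t : ℕ) (i : Fin n) :
    (concaveRun A f ε β Lφ x₀).scaling (t + 1) i =
      if RefreshCond (concaveRun A f ε β Lφ x₀).δ (concaveRun A f ε β Lφ x₀).logIterate (t + 1) i
      then (concaveRun A f ε β Lφ x₀).iterate (t + 1) i
      else (concaveRun A f ε β Lφ x₀).scaling t i := by
  rw [RunData.scaling_succ]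
  split_ifs
  · exact Real.exp_log ((iterate_mem_and_scaling_pos hs hβ hβ' (t + 1)).1.2 i)
  · exact Real.exp_log ((iterate_mem_and_scaling_pos hs hβ hβ' t).2 i)

/-- Every coordinate of the maintained scaling comes from the time of its last refresh. -/
lemma exists_last_refresh (hs : ConcaveSetting A b f ε Lφ C₀ x₀ xstar) (hβ : 0 < β)
    (hβ' : β ≤ 1 / 2) (t : ℕ) (i : Fin n) :
    ∃ a ≤ t, (concaveRun A f ε β Lφ x₀).scaling t i = (concaveRun A f ε β Lφ x₀).iterate a i ∧
      ∀ s, a < s → s ≤ t → ¬ RefreshCond (concaveRun A f ε β Lφ x₀).δ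
        (concaveRun A f ε β Lφ x₀).logIterate s i := by
  induction t with
  | zero => exact ⟨0, le_rfl, rfl, fun s h1 h2 => by omega⟩
  | succ t ih =>
    rw [scaling_succ_eq_ite hs hβ hβ']
    split_ifs with h
    · exact ⟨t + 1, le_rfl, rfl, fun s h1 h2 => by omega⟩
    · obtain ⟨a, h1, h2, h3⟩ := ih
      refine ⟨a, by omega, h2, fun s h4 h5 => ?_⟩
      rcases h5.eq_or_lt with rfl | h5
      · exact h
      · exact h3 s h4 (by omega)

/-- The accuracy of the maintained scaling. -/
lemma abs_log_scaling_sub_le (hs : ConcaveSetting A b f ε Lφ C₀ x₀ xstar) (hε : 0 < ε)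
    (hL : 0 < Lφ) (hβ : 0 < β) (hβ' : β ≤ 1 / 2) (t : ℕ) (i : Fin n) :
    |Real.log ((concaveRun A f ε β Lφ x₀).scaling t i) -
      Real.log ((concaveRun A f ε β Lφ x₀).iterate t i)| ≤ (1 - β) * ε / (184 * Lφ) := by
  obtain ⟨a, h1, h2, h3⟩ := exists_last_refresh hs hβ hβ' t i
  set D := concaveRun A f ε β Lφ x₀
  have hδ : 0 ≤ (1 - β) * ε / (184 * Lφ) :=
    div_nonneg (mul_nonneg (by linarith) hε.le) (by positivity)
  have hδD : D.δ = (1 - β) * ε / (184 * Lφ) := rfl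
  rw [← hδD] at hδ ⊢
  have hc : 0 ≤ D.δ / (2 * (Nat.clog 2 n : ℝ)) := by positivity
  rw [h2, abs_sub_comm]
  refine (abs_sub_le_of_dyadic (u := fun s => D.logIterate s i) hc h1
    (fun s h4 h5 h6 => h3 s h4 h5 (.inl h6)) (fun s l hl hdvd h4 h5 => ?_)).trans ?_
  · by_contra hlt
    exact h3 s h4 h5 (.inr ⟨l, hl, hdvd, (not_le.mp hlt).le⟩)
  · rcases (Nat.cast_nonneg (α := ℝ) (Nat.clog 2 n)).eq_or_lt with h | h
    · rw [← h]; simpa using hδ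
    · rw [mul_div_cancel₀ _ (by positivity)]

/-! ### Convergence -/

lemma loop_snd_le (D : RunData m n) (k t : ℕ) : (D.loop k t).2 ≤ t + k := by
  induction k generalizing t with
  | zero => exact le_rfl
  | succ k ih =>
    rw [RunData.loop]
    split_ifs
    · change t + 1 ≤ _; omega
    · have := ih (t + 1); omega

lemma loop_fst_cases (D : RunData m n) (k t : ℕ) :
    (∃ s, (D.loop k t).1 = D.iterate s ∧ D.Stops s) ∨
      (D.loop k t).1 = D.iterate (t + k) ∧ ∀ s, t ≤ s → s < t + k → ¬ D.Stops s := by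
  induction k generalizing t with
  | zero => exact .inr ⟨rfl, fun s h1 h2 => by omega⟩
  | succ k ih =>
    rw [RunData.loop]
    split_ifs with h
    · exact .inl ⟨t, rfl, h⟩
    · rcases ih (t + 1) with h1 | ⟨h1, h2⟩
      · exact .inl h1
      · refine .inr ⟨by rw [h1]; congr 1; omega, fun s h3 h4 => ?_⟩
        rcases h3.eq_or_lt with rfl | h3
        · exact h
        · exact h2 s h3 (by omega)

lemma concaveLimit_le {gap Δ : ℝ} (hβ : 0 < β) (hβ' : β ≤ 1 / 2) (hε : 0 < ε) (hε' : ε ≤ 1)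
    (hgap : gap ≤ Δ) :
    (concaveLimit ε β C₀ gap : ℝ) ≤ (2 * (|Δ| + |C₀| + 1) / (β * (1 - β)) + 1) / ε := by
  have hβ1 : 0 < 1 - β := by linarith
  have hle : 2 * (gap + (C₀ - 1) * ε) / (ε * β * (1 - β)) ≤
      2 * (|Δ| + |C₀| + 1) / (β * (1 - β)) / ε := by
    rw [div_div, mul_comm (β * (1 - β)) ε, ← mul_assoc]
    refine div_le_div_of_nonneg_right ?_ (by positivity)
    have h1 : (C₀ - 1) * ε ≤ |C₀ - 1| * 1 := by
      refine (le_abs_self _).trans ?_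
      rw [abs_mul, abs_of_pos hε]
      gcongr
    have h2 : |C₀ - 1| ≤ |C₀| + 1 := by simpa using abs_sub C₀ 1
    linarith [le_abs_self Δ]
  have hK : 0 ≤ 2 * (|Δ| + |C₀| + 1) / (β * (1 - β)) / ε := by positivity
  have h1ε : 1 ≤ 1 / ε := by rw [le_div_iff₀ hε]; linarith
  have : (concaveLimit ε β C₀ gap : ℝ) ≤ 2 * (|Δ| + |C₀| + 1) / (β * (1 - β)) / ε + 1 := by
    refine (Nat.cast_le.mpr (Nat.ceil_mono hle)).trans (Nat.ceil_lt_add_one hK).le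
  rw [add_div]
  linarith

lemma output_isApproxKKT_or_le (hs : ConcaveSetting A b f ε Lφ C₀ x₀ xstar) (hε : 0 < ε)
    (hL : 0 < Lφ) (hβ : 0 < β) (hβ' : β ≤ 1 / 2) :
    IsApproxKKT A b f (2 * ε)
        ((concaveRun A f ε β Lφ x₀).output (concaveLimit ε β C₀ (f x₀ - f xstar))) ∨
      f ((concaveRun A f ε β Lφ x₀).output (concaveLimit ε β C₀ (f x₀ - f xstar))) - f xstar ≤
        ε := by
  set D := concaveRun A f ε β Lφ x₀ with hD
  set T := concaveLimit ε β C₀ (f x₀ - f xstar) with hT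
  have hDε : D.ε = ε := rfl
  have hDf : D.f = f := rfl
  have hDβ : D.β = β := rfl
  rcases loop_fst_cases D T 0 with ⟨s, h1, h2⟩ | ⟨h1, h2⟩
  · left
    rw [RunData.output, h1]
    have hmem := iterate_mem_and_scaling_pos hs hβ hβ' s
    refine (isApproxKKT_or_decrease hs hε hL hβ hβ' hmem.1 hmem.2 fun i =>
      abs_log_scaling_sub_le hs hε hL hβ hβ' s i).resolve_right fun h => ?_
    rw [← hD, ← RunData.iterate_succ] at h
    exact absurd h (not_le.mpr h2)
  · right
    rw [RunData.output, h1, zero_add]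
    have hdec : ∀ t ≤ T, potential ε f (D.iterate t) ≤
        potential ε f x₀ - t * (ε * β * (1 - β) / 2) := by
      intro t ht
      induction t with
      | zero => exact le_of_eq (by simp [show D.iterate 0 = x₀ from rfl])
      | succ t ih =>
        have h3 := h2 t (Nat.zero_le _) (by omega)
        rw [RunData.Stops, gt_iff_lt, not_lt, hDε, hDf, hDβ] at h3
        have h4 := ih (by omega)
        push_cast
        linarith
    have hT1 := hdec T le_rfl
    have hT2 : f x₀ - f xstar + (C₀ - 1) * ε ≤ T * (ε * β * (1 - β) / 2) := by
      have h3 := Nat.le_ceil (2 * (f x₀ - f xstar + (C₀ - 1) * ε) / (ε * β * (1 - β)))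
      have h4 : 0 < ε * β * (1 - β) := mul_pos (mul_pos hε hβ) (by linarith)
      rw [div_le_iff₀ h4] at h3
      change _ ≤ (T : ℝ) * _ at h3
      linarith
    have hcenter := hs.start_center _ (iterate_mem_and_scaling_pos hs hβ hβ' T).1
    have h5 := mul_le_mul_of_nonneg_left hcenter hε.le
    rw [← hD] at h5
    simp only [potential] at hT1
    linarith

/-! ### The number of refreshed coordinates -/

open Classical in
/-- The coordinates that are refreshed at time `t`. -/
def RunData.refreshed (D : RunData m n) (t : ℕ) : Finset (Fin n) :=
  Finset.univ.filter fun i => RefreshCond D.δ D.logIterate t i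

/-- The logarithms of the iterates move by at most `2 β ≤ 1` per step in the Euclidean norm. -/
lemma norm_logIterate_succ_sub_le (hs : ConcaveSetting A b f ε Lφ C₀ x₀ xstar) (hβ : 0 < β)
    (hβ' : β ≤ 1 / 2) (t : ℕ) :
    ‖(WithLp.toLp 2 ((concaveRun A f ε β Lφ x₀).logIterate (t + 1)) : E n) -
      WithLp.toLp 2 ((concaveRun A f ε β Lφ x₀).logIterate t)‖ ≤ 1 := by
  set D := concaveRun A f ε β Lφ x₀ with hD
  have hmem := (iterate_mem_and_scaling_pos hs hβ hβ' t).1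
  set d := D.direction (D.iterate t) (D.scaling t) with hd
  have hdβ : ‖d‖ ≤ β := D.norm_direction_le hβ.le _ _
  have hcoord : ∀ i, |D.logIterate (t + 1) i - D.logIterate t i| ≤ 2 * |d i| := by
    intro i
    have h1 := (abs_apply_le_norm d i).trans (hdβ.trans hβ')
    have h2 : D.iterate (t + 1) i = D.iterate t i * (1 + d i) := by
      rw [D.iterate_succ, ← hd]
      simp only [PiLp.add_apply, scale]
      ring
    have h3 : D.logIterate (t + 1) i - D.logIterate t i = Real.log (1 + d i) := by
      rw [RunData.logIterate, h2, Real.log_mul (hmem.2 i).ne'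
        (by linarith [(abs_le.mp h1).1]), RunData.logIterate]
      ring
    rw [h3]
    exact abs_log_one_add_le h1
  refine abs_le_of_sq_le_sq' ?_ zero_le_one |>.2
  rw [norm_sq_eq_sum]
  calc ∑ i, ((WithLp.toLp 2 (D.logIterate (t + 1)) : E n) - WithLp.toLp 2 (D.logIterate t)) i ^ 2
      ≤ ∑ i, 4 * d i ^ 2 := Finset.sum_le_sum fun i _ => by
        have h1 := pow_le_pow_left₀ (abs_nonneg _) (hcoord i) 2
        rw [sq_abs, mul_pow, sq_abs] at h1
        rw [PiLp.sub_apply]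
        linarith
    _ = 4 * ‖d‖ ^ 2 := by rw [norm_sq_eq_sum, Finset.mul_sum]
    _ ≤ 4 * (1 / 2) ^ 2 := by
        have := hdβ.trans hβ'
        gcongr
    _ = 1 ^ 2 := by norm_num

/-- A vector of norm at most `N` has at most `(N / c)²` entries of absolute value at least `c`. -/
lemma sqrt_card_filter_le {v : E n} {c N : ℝ} (hc : 0 < c) (hv : ‖v‖ ≤ N) {s : Finset (Fin n)}
    (h : ∀ i ∈ s, c ≤ |v i|) : √(s.card : ℝ) ≤ N / c := by
  have hN : 0 ≤ N := (norm_nonneg v).trans hv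
  refine Real.sqrt_le_iff.mpr ⟨by positivity, ?_⟩
  rw [div_pow, le_div_iff₀ (by positivity)]
  calc (s.card : ℝ) * c ^ 2 = ∑ i ∈ s, c ^ 2 := by rw [Finset.sum_const, nsmul_eq_mul]
    _ ≤ ∑ i ∈ s, v i ^ 2 := Finset.sum_le_sum fun i hi => by
        rw [← sq_abs (v i)]
        exact pow_le_pow_left₀ hc.le (h i hi) 2
    _ ≤ ∑ i, v i ^ 2 :=
        Finset.sum_le_sum_of_subset_of_nonneg (Finset.subset_univ s) fun i _ _ => sq_nonneg _
    _ = ‖v‖ ^ 2 := (norm_sq_eq_sum v).symm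
    _ ≤ N ^ 2 := by gcongr

lemma sqrt_sum_le_sum_sqrt {α : Type} (s : Finset α) {a : α → ℝ} (ha : ∀ l, 0 ≤ a l) :
    √(∑ l ∈ s, a l) ≤ ∑ l ∈ s, √(a l) := by
  classical
  induction s using Finset.induction_on with
  | empty => simp
  | insert l s hl ih =>
    rw [Finset.sum_insert hl, Finset.sum_insert hl]
    refine le_trans (Real.sqrt_le_iff.mpr ⟨by positivity, ?_⟩) (add_le_add_right ih _)
    have h1 : 0 ≤ ∑ l ∈ s, a l := Finset.sum_nonneg fun l _ => ha l
    rw [add_sq, Real.sq_sqrt (ha l), Real.sq_sqrt h1]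
    have : 0 ≤ 2 * √(a l) * √(∑ l ∈ s, a l) := by positivity
    linarith

open Classical in
/-- The coordinates that moved far enough since time `t - 2 ^ l` to be refreshed because of level
`l`. -/
def RunData.refreshedAt (D : RunData m n) (t l : ℕ) : Finset (Fin n) :=
  Finset.univ.filter fun i => 2 ^ l ∣ t ∧
    D.δ / (2 * (Nat.clog 2 n : ℝ)) ≤ |D.logIterate t i - D.logIterate (t - 2 ^ l) i|

lemma RunData.card_refreshed_le (D : RunData m n) {t : ℕ} (htop : ¬ 2 ^ Nat.clog 2 n ∣ t) :
    (D.refreshed t).card ≤ ∑ l ∈ Finset.range (Nat.clog 2 n), (D.refreshedAt t l).card := by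
  classical
  have hsub : D.refreshed t ⊆ (Finset.range (Nat.clog 2 n)).biUnion (D.refreshedAt t) := by
    intro i hi
    rcases (Finset.mem_filter.mp hi).2 with h | ⟨l, h1, h2⟩
    · exact absurd h htop
    · exact Finset.mem_biUnion.mpr ⟨l, Finset.mem_range.mpr h1,
        Finset.mem_filter.mpr ⟨Finset.mem_univ i, h2⟩⟩
  exact (Finset.card_le_card hsub).trans Finset.card_biUnion_le

lemma RunData.sqrt_card_refreshedAt_le (D : RunData m n) (hδ : 0 < D.δ)
    (hmove : ∀ t, ‖(WithLp.toLp 2 (D.logIterate (t + 1)) : E n) -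
      WithLp.toLp 2 (D.logIterate t)‖ ≤ 1) {t l : ℕ} (ht : 0 < t) (hl : l < Nat.clog 2 n) :
    √((D.refreshedAt t l).card : ℝ) ≤
      if 2 ^ l ∣ t then 2 ^ l * (2 * (Nat.clog 2 n : ℝ) / D.δ) else 0 := by
  have hL0 : (0 : ℝ) < Nat.clog 2 n := by exact_mod_cast (Nat.zero_le l).trans_lt hl
  split_ifs with hdvd
  · have hle : 2 ^ l ≤ t := Nat.le_of_dvd ht hdvd
    have hmoves : ∀ k s, ‖(WithLp.toLp 2 (D.logIterate (s + k)) : E n) -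
        WithLp.toLp 2 (D.logIterate s)‖ ≤ k := by
      intro k s
      induction k with
      | zero => simp
      | succ k ih =>
        have h1 := hmove (s + k)
        have h2 := norm_sub_le_norm_sub_add_norm_sub
          (WithLp.toLp 2 (D.logIterate (s + k + 1)) : E n)
          (WithLp.toLp 2 (D.logIterate (s + k))) (WithLp.toLp 2 (D.logIterate s))
        push_cast
        rw [← add_assoc]
        linarith
    have h1 := hmoves (2 ^ l) (t - 2 ^ l)
    rw [Nat.sub_add_cancel hle] at h1
    refine (sqrt_card_filter_le (c := D.δ / (2 * Nat.clog 2 n)) (by positivity) h1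
      (s := D.refreshedAt t l) fun i hi => (Finset.mem_filter.mp hi).2.2).trans (le_of_eq ?_)
    push_cast
    field_simp
  · have : D.refreshedAt t l = ∅ := Finset.filter_eq_empty_iff.mpr fun i _ h => hdvd h.1
    rw [this]
    simp

/-- The bound for `√k`, where `k` is the number of coordinates refreshed at time `t`. -/
lemma RunData.sqrt_card_refreshed_le (D : RunData m n) (hδ : 0 < D.δ)
    (hmove : ∀ t, ‖(WithLp.toLp 2 (D.logIterate (t + 1)) : E n) -
      WithLp.toLp 2 (D.logIterate t)‖ ≤ 1) {t : ℕ} (ht : 0 < t) :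
    √((D.refreshed t).card : ℝ) ≤
      (if 2 ^ Nat.clog 2 n ∣ t then 2 ^ Nat.clog 2 n else 0) +
        ∑ l ∈ Finset.range (Nat.clog 2 n), if 2 ^ l ∣ t then
          2 ^ l * (2 * (Nat.clog 2 n : ℝ) / D.δ) else 0 := by
  by_cases htop : 2 ^ Nat.clog 2 n ∣ t
  · rw [if_pos htop]
    have hsum : 0 ≤ ∑ l ∈ Finset.range (Nat.clog 2 n), if 2 ^ l ∣ t then
        2 ^ l * (2 * (Nat.clog 2 n : ℝ) / D.δ) else (0 : ℝ) :=
      Finset.sum_nonneg fun l _ => by split_ifs <;> positivity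
    have h1 : ((D.refreshed t).card : ℝ) ≤ 2 ^ Nat.clog 2 n := by
      have h2 : (D.refreshed t).card ≤ n := by simpa using Finset.card_le_univ (D.refreshed t)
      exact_mod_cast h2.trans (Nat.le_pow_clog (by norm_num) n)
    have h3 : √((D.refreshed t).card : ℝ) ≤ 2 ^ Nat.clog 2 n := by
      refine Real.sqrt_le_iff.mpr ⟨by positivity, h1.trans ?_⟩
      exact le_self_pow₀ (one_le_pow₀ (by norm_num)) (by norm_num)
    linarith
  · rw [if_neg htop, zero_add]
    have hcard : ((D.refreshed t).card : ℝ) ≤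
        ∑ l ∈ Finset.range (Nat.clog 2 n), ((D.refreshedAt t l).card : ℝ) := by
      exact_mod_cast D.card_refreshed_le htop
    exact (Real.sqrt_le_sqrt hcard).trans ((sqrt_sum_le_sum_sqrt _ fun _ => Nat.cast_nonneg _).trans
      (Finset.sum_le_sum fun l hl =>
        D.sqrt_card_refreshedAt_le hδ hmove ht (Finset.mem_range.mp hl)))

/-- There are at most `T / 2 ^ l` multiples of `2 ^ l` up to `T`. -/
lemma sum_ite_dvd_le (T l : ℕ) {c : ℝ} (hc : 0 ≤ c) :
    ∑ t ∈ Finset.range T, (if 2 ^ l ∣ t + 1 then 2 ^ l * c else 0) ≤ T * c := by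
  rw [← Finset.sum_filter, Finset.sum_const, nsmul_eq_mul, ← mul_assoc]
  refine mul_le_mul_of_nonneg_right ?_ hc
  have h : ((Finset.range T).filter fun t => 2 ^ l ∣ t + 1).card = T / 2 ^ l := by
    rw [Nat.card_multiples T (2 ^ l)]
  rw [h]
  exact_mod_cast Nat.div_mul_le_self T (2 ^ l)

/-- The amortized bound on the sizes of the updates. -/
lemma sum_sqrt_card_refreshed_le (hs : ConcaveSetting A b f ε Lφ C₀ x₀ xstar) (hε : 0 < ε)
    (hL : 0 < Lφ) (hβ : 0 < β) (hβ' : β ≤ 1 / 2) (T : ℕ) :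
    ∑ t ∈ Finset.range T, √(((concaveRun A f ε β Lφ x₀).refreshed (t + 1)).card : ℝ) ≤
      T * (1 + 2 * (Nat.clog 2 n : ℝ) ^ 2 / (concaveRun A f ε β Lφ x₀).δ) := by
  set D := concaveRun A f ε β Lφ x₀ with hD
  set L := Nat.clog 2 n with hLdef
  have hδ : 0 < D.δ := by
    change 0 < (1 - β) * ε / (184 * Lφ)
    exact div_pos (mul_pos (by linarith) hε) (by positivity)
  refine (Finset.sum_le_sum fun t _ => D.sqrt_card_refreshed_le hδ
    (norm_logIterate_succ_sub_le hs hβ hβ') (Nat.succ_pos t)).trans ?_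
  rw [Finset.sum_add_distrib, Finset.sum_comm]
  have h1 := sum_ite_dvd_le T L zero_le_one
  simp only [mul_one] at h1
  have h2 : ∑ l ∈ Finset.range L, ∑ t ∈ Finset.range T, (if 2 ^ l ∣ t + 1 then
      2 ^ l * (2 * (L : ℝ) / D.δ) else 0) ≤ ∑ l ∈ Finset.range L, T * (2 * (L : ℝ) / D.δ) :=
    Finset.sum_le_sum fun l _ => sum_ite_dvd_le T l (by positivity)
  rw [Finset.sum_const, Finset.card_range, nsmul_eq_mul] at h2
  refine (add_le_add h1 h2).trans (le_of_eq ?_)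
  field_simp

end Run

/-! ### The implementation -/

section Implementation

variable {m n : ℕ} {κ : Type} {W W' : World} {D : RunData m n}

/-- The entry `A i j` as an input register. -/
def regA (i : Fin m) (j : Fin n) : Reg (Input m n) := .inl (.A i j)

lemma rep_eps : Rep D.input W (.inl .ε) D.ε := rfl

lemma rep_beta : Rep D.input W (.inl .β) D.β := rfl

lemma rep_delta : Rep D.input W (.inl .δ) D.δ := rfl

lemma repMat_regA : RepMat D.input W regA D.A := fun _ _ => rfl

/-- The logarithms of the coordinates of a point and the value of the potential function. -/
def Prog.logPotential (x : Fin n → Reg (Input m n)) :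
    Prog (Input m n) κ n ((Fin n → Reg (Input m n)) × Reg (Input m n)) := do
  let l ← Prog.forAll fun i => .log (x i)
  let s ← Prog.sum l
  let F ← Prog.value x
  let t ← Prog.mul (.inl .ε) s
  let p ← Prog.sub F t
  pure (l, p)

lemma spec_logPotential {xr : Fin n → Reg (Input m n)} {x : E n}
    (hx : ∀ i, Rep D.input W (xr i) (x i)) :
    Spec D.f D.input (.logPotential xr : Prog (Input m n) κ n _) W
      (fun r W' => (∀ i, Rep D.input W' (r.1 i) (Real.log (x i))) ∧
        Rep D.input W' r.2 (potential D.ε D.f x)) (3 * n + 4) := by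
  refine Spec.cost_le (c := Fintype.card (Fin n) * 1 + ((Fintype.card (Fin n) + 1) + ((n + 1) +
    (1 + 1)))) ?_ (by rw [Fintype.card_fin]; linarith)
  refine (spec_forAll_rep fun i W₁ h₁ => spec_log ((hx i).mono h₁)).bind fun l W₁ h₁ hl => ?_
  refine (spec_sum hl).bind fun s W₂ h₂ hs => ?_
  refine (spec_value fun i => (hx i).mono (h₁.trans h₂)).bind fun F W₃ h₃ hF => ?_
  refine (spec_mul rep_eps (hs.mono h₃)).bind fun t W₄ h₄ ht => ?_
  exact (spec_sub (hF.mono h₄) ht).map fun p W₅ h₅ hp =>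
    ⟨fun i => (hl i).mono ((h₂.trans h₃).trans (h₄.trans h₅)), hp⟩

/-- One step `x ↦ x + X d`, from the squares `z` of the scaling and the inverse `M` of
`A diag(z) Aᵀ`. If the projected gradient vanishes, then `β / 0 = 0` gives the zero step, so that
no case distinction is needed. -/
def Prog.step (x z : Fin n → Reg (Input m n)) (M : Fin m → Fin m → Reg (Input m n)) :
    Prog (Input m n) κ n (Fin n → Reg (Input m n)) := do
  let g ← Prog.grad x
  let a ← Prog.forAll fun i => .mul (x i) (g i)
  let u ← Prog.forAll fun i => .sub (a i) (.inl .ε)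
  let xu ← Prog.forAll fun i => .mul (x i) (u i)
  let v ← Prog.mulVec regA xu
  let mu ← Prog.mulVec M v
  let q ← Prog.mulVec (fun j i => regA i j) mu
  let zx ← Prog.forAll fun i => .div (z i) (x i)
  let h ← Prog.forAll fun i => .mul (zx i) (q i)
  let r ← Prog.forAll fun i => .sub (u i) (h i)
  let s ← Prog.dot r r
  let nr ← Prog.sqrt s
  let c ← Prog.div (.inl .β) nr
  let e ← Prog.forAll fun i => .mul c (r i)
  let y ← Prog.forAll fun i => .mul (x i) (e i)
  Prog.forAll fun i => .sub (x i) (y i)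

lemma spec_step (hm : 0 < m) (hmn : m ≤ n) {xr zr : Fin n → Reg (Input m n)}
    {M : Fin m → Fin m → Reg (Input m n)} {x xbar : E n} (hpos : ∀ i, 0 < x i)
    (hf : DifferentiableAt ℝ D.f x) (hx : ∀ i, Rep D.input W (xr i) (x i))
    (hz : ∀ i, Rep D.input W (zr i) (xbar i ^ 2))
    (hM : RepMat D.input W M (gram D.A fun i => xbar i ^ 2)⁻¹) :
    Spec D.f D.input (.step xr zr M : Prog (Input m n) κ n _) W
      (fun r W' => ∀ i, Rep D.input W' (r i) ((x + scale x (D.direction x xbar)) i))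
      (30 * (n * m)) := by
  have hn1 : (1 : ℝ) ≤ n := by exact_mod_cast hm.trans_le hmn
  have hm1 : (1 : ℝ) ≤ m := by exact_mod_cast hm
  have hmn' : (m : ℝ) ≤ n := by exact_mod_cast hmn
  set u : E n := scale x (gradient (potential D.ε D.f) x) with hu
  set r : E n := D.projectedGradient x xbar with hr
  have hrp : ∀ i, r i = u i - xbar i ^ 2 / x i * (D.Aᵀ *ᵥ multiplier D.A x xbar u) i :=
    fun i => project_apply D.A xbar u hpos i
  let N : ℝ := Fintype.card (Fin n)
  refine Spec.cost_le (c := (n + 1) + (N * 1 + (N * 1 + (N * 1 +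
    (Fintype.card (Fin m) * (2 * Fintype.card (Fin n) + 1) +
    (Fintype.card (Fin m) * (2 * Fintype.card (Fin m) + 1) +
    (Fintype.card (Fin n) * (2 * Fintype.card (Fin m) + 1) + (N * 1 + (N * 1 + (N * 1 +
    ((2 * N + 1) + (1 + (1 + (N * 1 + (N * 1 + N * 1))))))))))))))) ?_ ?_
  · refine (spec_grad hx).bind fun g W₁ h₁ hg => ?_
    refine (spec_forAll_rep fun i W' h' => spec_mul ((hx i).mono (h₁.trans h'))
      ((hg i).mono h')).bind fun a W₂ h₂ ha => ?_
    refine (spec_forAll_rep (x := fun i => u i) fun i W' h' => ?_).bind fun ur W₃ h₃ hur => ?_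
    · rw [hu, scale_gradient_potential_apply hpos hf]
      exact spec_sub ((ha i).mono h') rep_eps
    have h₁₃ := (h₁.trans h₂).trans h₃
    refine (spec_forAll_rep fun i W' h' => spec_mul ((hx i).mono (h₁₃.trans h'))
      ((hur i).mono h')).bind fun xu W₄ h₄ hxu => ?_
    refine (spec_mulVec repMat_regA hxu).bind fun v W₅ h₅ hv => ?_
    have h₁₅ := h₁₃.trans (h₄.trans h₅)
    refine (spec_mulVec (hM.mono h₁₅) hv).bind fun mu W₆ h₆ hmu => ?_
    refine (spec_mulVec repMat_regA.transpose hmu).bind fun q W₇ h₇ hq => ?_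
    have h₁₇ := h₁₅.trans (h₆.trans h₇)
    refine (spec_forAll_rep fun i W' h' => spec_div ((hz i).mono (h₁₇.trans h'))
      ((hx i).mono (h₁₇.trans h'))).bind fun zx W₈ h₈ hzx => ?_
    refine (spec_forAll_rep fun i W' h' => spec_mul ((hzx i).mono h')
      ((hq i).mono (h₈.trans h'))).bind fun h W₉ h₉ hh => ?_
    refine (spec_forAll_rep (x := fun i => r i) fun i W' h' => ?_).bind fun rr W₁₀ h₁₀ hrr => ?_
    · rw [hrp]
      refine spec_sub ((hur i).mono ?_) ((hh i).mono h')
      exact (h₄.trans h₅).trans ((h₆.trans h₇).trans ((h₈.trans h₉).trans h'))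
    refine (spec_dot hrr hrr).bind fun s W₁₁ h₁₁ hs => ?_
    have hnorm : ‖r‖ = √(∑ i, r i * r i) := by
      rw [← inner_eq_sum, real_inner_self_eq_norm_mul_norm, Real.sqrt_mul_self (norm_nonneg r)]
    refine (spec_sqrt hs).bind fun nr W₁₂ h₁₂ hnr => ?_
    rw [← hnorm] at hnr
    refine (spec_div rep_beta hnr).bind fun c W₁₃ h₁₃' hc => ?_
    refine (spec_forAll_rep fun i W' h' => spec_mul (hc.mono h')
      ((hrr i).mono ((h₁₁.trans h₁₂).trans (h₁₃'.trans h')))).bind fun e W₁₄ h₁₄ he => ?_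
    have hx₁₄ : ∀ i, Rep D.input W₁₄ (xr i) (x i) := fun i => (hx i).mono
      (h₁₇.trans (((h₈.trans h₉).trans (h₁₀.trans h₁₁)).trans ((h₁₂.trans h₁₃').trans h₁₄)))
    refine (spec_forAll_rep fun i W' h' => spec_mul ((hx₁₄ i).mono h') ((he i).mono h')).bind
      fun y W₁₅ h₁₅' hy => ?_
    refine spec_forAll_rep fun i W' h' => ?_
    have hval : (x + scale x (D.direction x xbar)) i = x i - x i * (D.β / ‖r‖ * r i) := by
      rw [D.direction_eq, ← hr]
      simp only [PiLp.add_apply, scale, PiLp.smul_apply, smul_eq_mul]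
      ring
    rw [hval]
    exact spec_sub ((hx₁₄ i).mono (h₁₅'.trans h')) ((hy i).mono h')
  · simp only [N, Fintype.card_fin]
    have e1 : (n : ℝ) ≤ n * m := le_mul_of_one_le_right (by linarith) hm1
    have e2 : (m : ℝ) ≤ n * m := le_mul_of_one_le_left (by linarith) hn1
    have e3 : (m : ℝ) * m ≤ n * m := by gcongr
    have e4 : (1 : ℝ) ≤ n * m := hn1.trans e1
    linarith

/-- The test whether the potential function decreases sufficiently from `p` to `p'`. -/
def Prog.decreases (p p' : Reg (Input m n)) : Prog (Input m n) κ n Bool := do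
  let one ← Prog.const 1
  let two ← Prog.const 2
  let zero ← Prog.const 0
  let a ← Prog.sub one (.inl .β)
  let b ← Prog.mul (.inl .ε) (.inl .β)
  let c ← Prog.mul b a
  let d ← Prog.div c two
  let e ← Prog.sub zero d
  let q ← Prog.sub p' p
  Prog.le q e

lemma spec_decreases {p p' : Reg (Input m n)} {x x' : ℝ} (hp : Rep D.input W p x)
    (hp' : Rep D.input W p' x') :
    Spec D.f D.input (.decreases p p' : Prog (Input m n) κ n _) W
      (fun r _ => r = true ↔ ¬ x' - x > -(D.ε * D.β * (1 - D.β) / 2)) 10 := by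
  refine Spec.cost_le (c := 1 + (1 + (1 + (1 + (1 + (1 + (1 + (1 + (1 + 1))))))))) ?_ (by norm_num)
  refine (spec_const 1).bind fun one W₁ h₁ hone => ?_
  refine (spec_const 2).bind fun two W₂ h₂ htwo => ?_
  refine (spec_const 0).bind fun zero W₃ h₃ hzero => ?_
  refine (spec_sub (hone.mono (h₂.trans h₃)) rep_beta).bind
    fun a W₄ h₄ ha => ?_
  refine (spec_mul rep_eps rep_beta).bind
    fun b W₅ h₅ hb => ?_
  refine (spec_mul hb (ha.mono h₅)).bind fun c W₆ h₆ hc => ?_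
  refine (spec_div hc (htwo.mono (h₃.trans (h₄.trans (h₅.trans h₆))))).bind fun d W₇ h₇ hd => ?_
  have h₃₇ := (h₄.trans h₅).trans (h₆.trans h₇)
  refine (spec_sub (hzero.mono h₃₇) hd).bind fun e W₈ h₈ he => ?_
  have h₁₈ := ((h₁.trans h₂).trans h₃).trans (h₃₇.trans h₈)
  refine (spec_sub (hp'.mono h₁₈) (hp.mono h₁₈)).bind fun q W₉ h₉ hq => ?_
  refine (spec_le hq (he.mono h₉)).weaken (fun r _ _ hr => ?_) le_rfl
  rw [hr, zero_sub, gt_iff_lt, not_lt]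

/-- The test whether coordinate `i` is refreshed at time `t`, given the logarithms of the
iterates. Divisibility is decided when the tree is built, and `|d|` is computed as `√(d * d)`. -/
def Prog.refresh (logs : ℕ → Fin n → Reg (Input m n)) (t : ℕ) (i : Fin n) :
    Prog (Input m n) κ n Bool :=
  if 2 ^ Nat.clog 2 n ∣ t then pure true
  else Prog.anyList (fun l => if 2 ^ l ∣ t then do
      let d ← Prog.sub (logs t i) (logs (t - 2 ^ l) i)
      let q ← Prog.mul d d
      let a ← Prog.sqrt q
      let k ← Prog.const (2 * (Nat.clog 2 n : ℝ))
      let c ← Prog.div (.inl .δ) k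
      Prog.le c a
    else pure false) (List.range (Nat.clog 2 n))

lemma spec_refresh {logs : ℕ → Fin n → Reg (Input m n)} {t : ℕ}
    (hlogs : ∀ s ≤ t, ∀ i, Rep D.input W (logs s i) (D.logIterate s i)) (i : Fin n) :
    Spec D.f D.input (.refresh logs t i : Prog (Input m n) κ n _) W
      (fun r _ => r = true ↔ RefreshCond D.δ D.logIterate t i) (Nat.clog 2 n * 6) := by
  rw [Prog.refresh]
  split_ifs with htop
  · exact (Spec.pure (by simp [RefreshCond, htop])).cost_le (by positivity)
  · refine (spec_anyList (P := fun l => 2 ^ l ∣ t ∧ D.δ / (2 * (Nat.clog 2 n : ℝ)) ≤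
      |D.logIterate t i - D.logIterate (t - 2 ^ l) i|) (c := 6) _ W fun l _ W₁ h₁ => ?_).weaken
        (fun r _ _ hr => ?_) (by simp)
    · split_ifs with hdvd
      · refine Spec.cost_le (c := 1 + (1 + (1 + (1 + (1 + 1))))) ?_ (by norm_num)
        refine (spec_sub ((hlogs t le_rfl i).mono h₁)
          ((hlogs (t - 2 ^ l) (Nat.sub_le _ _) i).mono h₁)).bind fun d W₂ h₂ hd => ?_
        refine (spec_mul hd hd).bind fun q W₃ h₃ hq => ?_
        refine (spec_sqrt hq).bind fun a W₄ h₄ ha => ?_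
        rw [Real.sqrt_mul_self_eq_abs] at ha
        refine (spec_const _).bind fun k W₅ h₅ hk => ?_
        refine (spec_div rep_delta hk).bind fun c W₆ h₆ hc => ?_
        refine (spec_le hc (ha.mono (h₅.trans h₆))).weaken (fun r _ _ hr => ?_) le_rfl
        rw [hr]
        simp [hdvd]
      · exact (Spec.pure (by simp [hdvd])).cost_le (by norm_num)
    · rw [hr, RefreshCond]
      simp [htop]

/-- The registers that hold the state of the main loop: the logarithms of all iterates so far, the
current iterate, the maintained scaling and its squares, the inverse of `A X̄² Aᵀ`, and the
potential. -/
structure RunRegs (m n : ℕ) : Type where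
  logs : ℕ → Fin n → Reg (Input m n)
  x : Fin n → Reg (Input m n)
  xbar : Fin n → Reg (Input m n)
  z : Fin n → Reg (Input m n)
  M : Fin m → Fin m → Reg (Input m n)
  phi : Reg (Input m n)

/-- The registers hold the state of the run at time `t`. -/
structure RunRegs.Holds (D : RunData m n) (W : World) (t : ℕ) (R : RunRegs m n) : Prop where
  logs : ∀ s ≤ t, ∀ i, Rep D.input W (R.logs s i) (D.logIterate s i)
  x : ∀ i, Rep D.input W (R.x i) (D.iterate t i)
  xbar : ∀ i, Rep D.input W (R.xbar i) (D.scaling t i)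
  z : ∀ i, Rep D.input W (R.z i) (D.scaling t i ^ 2)
  M : RepMat D.input W R.M (gram D.A fun i => D.scaling t i ^ 2)⁻¹
  phi : Rep D.input W R.phi (potential D.ε D.f (D.iterate t))

/-- The computation of the next state from the next iterate `x`, its logarithms `l` and its
potential `p`. -/
def Prog.advance (S : MulFamily) (hm : 0 < m) (t : ℕ) (R : RunRegs m n)
    (x l : Fin n → Reg (Input m n)) (p : Reg (Input m n)) :
    Prog (Input m n) κ n (RunRegs m n) := do
  let logs := Function.update R.logs (t + 1) l
  let c ← Prog.forAll fun i => Prog.refresh logs (t + 1) i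
  let xbar := fun i => if c i then x i else R.xbar i
  let z ← Prog.forAll fun i => .mul (xbar i) (xbar i)
  let d ← Prog.forAll fun i => .sub (z i) (R.z i)
  let M ← Prog.update S hm regA d n (Finset.univ.filter fun i => c i = true) R.M
  pure { logs, x, xbar, z, M, phi := p }

open Classical in
lemma spec_advance {ω C : ℝ} {S : MulFamily} (hS : IsMulFamily ω C S) (hC : 0 ≤ C)
    (hω : 2 ≤ ω) (hω' : ω ≤ 5 / 2) (hm : 0 < m) (hA : LinearIndependent ℝ D.A.row) {t : ℕ}
    (hpos : ∀ s i, 0 < D.scaling s i)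
    (hscal : ∀ i, D.scaling (t + 1) i =
      if RefreshCond D.δ D.logIterate (t + 1) i then D.iterate (t + 1) i else D.scaling t i)
    {R : RunRegs m n} {x l : Fin n → Reg (Input m n)} {p : Reg (Input m n)}
    (hR : R.Holds D W t) (hx : ∀ i, Rep D.input W (x i) (D.iterate (t + 1) i))
    (hl : ∀ i, Rep D.input W (l i) (D.logIterate (t + 1) i))
    (hp : Rep D.input W p (potential D.ε D.f (D.iterate (t + 1)))) :
    Spec D.f D.input (.advance S hm t R x l p : Prog (Input m n) κ n _) W
      (fun R' W' => R'.Holds D W' (t + 1))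
      (n * (Nat.clog 2 n * 6) + 2 * n +
        200 * (C + 2) * updateCost m (D.refreshed (t + 1)).card) := by
  refine Spec.cost_le (c := Fintype.card (Fin n) * (Nat.clog 2 n * 6) + (Fintype.card (Fin n) * 1 +
    (Fintype.card (Fin n) * 1 + 200 * (C + 2) * updateCost m (D.refreshed (t + 1)).card)))
    ?_ (by rw [Fintype.card_fin]; linarith)
  have hlogs : ∀ s ≤ t + 1, ∀ i,
      Rep D.input W (Function.update R.logs (t + 1) l s i) (D.logIterate s i) := by
    intro s hs i
    rcases hs.eq_or_lt with rfl | hs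
    · rw [Function.update_self]; exact hl i
    · rw [Function.update_of_ne hs.ne]; exact hR.logs s (by omega) i
  refine (spec_forAll (Q := fun i (r : Bool) _ => r = true ↔ RefreshCond D.δ D.logIterate (t + 1) i)
    (fun _ _ _ _ _ h => h) fun i W₁ h₁ =>
      spec_refresh (fun s hs j => (hlogs s hs j).mono h₁) i).bind fun c W₁ h₁ hc => ?_
  have hxbar : ∀ i, Rep D.input W (if c i then x i else R.xbar i) (D.scaling (t + 1) i) := by
    intro i
    rw [hscal i]
    by_cases h : c i = true
    · rw [if_pos h, if_pos ((hc i).mp h)]; exact hx i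
    · rw [if_neg h, if_neg fun h' => h ((hc i).mpr h')]; exact hR.xbar i
  refine (spec_forAll_rep (x := fun i => D.scaling (t + 1) i ^ 2) fun i W' h' => ?_).bind
    fun z W₂ h₂ hz => ?_
  · rw [sq]
    exact spec_mul ((hxbar i).mono (h₁.trans h')) ((hxbar i).mono (h₁.trans h'))
  have h₁₂ := h₁.trans h₂
  refine (spec_forAll_rep fun i W' h' => spec_sub ((hz i).mono h')
    ((hR.z i).mono (h₁₂.trans h'))).bind fun d W₃ h₃ hd => ?_
  have hset : (Finset.univ.filter fun i => c i = true) = D.refreshed (t + 1) := by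
    ext i
    simp [RunData.refreshed, hc i]
  have hpw : (D.refreshed (t + 1)).piecewise (fun i => D.scaling (t + 1) i ^ 2)
      (fun i => D.scaling t i ^ 2) = fun i => D.scaling (t + 1) i ^ 2 := by
    ext i
    by_cases h : i ∈ D.refreshed (t + 1)
    · rw [Finset.piecewise_eq_of_mem _ _ _ h]
    · rw [Finset.piecewise_eq_of_notMem _ _ _ h, hscal i, if_neg]
      exact fun h' => h (Finset.mem_filter.mpr ⟨Finset.mem_univ i, h'⟩)
  have h₁₃ := h₁₂.trans h₃
  have hupd := spec_update (f := D.f) (κ := κ) (inp := D.input) (W := W₃) (d := d) hS hC hω hω'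
    hm hA (z' := fun i => D.scaling (t + 1) i ^ 2) (fun i => pow_pos (hpos _ i) 2) n
    (z := fun i => D.scaling t i ^ 2) (fun i => pow_pos (hpos _ i) 2) (s := D.refreshed (t + 1))
    (by simpa using Finset.card_le_univ (D.refreshed (t + 1))) repMat_regA
    (fun i _ => hd i) (hR.M.mono h₁₃)
  rw [hpw] at hupd
  simp only [hset]
  refine hupd.map fun M W₄ h₄ hM => ?_
  have h₁₄ := h₁₃.trans h₄
  exact ⟨fun s hs i => (hlogs s hs i).mono h₁₄, fun i => (hx i).mono h₁₄,
    fun i => (hxbar i).mono h₁₄, fun i => (hz i).mono (h₃.trans h₄), hM, hp.mono h₁₄⟩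

/-- The main loop, entered at time `t` with at most `k` iterations left. -/
def Prog.mainLoop (S : MulFamily) (hm : 0 < m) :
    ℕ → ℕ → RunRegs m n → Prog (Input m n) κ n (Fin n → Reg (Input m n))
  | 0, _, R => pure R.x
  | k + 1, t, R => do
    let x ← Prog.step R.x R.z R.M
    let lp ← Prog.logPotential x
    let b ← Prog.decreases R.phi lp.2
    if b then do
      let R' ← Prog.advance S hm t R x lp.1 lp.2
      Prog.mainLoop S hm k (t + 1) R'
    else pure R.x

lemma spec_mainLoop {ω C : ℝ} {S : MulFamily} (hS : IsMulFamily ω C S) (hC : 0 ≤ C)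
    (hω : 2 ≤ ω) (hω' : ω ≤ 5 / 2) (hm : 0 < m) (hmn : m ≤ n)
    {A : Matrix (Fin m) (Fin n) ℝ} {b : Fin m → ℝ} {f : E n → ℝ} {ε Lφ C₀ β : ℝ} {x₀ xstar : E n}
    (hs : ConcaveSetting A b f ε Lφ C₀ x₀ xstar) (hβ : 0 < β) (hβ' : β ≤ 1 / 2)
    (hD : D = concaveRun A f ε β Lφ x₀) (k : ℕ) {t : ℕ} {W : World} {R : RunRegs m n}
    (hR : R.Holds D W t) :
    Spec D.f D.input (.mainLoop S hm k t R : Prog (Input m n) κ n _) W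
      (fun r W' => ∀ i, Rep D.input W' (r i) ((D.loop k t).1 i))
      (∑ s ∈ Finset.range k, ((n * m) * (50 + 6 * Nat.clog 2 n) +
        400 * (C + 2) * (n * m) * √((D.refreshed (t + s + 1)).card : ℝ))) := by
  have hn1 : (1 : ℝ) ≤ n := by exact_mod_cast hm.trans_le hmn
  have hm1 : (1 : ℝ) ≤ m := by exact_mod_cast hm
  induction k generalizing t W R with
  | zero => exact (Spec.pure hR.x).cost_le (by simp)
  | succ k ih =>
    have hmem := fun s => iterate_mem_and_scaling_pos hs hβ hβ' s
    rw [← hD] at hmem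
    have hDA : D.A = A := by rw [hD]; rfl
    have hDf : D.f = f := by rw [hD]; rfl
    have hnext := scaling_succ_eq_ite hs hβ hβ' t
    rw [← hD] at hnext
    rw [Finset.sum_range_succ']
    have hcost : 0 ≤ ∑ s ∈ Finset.range k, ((n * m) * (50 + 6 * (Nat.clog 2 n : ℝ)) +
        400 * (C + 2) * (n * m) * √((D.refreshed (t + (s + 1) + 1)).card : ℝ)) :=
      Finset.sum_nonneg fun s _ => by positivity
    have hcard : (D.refreshed (t + 1)).card ≤ n := by
      simpa using Finset.card_le_univ (D.refreshed (t + 1))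
    refine Spec.cost_le (c := 30 * (n * m) + ((3 * n + 4) + (10 +
      ((n * (Nat.clog 2 n * 6) + 2 * n + 200 * (C + 2) * updateCost m (D.refreshed (t + 1)).card) +
      ∑ s ∈ Finset.range k, ((n * m) * (50 + 6 * (Nat.clog 2 n : ℝ)) +
        400 * (C + 2) * (n * m) * √((D.refreshed (t + (s + 1) + 1)).card : ℝ)))))) ?_ ?_
    · refine (spec_step hm hmn (hmem t).1.2 (by rw [hDf]; exact hs.differentiableAt _ (hmem t).1.2)
        hR.x hR.z hR.M).bind fun x W₁ h₁ hx => ?_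
      rw [← D.iterate_succ] at hx
      refine (spec_logPotential hx).bind fun lp W₂ h₂ hlp => ?_
      refine (spec_decreases (hR.phi.mono (h₁.trans h₂)) hlp.2).bind fun b W₃ h₃ hb => ?_
      have h₁₃ := (h₁.trans h₂).trans h₃
      rw [RunData.loop]
      have hb' : b = true ↔ ¬ D.Stops t := hb
      by_cases hret : D.Stops t
      · rw [if_pos hret, if_neg (by rw [hb']; exact not_not.mpr hret)]
        refine (Spec.pure fun i => (hR.x i).mono h₁₃).cost_le (add_nonneg ?_ hcost)
        have := updateCost_nonneg m (D.refreshed (t + 1)).card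
        positivity
      · rw [if_neg hret, if_pos (hb'.mpr hret)]
        have hR₃ : R.Holds D W₃ t := ⟨fun s hs i => (hR.logs s hs i).mono h₁₃,
          fun i => (hR.x i).mono h₁₃, fun i => (hR.xbar i).mono h₁₃,
          fun i => (hR.z i).mono h₁₃, hR.M.mono h₁₃, hR.phi.mono h₁₃⟩
        refine (spec_advance hS hC hω hω' hm (hDA ▸ hs.fullRowRank) (fun s => (hmem s).2) hnext hR₃
          (fun i => (hx i).mono (h₂.trans h₃)) (fun i => (hlp.1 i).mono h₃)
          (hlp.2.mono h₃)).bind fun R' W₄ h₄ hR' => ?_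
        refine (ih hR').cost_le (le_of_eq (Finset.sum_congr rfl fun s _ => ?_))
        rw [add_right_comm t 1 s, add_assoc t s 1]
    · have h1 := mul_le_mul_of_nonneg_left (updateCost_le_mul_sqrt hmn hcard)
        (by positivity : 0 ≤ 200 * (C + 2))
      have e1 : (n : ℝ) ≤ n * m := le_mul_of_one_le_right (by linarith) hm1
      have e2 : (1 : ℝ) ≤ n * m := hn1.trans e1
      have e3 : (n : ℝ) * Nat.clog 2 n ≤ n * m * Nat.clog 2 n := by gcongr
      linarith

/-- The complete program: the initial state, then the main loop. -/
def Prog.main (S : MulFamily) (hm : 0 < m) (T : ℕ) :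
    Prog (Input m n) κ n (Fin n → Reg (Input m n)) := do
  let x : Fin n → Reg (Input m n) := fun i => .inl (.x₀ i)
  let lp ← Prog.logPotential x
  let z ← Prog.forAll fun i => .mul (x i) (x i)
  let M ← Prog.gramInv S hm regA z
  Prog.mainLoop S hm T 0 { logs := fun _ => lp.1, x, xbar := x, z, M, phi := lp.2 }

lemma spec_main {ω C : ℝ} {S : MulFamily} (hS : IsMulFamily ω C S) (hC : 0 ≤ C)
    (hω : 2 ≤ ω) (hω' : ω ≤ 5 / 2) (hm : 0 < m) (hmn : m ≤ n)
    {A : Matrix (Fin m) (Fin n) ℝ} {b : Fin m → ℝ} {f : E n → ℝ} {ε Lφ C₀ β : ℝ} {x₀ xstar : E n}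
    (hs : ConcaveSetting A b f ε Lφ C₀ x₀ xstar) (hβ : 0 < β) (hβ' : β ≤ 1 / 2)
    (hD : D = concaveRun A f ε β Lφ x₀) (T : ℕ) :
    Spec D.f D.input (.main S hm T : Prog (Input m n) κ n _) W
      (fun r W' => ∀ i, Rep D.input W' (r i) (D.output T i))
      (4 * n + 4 + 160 * (C + 2) * (n * (m : ℝ) ^ (ω - 1)) +
        ∑ s ∈ Finset.range T, ((n * m) * (50 + 6 * Nat.clog 2 n) +
          400 * (C + 2) * (n * m) * √((D.refreshed (s + 1)).card : ℝ))) := by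
  have hmem := (iterate_mem_and_scaling_pos hs hβ hβ' 0)
  rw [← hD] at hmem
  have hDA : D.A = A := by rw [hD]; rfl
  have hit : ∀ i, D.iterate 0 i = D.x₀ i := fun i => rfl
  have hsc : ∀ i, D.scaling 0 i = D.x₀ i := fun i => rfl
  refine Spec.cost_le (c := (3 * n + 4) + (Fintype.card (Fin n) * 1 +
    (160 * (C + 2) * (n * (m : ℝ) ^ (ω - 1)) + ∑ s ∈ Finset.range T,
      ((n * m) * (50 + 6 * (Nat.clog 2 n : ℝ)) +
        400 * (C + 2) * (n * m) * √((D.refreshed (0 + s + 1)).card : ℝ))))) ?_ ?_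
  · have hx : ∀ W, ∀ i, Rep D.input W (.inl (.x₀ i)) (D.iterate 0 i) := fun W i => rfl
    refine (spec_logPotential (hx W)).bind fun lp W₁ h₁ hlp => ?_
    refine (spec_forAll_rep (x := fun i => D.scaling 0 i ^ 2) fun i W' h' => ?_).bind
      fun z W₂ h₂ hz => ?_
    · rw [sq]
      exact spec_mul (hx W' i) (hx W' i)
    refine (spec_gramInv hS hC hω (by linarith) hm hmn (hDA ▸ hs.fullRowRank)
      (fun i => pow_pos (hmem.2 i) 2) repMat_regA hz).bind fun M W₃ h₃ hM => ?_
    refine spec_mainLoop hS hC hω hω' hm hmn hs hβ hβ' hD T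
      ⟨fun s hs0 i => ?_, hx W₃, hx W₃, fun i => (hz i).mono h₃, hM,
        hlp.2.mono (h₂.trans h₃)⟩
    rw [Nat.le_zero.mp hs0]
    exact (hlp.1 i).mono (h₂.trans h₃)
  · simp only [zero_add, Fintype.card_fin]
    linarith

/-- The tree of a complete program. -/
def Prog.toTree {ι κ : Type} {n : ℕ} (p : Prog ι κ n (κ → Reg ι)) : Tree ι κ n :=
  p 0 fun out _ => .halt out

lemma Spec.toTree {ι κ : Type} {n : ℕ} {f : E n → ℝ} {inp : ι → ℝ} {p : Prog ι κ n (κ → Reg ι)}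
    {y : κ → ℝ} {c : ℝ}
    (h : Spec f inp p ⟨0, 0, fun _ _ => rfl⟩ (fun r W' => ∀ i, Rep inp W' (r i) (y i)) c) :
    (∀ i, p.toTree.result f inp i = y i) ∧ (p.toTree.steps f inp : ℝ) ≤ c := by
  obtain ⟨out, W', k, -, h2, h3, h4⟩ := h
  have h5 := h4 fun out _ => .halt out
  refine ⟨fun i => ?_, ?_⟩
  · have : p.toTree.result f inp i = Sum.elim inp W'.vals (out i) :=
      congrFun (congrArg Prod.fst h5) i
    rw [this, (h2 i).eval]
  · have : p.toTree.steps f inp = 0 + k := congrArg Prod.snd h5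
    rw [this, zero_add]
    exact h3

end Implementation

/-! ### The total cost -/

/-- The implementation of the algorithm as a family of trees; the tree for `m = 0` is arbitrary. -/
def implementation (S : MulFamily) (m n T : ℕ) : Tree (Input m n) (Fin n) n :=
  if hm : 0 < m then (Prog.main S hm T).toTree else .halt fun _ => .inr 0

lemma clog_le_two_mul {n : ℕ} (hn : 0 < n) {ε : ℝ} (hε : 0 < ε) (hε' : ε ≤ 1) :
    (Nat.clog 2 n : ℝ) ≤ 2 * (1 + Real.log (n / ε)) := by
  have hn1 : (1 : ℝ) ≤ n := by exact_mod_cast hn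
  have hlog0 : 0 ≤ Real.log n := Real.log_nonneg hn1
  have hlog : Real.log n ≤ Real.log (n / ε) := by
    refine Real.log_le_log (by linarith) ?_
    rw [le_div_iff₀ hε]
    nlinarith
  rcases Nat.lt_or_ge 1 n with h1 | h1
  · have h2 := Nat.pow_pred_clog_lt_self (b := 2) (by norm_num) h1
    obtain ⟨c, hc⟩ : ∃ c, Nat.clog 2 n = c + 1 :=
      ⟨_, (Nat.succ_pred_eq_of_pos (Nat.clog_pos (by norm_num) h1)).symm⟩
    rw [hc] at h2 ⊢
    simp only [Nat.pred_succ] at h2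
    have h3 : (c : ℝ) * Real.log 2 ≤ Real.log n := by
      rw [← Real.log_pow]
      exact Real.log_le_log (by positivity) (by exact_mod_cast h2.le)
    have h4 := Real.log_two_gt_d9
    push_cast
    nlinarith [(Nat.cast_nonneg c : (0 : ℝ) ≤ c)]
  · have hc : Nat.clog 2 n = 0 := Nat.clog_of_right_le_one h1 2
    rw [hc, Nat.cast_zero]
    linarith

/-- The final estimate: `L` stands for `⌈log₂ n⌉`, `T` for the number of iterations, `s` for the sum
of the square roots of the sizes of the updates, and `q` for the logarithmic factor. -/
lemma total_cost_le {C K₁ K₂ ε δ L T s q n m Y : ℝ} (hC : 0 ≤ C) (hK₁ : 0 ≤ K₁) (hK₂ : 0 ≤ K₂)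
    (hε : 0 < ε) (hε' : ε ≤ 1) (hq : 1 ≤ q) (hn : 1 ≤ n) (hm : 1 ≤ m) (hY : 0 ≤ Y) (hL0 : 0 ≤ L)
    (hL : L ≤ 2 * q) (hT0 : 0 ≤ T) (hT : T ≤ K₁ / ε) (hδ : 1 / δ = K₂ / ε)
    (hs : s ≤ T * (1 + 2 * L ^ 2 / δ)) :
    4 * n + 4 + 160 * (C + 2) * Y + (T * ((n * m) * (50 + 6 * L)) + 400 * (C + 2) * (n * m) * s) ≤
      (8 + 160 * (C + 2) + 62 * K₁ + 400 * (C + 2) * (K₁ * (1 + 8 * K₂))) *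
        (Y + n * m / ε ^ 2) * q ^ 2 := by
  set Z := n * m / ε ^ 2 with hZ
  have hnm : 1 ≤ n * m := by nlinarith
  have hq2 : q ≤ q ^ 2 := by nlinarith
  have hq1 : 1 ≤ q ^ 2 := by nlinarith
  have hε1 : 1 ≤ 1 / ε := by rw [le_div_iff₀ hε]; linarith
  have hε2 : 1 / ε ≤ 1 / ε ^ 2 := by
    rw [div_le_div_iff_of_pos_left one_pos hε (by positivity)]
    nlinarith
  have hZ0 : 0 ≤ Z := by positivity
  have hZε : n * m * (1 / ε) ≤ Z := by
    rw [hZ, div_eq_mul_one_div (n * m) (ε ^ 2)]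
    exact mul_le_mul_of_nonneg_left hε2 (by linarith)
  have hZ1 : n * m ≤ Z := le_trans (le_mul_of_one_le_right (by linarith) hε1) hZε
  have h1 : 4 * n + 4 ≤ 8 * (Z * q ^ 2) := by
    have h2 : n ≤ n * m := le_mul_of_one_le_right (by linarith) hm
    have h3 : Z ≤ Z * q ^ 2 := le_mul_of_one_le_right hZ0 hq1
    linarith
  have h2 : 160 * (C + 2) * Y ≤ 160 * (C + 2) * (Y * q ^ 2) := by
    gcongr
    exact le_mul_of_one_le_right hY hq1
  have h3 : T * ((n * m) * (50 + 6 * L)) ≤ 62 * K₁ * (Z * q ^ 2) := by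
    calc T * ((n * m) * (50 + 6 * L)) ≤ K₁ / ε * ((n * m) * (62 * q ^ 2)) := by
          gcongr
          linarith
      _ = 62 * K₁ * (n * m * (1 / ε) * q ^ 2) := by ring
      _ ≤ 62 * K₁ * (Z * q ^ 2) := by gcongr
  have h4 : s ≤ K₁ * (1 + 8 * K₂) * (q ^ 2 * (1 / ε ^ 2)) := by
    have h5 : 1 + 2 * L ^ 2 / δ ≤ (1 + 8 * K₂) * q ^ 2 * (1 / ε) := by
      have h6 : 2 * L ^ 2 / δ = 2 * L ^ 2 * (K₂ * (1 / ε)) := by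
        rw [div_eq_mul_one_div, hδ, div_eq_mul_one_div K₂]
      have h7 : L ^ 2 ≤ (2 * q) ^ 2 := by gcongr
      have h8 : 2 * L ^ 2 * (K₂ * (1 / ε)) ≤ 2 * (2 * q) ^ 2 * (K₂ * (1 / ε)) := by gcongr
      have h9 : 1 ≤ q ^ 2 * (1 / ε) := one_le_mul_of_one_le_of_one_le hq1 hε1
      rw [h6]
      linarith
    calc s ≤ T * (1 + 2 * L ^ 2 / δ) := hs
      _ ≤ T * ((1 + 8 * K₂) * q ^ 2 * (1 / ε)) := by gcongr
      _ ≤ K₁ / ε * ((1 + 8 * K₂) * q ^ 2 * (1 / ε)) := by gcongr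
      _ = _ := by field_simp
  have h5 : 400 * (C + 2) * (n * m) * s ≤
      400 * (C + 2) * (K₁ * (1 + 8 * K₂)) * (Z * q ^ 2) := by
    calc 400 * (C + 2) * (n * m) * s
        ≤ 400 * (C + 2) * (n * m) * (K₁ * (1 + 8 * K₂) * (q ^ 2 * (1 / ε ^ 2))) := by gcongr
      _ = _ := by rw [hZ]; field_simp
  have hZq : 0 ≤ Z * q ^ 2 := by positivity
  have hYq : 0 ≤ Y * q ^ 2 := by positivity
  have h6 : 0 ≤ 160 * (C + 2) * (Z * q ^ 2) := by positivity
  have h7 : 0 ≤ (8 + 62 * K₁ + 400 * (C + 2) * (K₁ * (1 + 8 * K₂))) * (Y * q ^ 2) := by positivity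
  linarith

lemma implementation_spec {ω C : ℝ} {S : MulFamily} (hS : IsMulFamily ω C S) (hC : 0 ≤ C)
    (hω : 2 ≤ ω) (hω' : ω ≤ 5 / 2) {m n : ℕ} (hm : 0 < m) (hmn : m ≤ n)
    {A : Matrix (Fin m) (Fin n) ℝ} {b : Fin m → ℝ} {f : E n → ℝ} {ε Lφ C₀ β Δ : ℝ} {x₀ xstar : E n}
    (hε : 0 < ε) (hε' : ε ≤ 1) (hL : 0 < Lφ) (hβ : 0 < β) (hβ' : β ≤ 1 / 2)
    (hs : ConcaveSetting A b f ε Lφ C₀ x₀ xstar) (hgap : f x₀ - f xstar ≤ Δ) :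
    (∀ i, (implementation S m n (concaveLimit ε β C₀ (f x₀ - f xstar))).result f
      (concaveRun A f ε β Lφ x₀).input i =
        (concaveRun A f ε β Lφ x₀).output (concaveLimit ε β C₀ (f x₀ - f xstar)) i) ∧
    ((implementation S m n (concaveLimit ε β C₀ (f x₀ - f xstar))).steps f
      (concaveRun A f ε β Lφ x₀).input : ℝ) ≤
        (8 + 160 * (C + 2) + 62 * (2 * (|Δ| + |C₀| + 1) / (β * (1 - β)) + 1) +
          400 * (C + 2) * ((2 * (|Δ| + |C₀| + 1) / (β * (1 - β)) + 1) *
            (1 + 8 * (184 * Lφ / (1 - β))))) *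
        ((n : ℝ) * (m : ℝ) ^ (ω - 1) + (n : ℝ) * (m : ℝ) / ε ^ 2) *
          (1 + Real.log ((n : ℝ) / ε)) ^ 2 := by
  have hn : 0 < n := hm.trans_le hmn
  have hn1 : (1 : ℝ) ≤ n := by exact_mod_cast hn
  have hβ1 : 0 < 1 - β := by linarith
  set T := concaveLimit ε β C₀ (f x₀ - f xstar) with hT
  have hcost := (spec_main (W := ⟨0, 0, fun _ _ => rfl⟩) (κ := Fin n) hS hC hω hω' hm hmn hs hβ hβ'
    rfl T).toTree
  rw [implementation, dif_pos hm]
  refine ⟨hcost.1, hcost.2.trans ?_⟩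
  rw [Finset.sum_add_distrib, Finset.sum_const, Finset.card_range, nsmul_eq_mul, ← Finset.mul_sum]
  have hlog : 0 ≤ Real.log ((n : ℝ) / ε) := by
    refine Real.log_nonneg ?_
    rw [le_div_iff₀ hε]
    linarith
  refine total_cost_le hC (by positivity) (by positivity) hε hε' (by linarith) hn1
    (by exact_mod_cast hm) (by positivity) (Nat.cast_nonneg _) (clog_le_two_mul hn hε hε')
    (Nat.cast_nonneg _) (concaveLimit_le hβ hβ' hε hε' hgap) ?_
    (sum_sqrt_card_refreshed_le hs hε hL hβ hβ' T)
  change 1 / ((1 - β) * ε / (184 * Lφ)) = _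
  field_simp

end IPTR

end

theorem mainTheorem5 :
    (∀ β C₀ Δ : ℝ, 0 < β → β ≤ 1 / 2 → ∃ K : ℝ,
      ∀ (m n : ℕ), 0 < m → m ≤ n → ∀ (ε Lφ : ℝ), 0 < ε → ε ≤ 1 → 0 < Lφ →
      ∀ (A : Matrix (Fin m) (Fin n) ℝ) (b : Fin m → ℝ) (f : IPTR.E n → ℝ) (x₀ xstar : IPTR.E n),
        IPTR.ConcaveSetting A b f ε Lφ C₀ x₀ xstar → f x₀ - f xstar ≤ Δ →
        let D := IPTR.concaveRun A f ε β Lφ x₀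
        let T := IPTR.concaveLimit ε β C₀ (f x₀ - f xstar)
        (D.iterations T : ℝ) ≤ K / ε ∧
          (IPTR.IsApproxKKT A b f (2 * ε) (D.output T) ∨ f (D.output T) - f xstar ≤ ε)) ∧
    (∀ ω : ℝ, 2 ≤ ω → ω < 5 / 2 → IPTR.IsMatMulExponent ω →
      ∃ P : (m n T : ℕ) → IPTR.Tree (IPTR.Input m n) (Fin n) n,
      ∀ β C₀ Δ Lφ : ℝ, 0 < β → β ≤ 1 / 2 → 0 < Lφ → ∃ (K : ℝ) (p : ℕ),
      ∀ (m n : ℕ), 0 < m → m ≤ n → ∀ ε : ℝ, 0 < ε → ε ≤ 1 →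
      ∀ (A : Matrix (Fin m) (Fin n) ℝ) (b : Fin m → ℝ) (f : IPTR.E n → ℝ) (x₀ xstar : IPTR.E n),
        IPTR.ConcaveSetting A b f ε Lφ C₀ x₀ xstar → f x₀ - f xstar ≤ Δ →
        let D := IPTR.concaveRun A f ε β Lφ x₀
        let T := IPTR.concaveLimit ε β C₀ (f x₀ - f xstar)
        (∀ i, (P m n T).result f D.input i = D.output T i) ∧
          ((P m n T).steps f D.input : ℝ) ≤
            K * ((n : ℝ) * (m : ℝ) ^ (ω - 1) + (n : ℝ) * (m : ℝ) / ε ^ 2) *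
              (1 + Real.log ((n : ℝ) / ε)) ^ p) := by
  refine ⟨fun β C₀ Δ hβ hβ' => ⟨2 * (|Δ| + |C₀| + 1) / (β * (1 - β)) + 1, ?_⟩, ?_⟩
  · intro m n hm hmn ε Lφ hε hε' hL A b f x₀ xstar hs hgap D T
    refine ⟨?_, IPTR.output_isApproxKKT_or_le hs hε hL hβ hβ'⟩
    refine le_trans ?_ (IPTR.concaveLimit_le (C₀ := C₀) hβ hβ' hε hε' hgap)
    have := IPTR.loop_snd_le D T 0
    rw [zero_add] at this
    exact Nat.cast_le.mpr this
  · intro ω hω hω' hexp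
    obtain ⟨C, S, hC, hS⟩ := hexp.exists_mulFamily
    refine ⟨IPTR.implementation S, fun β C₀ Δ Lφ hβ hβ' hL =>
      ⟨8 + 160 * (C + 2) + 62 * (2 * (|Δ| + |C₀| + 1) / (β * (1 - β)) + 1) +
          400 * (C + 2) * ((2 * (|Δ| + |C₀| + 1) / (β * (1 - β)) + 1) *
            (1 + 8 * (184 * Lφ / (1 - β)))), 2, ?_⟩⟩
    intro m n hm hmn ε hε hε' A b f x₀ xstar hs hgap D T
    exact IPTR.implementation_spec hS hC hω hω'.le hm hmn hε hε' hL hβ hβ' hs hgap
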